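/- Let $K$ be a field of characteristic $0$ (e.g. $K=\mathbb C$). **Conventions.** For a finite dimensional Lie bialgebra $(\mathfrak h,\delta)$ over $K$, the dual $\mathfrak h^*$ is a Lie algebra by $[\xi,\eta]=(\xi\otimes\eta)\circ\delta$, the double is the Lie algebra $\mathfrak d(\mathfrak h)=\mathfrak h\oplus\mathfrak h^*$ whose canonical pairing $\langle-,-\rangle$ is invariant, and $H^*$ denotes the formal group of $\mathfrak h^*$, with function ring $K[[H^*]]=U(\mathfrak h^*)^*$. For $\xi\in\mathfrak h^*$ let $(\mathbf L_\xi f)(x)=\frac{d}{d\varepsilon}|_{\varepsilon=0}f(e^{-\varepsilon\xi}x)$ and $(\mathbf R_\xi f)(x)=\frac{d}{d\varepsilon}|_{\varepsilon=0}f(xe^{\varepsilon\xi})$; for $a\in\mathfrak h$ let $(\mathrm{dress}^L_af)(x)=-(\mathbf R_{(\mathrm{Ad}(x^{-1})a)_{\mathfrak h^*}}f)(x)$, where $(-)_{\mathfrak h^*}$ is the projection of $\mathfrak d(\mathfrak h)$ parallel to $\mathfrak h$; and let $\mathrm d^Lf=-\sum_ie_i\otimes\mathbf L_{\varepsilon^i}f$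 for dual bases $(e_i),(\varepsilon^i)$ of $\mathfrak h,\mathfrak h^*$. These derivations are extended to localizations $K[[H^*]][1/P]$, $P\ne0$. $\wedge^k(V)$ is the space of totally antisymmetric tensors in $V^{\otimes k}$, $\mathrm{Alt}$ is the sum over cyclic permutations of three tensor factors, and $\mathrm{CYB}(\rho)=[\rho^{1,2},\rho^{1,3}]+[\rho^{1,2},\rho^{2,3}]+[\rho^{1,3},\rho^{2,3}]$. Let $(\mathfrak a,\delta)$ be a Lie bialgebra, $\mathfrak h\subset\mathfrak a$ a finite dimensional Lie subbialgebra and $Z\in\wedge^3(\mathfrak a)^{\mathfrak a}$. A *Poisson–Lie (PL) dynamical $r$-matrix for $(H^*,\mathfrak a,Z)$* is an element $\rho\in\wedge^2(\mathfrak a)\otimes K[[H^*]][1/P]$, for some nonzero $P\in K[[H^*]]$, such that (a) $\mathrm{dress}^L_a(\rho)+[a\otimes1+1\otimes a,\rho]=0$ for all $a\in\mathfrak h$, and (b) $\mathrm{CYB}(\rho)+\mathrm{Alt}(\mathrm d^L\rho)+\mathrm{Alt}((\delta\otimes\mathrm{id})(\rho))=Z$. Let $(\mathfrak g,\delta)$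 be a finite dimensional Lie bialgebra with a splitting $\mathfrak g=\mathfrak l\oplus\mathfrak u$: $\mathfrak l$ is a Lie subbialgebra, $[\mathfrak l,\mathfrak u]\subset\mathfrak u$ and $\delta(\mathfrak u)\subset(\mathfrak l\otimes\mathfrak u)\oplus(\mathfrak u\otimes\mathfrak l)\oplus(\mathfrak u\otimes\mathfrak u)$. Assume that it is nondegenerate: for generic $\lambda\in\mathfrak l^*$ the form $(u,v)\mapsto\lambda([u,v]_{\mathfrak l})$ on $\mathfrak u$ is nondegenerate, where $(-)_{\mathfrak l}$ is the projection parallel to $\mathfrak u$. Extension of linear forms by $0$ on $\mathfrak u$ makes $\mathfrak l^*$ a Lie subalgebra of $\mathfrak g^*$ and gives a restriction map $K[[G^*]]\to K[[L^*]]$, $f\mapsto f_{|L^*}$. For $x\in L^*$ and $u,v\in\mathfrak u$ put $\omega_x(u,v)=\langle(\mathrm{Ad}(x^{-1})u)_{\mathfrak g},(\mathrm{Ad}(x^{-1})v)_{\mathfrak g^*}\rangle$, let $P_{\mathfrak l}^{\mathfrak g}\in K[[L^*]]$ be the determinant of $\omega_x$ in a basis of $\mathfrak u$, and let $\sigma_{\mathfrak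 l}^{\mathfrak g}=\sum_\alpha a_\alpha\otimes b_\alpha\otimes\ell_\alpha\in\wedge^2(\mathfrak u)\otimes K[[L^*]][1/P_{\mathfrak l}^{\mathfrak g}]$ be the inverse of $\omega_x$, i.e. $\sum_\alpha\omega_x(v,b_\alpha)\,\ell_\alpha(x)\,a_\alpha=v$ for all $v\in\mathfrak u$. **Theorem.** Let $\mathfrak g\subset\mathfrak a$ be an inclusion of Lie bialgebras and let $Z\in\wedge^3(\mathfrak a)^{\mathfrak a}$. Let $\rho\in\wedge^2(\mathfrak a)\otimes K[[G^*]][1/P]$ be a PL dynamical $r$-matrix for $(G^*,\mathfrak a,Z)$ whose denominator satisfies $P_{|L^*}\neq0$, so that $\rho_{|L^*}$ is defined. Then $P_{|L^*}P_{\mathfrak l}^{\mathfrak g}\ne0$ and $\rho_{|L^*}+\sigma_{\mathfrak l}^{\mathfrak g}\in\wedge^2(\mathfrak a)\otimes K[[L^*]][1/(P_{|L^*}P_{\mathfrak l}^{\mathfrak g})]$ is a PL dynamical $r$-matrix for $(L^*,\mathfrak a,Z)$. -/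

import Mathlib

open scoped TensorProduct

set_option linter.unusedSectionVars false
set_option maxSynthPendingDepth 3

section Envelope

attribute [local instance] LieRing.ofAssociativeRing

namespace UEnv

variable (K : Type*) [Field K] (L : Type*) [LieRing L] [LieAlgebra K L]


variable {K L} in
theorem algHom_ext {A : Type*} [Ring A] [Algebra K A]
    {F G : UniversalEnvelopingAlgebra K L →ₐ[K] A}
    (h : ∀ x : L, F (UniversalEnvelopingAlgebra.ι K x) = G (UniversalEnvelopingAlgebra.ι K x)) :
    F = G :=
  UniversalEnvelopingAlgebra.hom_ext K (LieHom.ext h)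

/-- The coproduct of the enveloping algebra: `x ↦ x ⊗ 1 + 1 ⊗ x` on `L`. -/
noncomputable def comulHom : (UniversalEnvelopingAlgebra K L) →ₐ[K] (UniversalEnvelopingAlgebra K L) ⊗[K] (UniversalEnvelopingAlgebra K L) :=
  UniversalEnvelopingAlgebra.lift K
    { toFun := fun x => (UniversalEnvelopingAlgebra.ι K x : (UniversalEnvelopingAlgebra K L)) ⊗ₜ[K] (1 : (UniversalEnvelopingAlgebra K L)) + (1 : (UniversalEnvelopingAlgebra K L)) ⊗ₜ[K] (UniversalEnvelopingAlgebra.ι K x : (UniversalEnvelopingAlgebra K L))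
      map_add' := by
        intro x y
        simp only [map_add, TensorProduct.add_tmul, TensorProduct.tmul_add]
        abel
      map_smul' := by
        intro c x
        simp only [map_smul, TensorProduct.smul_tmul', TensorProduct.tmul_smul, smul_add,
          RingHom.id_apply]
      map_lie' := by
        intro x y
        simp only [LieHom.map_lie, LieRing.of_associative_ring_bracket, mul_add, add_mul,
          Algebra.TensorProduct.tmul_mul_tmul, mul_one, one_mul, TensorProduct.sub_tmul,
          TensorProduct.tmul_sub]
        abel }

/-- The counit of the enveloping algebra: zero on `L`. -/
noncomputable def counitHom : (UniversalEnvelopingAlgebra K L) →ₐ[K] K :=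
  UniversalEnvelopingAlgebra.lift K 0

variable {L}

theorem comulHom_ι (x : L) :
    comulHom K L (UniversalEnvelopingAlgebra.ι K x) = (UniversalEnvelopingAlgebra.ι K x : (UniversalEnvelopingAlgebra K L)) ⊗ₜ[K] (1 : (UniversalEnvelopingAlgebra K L)) + (1 : (UniversalEnvelopingAlgebra K L)) ⊗ₜ[K] (UniversalEnvelopingAlgebra.ι K x : (UniversalEnvelopingAlgebra K L)) :=
  UniversalEnvelopingAlgebra.lift_ι_apply K _ x

theorem counitHom_ι (x : L) : counitHom K L (UniversalEnvelopingAlgebra.ι K x) = 0 :=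
  UniversalEnvelopingAlgebra.lift_ι_apply K _ x

variable (L)

/-- The standard bialgebra structure of the enveloping algebra. -/
noncomputable instance instBialgebra : Bialgebra K (UniversalEnvelopingAlgebra K L) :=
  Bialgebra.ofAlgHom (comulHom K L) (counitHom K L)
    (by
      apply algHom_ext
      intro x
      simp only [AlgHom.comp_apply, comulHom_ι, map_add,
        Algebra.TensorProduct.map_tmul, map_one, AlgHom.coe_id, id_eq, TensorProduct.add_tmul,
        TensorProduct.tmul_add, Algebra.TensorProduct.one_def]
      simp [Algebra.TensorProduct.assoc_tmul, add_assoc])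
    (by
      apply algHom_ext
      intro x
      simp [-UniversalEnvelopingAlgebra.ι_apply, comulHom_ι, counitHom_ι])
    (by
      apply algHom_ext
      intro x
      simp [-UniversalEnvelopingAlgebra.ι_apply, comulHom_ι, counitHom_ι])

variable {L}

theorem comul_ι (x : L) : Coalgebra.comul (R := K) (UniversalEnvelopingAlgebra.ι K x : (UniversalEnvelopingAlgebra K L)) =
    (UniversalEnvelopingAlgebra.ι K x : (UniversalEnvelopingAlgebra K L)) ⊗ₜ[K] (1 : (UniversalEnvelopingAlgebra K L)) + (1 : (UniversalEnvelopingAlgebra K L)) ⊗ₜ[K] (UniversalEnvelopingAlgebra.ι K x : (UniversalEnvelopingAlgebra K L)) :=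
  comulHom_ι K x

theorem counit_ι (x : L) : Coalgebra.counit (R := K) (UniversalEnvelopingAlgebra.ι K x : (UniversalEnvelopingAlgebra K L)) = 0 :=
  counitHom_ι K x

variable (L)

noncomputable instance instIsCocomm : Coalgebra.IsCocomm K (UniversalEnvelopingAlgebra K L) where
  comm_comp_comul := by
    have h : (Algebra.TensorProduct.comm K (UniversalEnvelopingAlgebra K L) (UniversalEnvelopingAlgebra K L)).toAlgHom.comp (comulHom K L) = comulHom K L := by
      apply algHom_ext
      intro x
      simp [-UniversalEnvelopingAlgebra.ι_apply, comulHom_ι, add_comm]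
    exact congrArg AlgHom.toLinearMap h

variable {K L} {L' : Type*} [LieRing L'] [LieAlgebra K L']

/-- Functoriality of the enveloping algebra. -/
noncomputable def map (f : L →ₗ⁅K⁆ L') :
    UniversalEnvelopingAlgebra K L →ₐ[K] UniversalEnvelopingAlgebra K L' :=
  UniversalEnvelopingAlgebra.lift K ((UniversalEnvelopingAlgebra.ι K).comp f)

theorem map_ι (f : L →ₗ⁅K⁆ L') (x : L) :
    map f (UniversalEnvelopingAlgebra.ι K x) = UniversalEnvelopingAlgebra.ι K (f x) :=
  UniversalEnvelopingAlgebra.lift_ι_apply K _ x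

theorem comul_map (f : L →ₗ⁅K⁆ L') (y : UniversalEnvelopingAlgebra K L) :
    Coalgebra.comul (R := K) (map f y) =
      TensorProduct.map (map f).toLinearMap (map f).toLinearMap (Coalgebra.comul (R := K) y) := by
  have h : (comulHom K L').comp (map f) =
      (Algebra.TensorProduct.map (map f) (map f)).comp (comulHom K L) := by
    apply algHom_ext
    intro x
    simp [-UniversalEnvelopingAlgebra.ι_apply, comulHom_ι, map_ι]
  exact congrArg (fun F => F y) h

theorem counit_map (f : L →ₗ⁅K⁆ L') (y : UniversalEnvelopingAlgebra K L) :
    Coalgebra.counit (R := K) (map f y) = Coalgebra.counit (R := K) y := by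
  have h : (counitHom K L').comp (map f) = counitHom K L := by
    apply algHom_ext
    intro x
    simp [-UniversalEnvelopingAlgebra.ι_apply, counitHom_ι, map_ι]
  exact congrArg (fun F => F y) h

end UEnv

end Envelope

/-- The cyclic permutation `x ⊗ y ⊗ z ↦ y ⊗ z ⊗ x`. -/
noncomputable def cyc (K : Type*) [Field K] (V : Type*) [AddCommGroup V] [Module K V] :
    (V ⊗[K] V) ⊗[K] V →ₗ[K] (V ⊗[K] V) ⊗[K] V :=
  (TensorProduct.comm K V (V ⊗[K] V)).toLinearMap ∘ₗ (TensorProduct.assoc K V V V).toLinearMap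

/-- The sum of the cyclic permutations. -/
noncomputable def Alt (K : Type*) [Field K] (V : Type*) [AddCommGroup V] [Module K V] :
    (V ⊗[K] V) ⊗[K] V →ₗ[K] (V ⊗[K] V) ⊗[K] V :=
  LinearMap.id + cyc K V + cyc K V ∘ₗ cyc K V

/-- A Lie bialgebra structure on a Lie algebra: an antisymmetric cobracket which satisfies the
co-Jacobi identity and is a 1-cocycle for the adjoint action on `𝔤 ⊗ 𝔤`. -/
class LieBialgebra (K : Type*) [Field K] (𝔤 : Type*) [LieRing 𝔤] [LieAlgebra K 𝔤] where
  δ : 𝔤 →ₗ[K] 𝔤 ⊗[K] 𝔤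
  antisymm : ∀ x, TensorProduct.comm K 𝔤 𝔤 (δ x) = -δ x
  coJacobi : ∀ x, Alt K 𝔤 (δ.rTensor 𝔤 (δ x)) = 0
  cocycle : ∀ x y, δ ⁅x, y⁆ = ⁅x, δ y⁆ - ⁅y, δ x⁆

namespace LieBialgebra

variable {K : Type*} [Field K] [CharZero K] {𝔤 : Type*} [LieRing 𝔤] [LieAlgebra K 𝔤]

/-- The pairing of `ξ ⊗ η` with a tensor in `𝔤 ⊗ 𝔤`. -/
noncomputable def pair (ξ η : Module.Dual K 𝔤) : 𝔤 ⊗[K] 𝔤 →ₗ[K] K :=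
  LinearMap.mul' K K ∘ₗ TensorProduct.map ξ η

/-- The contraction `ξ ⊗ id : 𝔤 ⊗ 𝔤 → 𝔤`. -/
noncomputable def contract (ξ : Module.Dual K 𝔤) : 𝔤 ⊗[K] 𝔤 →ₗ[K] 𝔤 :=
  (TensorProduct.lid K 𝔤).toLinearMap ∘ₗ ξ.rTensor 𝔤

@[simp] theorem pair_tmul (ξ η : Module.Dual K 𝔤) (x y : 𝔤) :
    pair ξ η (x ⊗ₜ[K] y) = ξ x * η y := rfl

@[simp] theorem contract_tmul (ξ : Module.Dual K 𝔤) (x y : 𝔤) :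
    contract ξ (x ⊗ₜ[K] y) = ξ x • y := rfl

theorem pair_eq_contract (ξ η : Module.Dual K 𝔤) (t : 𝔤 ⊗[K] 𝔤) :
    pair ξ η t = η (contract ξ t) := by
  induction t with
  | zero => simp
  | tmul x y => simp
  | add s t hs ht => simp [hs, ht]

theorem pair_comm (ξ η : Module.Dual K 𝔤) (t : 𝔤 ⊗[K] 𝔤) :
    pair ξ η (TensorProduct.comm K 𝔤 𝔤 t) = pair η ξ t := by
  induction t with
  | zero => simp
  | tmul x y => simp [mul_comm]
  | add s t hs ht => simp [hs, ht]

theorem pair_add_left (ξ ξ' η : Module.Dual K 𝔤) (t : 𝔤 ⊗[K] 𝔤) :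
    pair (ξ + ξ') η t = pair ξ η t + pair ξ' η t := by
  simp [pair, TensorProduct.map_add_left]

theorem pair_add_right (ξ η η' : Module.Dual K 𝔤) (t : 𝔤 ⊗[K] 𝔤) :
    pair ξ (η + η') t = pair ξ η t + pair ξ η' t := by
  simp [pair, TensorProduct.map_add_right]

theorem pair_smul_right (c : K) (ξ η : Module.Dual K 𝔤) (t : 𝔤 ⊗[K] 𝔤) :
    pair ξ (c • η) t = c * pair ξ η t := by
  simp [pair, TensorProduct.map_smul_right]

theorem contract_add (ξ ξ' : Module.Dual K 𝔤) (t : 𝔤 ⊗[K] 𝔤) :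
    contract (ξ + ξ') t = contract ξ t + contract ξ' t := by
  simp [contract, LinearMap.rTensor_add]

theorem contract_smul (c : K) (ξ : Module.Dual K 𝔤) (t : 𝔤 ⊗[K] 𝔤) :
    contract (c • ξ) t = c • contract ξ t := by
  simp [contract, LinearMap.rTensor_smul]

variable [LieBialgebra K 𝔤]

/-- The bracket of the dual Lie algebra: `⟨[ξ, η], x⟩ = ⟨ξ ⊗ η, δ x⟩`. -/
noncomputable def dualBracket (ξ η : Module.Dual K 𝔤) : Module.Dual K 𝔤 := pair ξ η ∘ₗ δ

theorem dualBracket_apply (ξ η : Module.Dual K 𝔤) (x : 𝔤) :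
    dualBracket ξ η x = pair ξ η (δ x) := rfl

theorem pair_δ_swap (ξ η : Module.Dual K 𝔤) (x : 𝔤) :
    pair ξ η (δ (K := K) x) = -pair η ξ (δ (K := K) x) := by
  rw [← pair_comm, antisymm, map_neg]

/-- The pairing of `ξ ⊗ η ⊗ ζ` with a tensor in `𝔤 ⊗ 𝔤 ⊗ 𝔤`. -/
noncomputable def pair₃ (ξ η ζ : Module.Dual K 𝔤) : (𝔤 ⊗[K] 𝔤) ⊗[K] 𝔤 →ₗ[K] K :=
  LinearMap.mul' K K ∘ₗ TensorProduct.map (pair ξ η) ζ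

theorem pair₃_cyc (ξ η ζ : Module.Dual K 𝔤) (t : (𝔤 ⊗[K] 𝔤) ⊗[K] 𝔤) :
    pair₃ ξ η ζ (cyc K 𝔤 t) = pair₃ ζ ξ η t := by
  have h : pair₃ ξ η ζ ∘ₗ cyc K 𝔤 = pair₃ ζ ξ η := by
    apply TensorProduct.ext_threefold
    intro x y z
    simp [pair₃, cyc]
    ring
  exact LinearMap.congr_fun h t

theorem pair_dualBracket_left (ξ η ζ : Module.Dual K 𝔤) (t : 𝔤 ⊗[K] 𝔤) :
    pair (dualBracket ξ η) ζ t = pair₃ ξ η ζ ((δ (K := K)).rTensor 𝔤 t) := by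
  induction t with
  | zero => simp
  | tmul x y => simp [pair₃, dualBracket_apply]
  | add s t hs ht => simp [hs, ht]

theorem dual_jacobi (ξ η ζ : Module.Dual K 𝔤) (x : 𝔤) :
    pair (dualBracket ξ η) ζ (δ (K := K) x) + pair (dualBracket ζ ξ) η (δ (K := K) x) +
      pair (dualBracket η ζ) ξ (δ (K := K) x) = 0 := by
  have h := congrArg (pair₃ ξ η ζ) (coJacobi (K := K) x)
  simpa [Alt, pair₃_cyc, ← pair_dualBracket_left] using h

theorem dualBracket_swap (ξ η : Module.Dual K 𝔤) : dualBracket ξ η = -dualBracket η ξ := by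
  ext x
  exact pair_δ_swap ξ η x

theorem pair_neg_left (ξ η : Module.Dual K 𝔤) (t : 𝔤 ⊗[K] 𝔤) :
    pair (-ξ) η t = -pair ξ η t := by
  have := pair_add_left ξ (-ξ) η t
  simp only [add_neg_cancel] at this
  have h0 : pair (0 : Module.Dual K 𝔤) η t = 0 := by simp [pair]
  rw [h0] at this
  exact (neg_eq_of_add_eq_zero_right this.symm).symm

/-- The dual Lie algebra `𝔤*`. -/
noncomputable instance dualLieRing : LieRing (Module.Dual K 𝔤) where
  bracket := dualBracket
  add_lie ξ η ζ := by
    ext x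
    exact pair_add_left ξ η ζ (δ x)
  lie_add ξ η ζ := by
    ext x
    exact pair_add_right ξ η ζ (δ x)
  lie_self ξ := by
    ext x
    exact self_eq_neg.mp (pair_δ_swap ξ ξ x)
  leibniz_lie ξ η ζ := by
    ext x
    change pair ξ (dualBracket η ζ) (δ (K := K) x) =
      pair (dualBracket ξ η) ζ (δ (K := K) x) + pair η (dualBracket ξ ζ) (δ (K := K) x)
    have h := dual_jacobi ξ η ζ x
    rw [dualBracket_swap ζ ξ, pair_neg_left, pair_δ_swap (dualBracket ξ ζ) η,
      pair_δ_swap (dualBracket η ζ) ξ] at h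
    linear_combination -h

theorem dual_lie_apply (ξ η : Module.Dual K 𝔤) (x : 𝔤) :
    ⁅ξ, η⁆ x = pair ξ η (δ (K := K) x) := rfl

noncomputable instance dualLieAlgebra : LieAlgebra K (Module.Dual K 𝔤) where
  lie_smul c ξ η := by
    ext x
    exact pair_smul_right c ξ η (δ x)

/-- `ξ ↦ ξ ∘ ad x`. -/
noncomputable def compAd (x : 𝔤) (ξ : Module.Dual K 𝔤) : Module.Dual K 𝔤 :=
  ξ ∘ₗ (LieModule.toEnd K 𝔤 𝔤 x : 𝔤 →ₗ[K] 𝔤)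

@[simp] theorem compAd_apply (x y : 𝔤) (ξ : Module.Dual K 𝔤) : compAd x ξ y = ξ ⁅x, y⁆ := rfl

theorem contract_lie (ξ : Module.Dual K 𝔤) (x : 𝔤) (t : 𝔤 ⊗[K] 𝔤) :
    contract ξ ⁅x, t⁆ = ⁅x, contract ξ t⁆ + contract (compAd x ξ) t := by
  induction t with
  | zero => simp
  | tmul a b => simp [TensorProduct.LieModule.lie_tmul_right, add_comm]
  | add s t hs ht =>
    simp only [lie_add, map_add, hs, ht]
    abel

theorem apply_contract_δ (ξ η : Module.Dual K 𝔤) (x : 𝔤) :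
    η (contract ξ (δ (K := K) x)) = ⁅ξ, η⁆ x := (pair_eq_contract ξ η (δ x)).symm

theorem contract_δ_lie (ξ : Module.Dual K 𝔤) (x y : 𝔤) :
    contract ξ (δ (K := K) ⁅x, y⁆) =
      ⁅x, contract ξ (δ (K := K) y)⁆ + contract (compAd x ξ) (δ (K := K) y)
        - ⁅y, contract ξ (δ (K := K) x)⁆ - contract (compAd y ξ) (δ (K := K) x) := by
  rw [cocycle, map_sub, contract_lie, contract_lie]
  abel

theorem contract_lie_δ (ξ η : Module.Dual K 𝔤) (x : 𝔤) :
    contract ⁅ξ, η⁆ (δ (K := K) x) =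
      contract η (δ (K := K) (contract ξ (δ (K := K) x)))
        - contract ξ (δ (K := K) (contract η (δ (K := K) x))) := by
  rw [← sub_eq_zero, ← Module.forall_dual_apply_eq_zero_iff K]
  intro ζ
  simp only [map_sub, apply_contract_δ]
  have h := LinearMap.congr_fun (leibniz_lie ξ η ζ) x
  simp only [LinearMap.add_apply] at h
  rw [h]
  ring

theorem lie_compAd (ξ η : Module.Dual K 𝔤) (x : 𝔤) :
    compAd x ⁅ξ, η⁆ = ⁅compAd x ξ, η⁆ + ⁅ξ, compAd x η⁆
      + compAd (contract ξ (δ (K := K) x)) η - compAd (contract η (δ (K := K) x)) ξ := by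
  ext w
  have e : ⁅ξ, η⁆ ⁅x, w⁆ = η (contract ξ (δ (K := K) ⁅x, w⁆)) := (apply_contract_δ ξ η _).symm
  have e1 : η ⁅x, contract ξ (δ (K := K) w)⁆ = ⁅ξ, compAd x η⁆ w :=
    apply_contract_δ ξ (compAd x η) w
  have e2 : η (contract (compAd w ξ) (δ (K := K) x)) = -ξ ⁅w, contract η (δ (K := K) x)⁆ := by
    rw [apply_contract_δ, ← lie_skew, LinearMap.neg_apply, ← apply_contract_δ]
    rfl
  simp only [compAd_apply, LinearMap.sub_apply, LinearMap.add_apply]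
  rw [e, contract_δ_lie]
  simp only [map_sub, map_add]
  rw [e1, apply_contract_δ (compAd x ξ) η w, e2, ← lie_skew w (contract ξ _),
    ← lie_skew w (contract η _)]
  simp only [map_neg]
  ring

variable (K 𝔤) in
/-- The underlying space `𝔤 ⊕ 𝔤*` of the Drinfeld double. -/
def Double : Type _ := 𝔤 × Module.Dual K 𝔤

noncomputable instance doubleAddCommGroup : AddCommGroup (Double K 𝔤) :=
  inferInstanceAs (AddCommGroup (𝔤 × Module.Dual K 𝔤))

noncomputable instance doubleModule : Module K (Double K 𝔤) :=
  inferInstanceAs (Module K (𝔤 × Module.Dual K 𝔤))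

namespace Double

variable (K 𝔤) in
/-- The projection `𝔤 ⊕ 𝔤* → 𝔤`. -/
def fst : Double K 𝔤 →ₗ[K] 𝔤 := LinearMap.fst K 𝔤 (Module.Dual K 𝔤)

variable (K 𝔤) in
/-- The projection `𝔤 ⊕ 𝔤* → 𝔤*`. -/
def snd : Double K 𝔤 →ₗ[K] Module.Dual K 𝔤 := LinearMap.snd K 𝔤 (Module.Dual K 𝔤)

variable (K 𝔤) in
/-- The inclusion of `𝔤`. -/
def inl : 𝔤 →ₗ[K] Double K 𝔤 := LinearMap.inl K 𝔤 (Module.Dual K 𝔤)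

variable (K 𝔤) in
/-- The inclusion of `𝔤*`. -/
def inr : Module.Dual K 𝔤 →ₗ[K] Double K 𝔤 := LinearMap.inr K 𝔤 (Module.Dual K 𝔤)

@[ext] theorem ext' {a b : Double K 𝔤} (h₁ : fst K 𝔤 a = fst K 𝔤 b)
    (h₂ : snd K 𝔤 a = snd K 𝔤 b) : a = b := Prod.ext h₁ h₂

@[simp] theorem fst_inl (x : 𝔤) : fst K 𝔤 (inl K 𝔤 x) = x := rfl
@[simp] theorem snd_inl (x : 𝔤) : snd K 𝔤 (inl K 𝔤 x) = 0 := rfl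
@[simp] theorem fst_inr (ξ : Module.Dual K 𝔤) : fst K 𝔤 (inr K 𝔤 ξ) = 0 := rfl
@[simp] theorem snd_inr (ξ : Module.Dual K 𝔤) : snd K 𝔤 (inr K 𝔤 ξ) = ξ := rfl

/-- The bracket of the Drinfeld double: `𝔤` and `𝔤*` are subalgebras and
`[x, η] = (η ⊗ id)(δ x) - η ∘ ad x`, which is the bracket that makes the canonical form
invariant. -/
noncomputable instance instBracket : Bracket (Double K 𝔤) (Double K 𝔤) where
  bracket a b :=
    ((⁅fst K 𝔤 a, fst K 𝔤 b⁆ + contract (snd K 𝔤 b) (δ (K := K) (fst K 𝔤 a))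
        - contract (snd K 𝔤 a) (δ (K := K) (fst K 𝔤 b)),
      ⁅snd K 𝔤 a, snd K 𝔤 b⁆ - compAd (fst K 𝔤 a) (snd K 𝔤 b)
        + compAd (fst K 𝔤 b) (snd K 𝔤 a)) : 𝔤 × Module.Dual K 𝔤)

theorem fst_lie (a b : Double K 𝔤) : fst K 𝔤 ⁅a, b⁆ =
    ⁅fst K 𝔤 a, fst K 𝔤 b⁆ + contract (snd K 𝔤 b) (δ (K := K) (fst K 𝔤 a))
      - contract (snd K 𝔤 a) (δ (K := K) (fst K 𝔤 b)) := rfl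

theorem snd_lie (a b : Double K 𝔤) : snd K 𝔤 ⁅a, b⁆ =
    ⁅snd K 𝔤 a, snd K 𝔤 b⁆ - compAd (fst K 𝔤 a) (snd K 𝔤 b)
      + compAd (fst K 𝔤 b) (snd K 𝔤 a) := rfl

theorem compAd_add_left (x y : 𝔤) (ξ : Module.Dual K 𝔤) :
    compAd (x + y) ξ = compAd x ξ + compAd y ξ := by ext; simp
theorem compAd_sub_left (x y : 𝔤) (ξ : Module.Dual K 𝔤) :
    compAd (x - y) ξ = compAd x ξ - compAd y ξ := by ext; simp
theorem compAd_add_right (x : 𝔤) (ξ η : Module.Dual K 𝔤) :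
    compAd x (ξ + η) = compAd x ξ + compAd x η := by ext; simp
theorem compAd_sub_right (x : 𝔤) (ξ η : Module.Dual K 𝔤) :
    compAd x (ξ - η) = compAd x ξ - compAd x η := by ext; simp
theorem compAd_smul_left (c : K) (x : 𝔤) (ξ : Module.Dual K 𝔤) :
    compAd (c • x) ξ = c • compAd x ξ := by ext; simp
theorem compAd_smul_right (c : K) (x : 𝔤) (ξ : Module.Dual K 𝔤) :
    compAd x (c • ξ) = c • compAd x ξ := by ext; simp
theorem compAd_lie (x y : 𝔤) (ξ : Module.Dual K 𝔤) :
    compAd ⁅x, y⁆ ξ = compAd y (compAd x ξ) - compAd x (compAd y ξ) := by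
  ext; simp
theorem contract_sub (ξ η : Module.Dual K 𝔤) (t : 𝔤 ⊗[K] 𝔤) :
    contract (ξ - η) t = contract ξ t - contract η t := by
  simp [contract, LinearMap.rTensor_sub]

/-- The Drinfeld double `𝔡(𝔤) = 𝔤 ⊕ 𝔤*` as a Lie algebra. -/
noncomputable instance instLieRing : LieRing (Double K 𝔤) where
  add_lie a b c := by
    ext1
    · simp only [fst_lie, map_add, add_lie, contract_add]
      abel
    · simp only [snd_lie, map_add, add_lie, compAd_add_left, compAd_add_right]
      abel
  lie_add a b c := by
    ext1
    · simp only [fst_lie, map_add, lie_add, contract_add]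
      abel
    · simp only [snd_lie, map_add, lie_add, compAd_add_left, compAd_add_right]
      abel
  lie_self a := by
    ext1
    · simp [fst_lie]
    · simp [snd_lie]
  leibniz_lie a b c := by
    ext1
    · simp only [fst_lie, snd_lie, map_add, map_sub, lie_add, add_lie, lie_sub, sub_lie,
        contract_add, contract_sub, contract_δ_lie, contract_lie_δ]
      rw [leibniz_lie (fst K 𝔤 a)]
      simp only [← lie_skew (fst K 𝔤 b) (contract _ _), ← lie_skew (fst K 𝔤 c) (contract _ _),
        ← lie_skew (fst K 𝔤 a) (contract _ _)]
      abel
    · simp only [fst_lie, snd_lie, map_add, lie_add, add_lie, lie_sub, sub_lie,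
        compAd_add_left, compAd_add_right, compAd_sub_left, compAd_sub_right, compAd_lie,
        lie_compAd]
      rw [leibniz_lie (snd K 𝔤 a)]
      simp only [← lie_skew (snd K 𝔤 b) (compAd _ (snd K 𝔤 a))]
      abel

noncomputable instance instLieAlgebra : LieAlgebra K (Double K 𝔤) where
  lie_smul c a b := by
    ext1
    · simp only [fst_lie, map_smul, lie_smul, contract_smul, smul_add, smul_sub]
    · simp only [snd_lie, map_smul, lie_smul, compAd_smul_left, compAd_smul_right, smul_add,
        smul_sub]

theorem inr_lie (ξ η : Module.Dual K 𝔤) :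
    inr K 𝔤 ⁅ξ, η⁆ = ⁅inr K 𝔤 ξ, inr K 𝔤 η⁆ := by
  ext1
  · simp [fst_lie]
  · simp [snd_lie, compAd]

end Double

end LieBialgebra

section FormalGroup

attribute [local instance] LieRing.ofAssociativeRing

open LieBialgebra

/-- The function ring `K[[H*]] = U(𝔥*)*` of the formal group `H*` with Lie algebra `𝔥*`. -/
def FormalFun (K : Type*) [Field K] [CharZero K] (𝔥 : Type*) [LieRing 𝔥] [LieAlgebra K 𝔥]
    [LieBialgebra K 𝔥] : Type _ :=
  WithConv (UniversalEnvelopingAlgebra K (Module.Dual K 𝔥) →ₗ[K] K)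

namespace FormalFun

variable {K : Type*} [Field K] [CharZero K] {𝔥 : Type*} [LieRing 𝔥] [LieAlgebra K 𝔥]
  [LieBialgebra K 𝔥]

/-- The product of `K[[H*]]` is the convolution product, dual to the coproduct of `U(𝔥*)`. -/
noncomputable instance instCommRing : CommRing (FormalFun K 𝔥) :=
  inferInstanceAs
    (CommRing (WithConv (UniversalEnvelopingAlgebra K (Module.Dual K 𝔥) →ₗ[K] K)))

noncomputable instance instAlgebra : Algebra K (FormalFun K 𝔥) :=
  inferInstanceAs
    (Algebra K (WithConv (UniversalEnvelopingAlgebra K (Module.Dual K 𝔥) →ₗ[K] K)))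

/-- The function on `H*` given by a linear form on `U(𝔥*)`. -/
def mk (φ : UniversalEnvelopingAlgebra K (Module.Dual K 𝔥) →ₗ[K] K) : FormalFun K 𝔥 :=
  WithConv.toConv φ

/-- The linear form on `U(𝔥*)` given by a function on `H*`. -/
def eval (f : FormalFun K 𝔥) : UniversalEnvelopingAlgebra K (Module.Dual K 𝔥) →ₗ[K] K :=
  WithConv.ofConv f

@[ext] theorem ext' {f g : FormalFun K 𝔥} (h : ∀ y, f.eval y = g.eval y) : f = g :=
  WithConv.ofConv_injective (LinearMap.ext h)

@[simp] theorem eval_mk (φ : UniversalEnvelopingAlgebra K (Module.Dual K 𝔥) →ₗ[K] K) :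
    (mk φ).eval = φ := rfl
@[simp] theorem eval_add (f g : FormalFun K 𝔥) : (f + g).eval = f.eval + g.eval := rfl
@[simp] theorem eval_zero : (0 : FormalFun K 𝔥).eval = 0 := rfl
@[simp] theorem eval_smul (c : K) (f : FormalFun K 𝔥) : (c • f).eval = c • f.eval := rfl

theorem eval_one (y : UniversalEnvelopingAlgebra K (Module.Dual K 𝔥)) :
    (1 : FormalFun K 𝔥).eval y = Coalgebra.counit (R := K) y := rfl

theorem eval_mul (f g : FormalFun K 𝔥) (y : UniversalEnvelopingAlgebra K (Module.Dual K 𝔥)) :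
    (f * g).eval y =
      LinearMap.mul' K K (TensorProduct.map f.eval g.eval (Coalgebra.comul (R := K) y)) := rfl

theorem eval_algebraMap (c : K) (y : UniversalEnvelopingAlgebra K (Module.Dual K 𝔥)) :
    (algebraMap K (FormalFun K 𝔥) c).eval y = c * Coalgebra.counit (R := K) y := rfl

theorem pairing_left (f g : UniversalEnvelopingAlgebra K (Module.Dual K 𝔥) →ₗ[K] K)
    (a : UniversalEnvelopingAlgebra K (Module.Dual K 𝔥))
    (t : UniversalEnvelopingAlgebra K (Module.Dual K 𝔥) ⊗[K]
      UniversalEnvelopingAlgebra K (Module.Dual K 𝔥)) :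
    LinearMap.mul' K K (TensorProduct.map f g ((a ⊗ₜ[K] 1 + 1 ⊗ₜ[K] a) * t)) =
      LinearMap.mul' K K (TensorProduct.map (f ∘ₗ LinearMap.mulLeft K a) g t) +
        LinearMap.mul' K K (TensorProduct.map f (g ∘ₗ LinearMap.mulLeft K a) t) := by
  induction t with
  | zero => simp
  | tmul x y => simp [add_mul]
  | add s t hs ht =>
    simp only [mul_add, map_add, hs, ht]
    ring

theorem pairing_right (f g : UniversalEnvelopingAlgebra K (Module.Dual K 𝔥) →ₗ[K] K)
    (a : UniversalEnvelopingAlgebra K (Module.Dual K 𝔥))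
    (t : UniversalEnvelopingAlgebra K (Module.Dual K 𝔥) ⊗[K]
      UniversalEnvelopingAlgebra K (Module.Dual K 𝔥)) :
    LinearMap.mul' K K (TensorProduct.map f g (t * (a ⊗ₜ[K] 1 + 1 ⊗ₜ[K] a))) =
      LinearMap.mul' K K (TensorProduct.map (f ∘ₗ LinearMap.mulRight K a) g t) +
        LinearMap.mul' K K (TensorProduct.map f (g ∘ₗ LinearMap.mulRight K a) t) := by
  induction t with
  | zero => simp
  | tmul x y => simp [mul_add]
  | add s t hs ht =>
    simp only [add_mul, map_add, hs, ht]
    ring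

/-- The left translation `(L_ξ f)(x) = d/dε f(e^{-εξ} x)`, that is `(L_ξ f)(y) = f(-ξ y)` for
`y ∈ U(𝔥*)`. -/
noncomputable def leftDer (ξ : Module.Dual K 𝔥) :
    Derivation K (FormalFun K 𝔥) (FormalFun K 𝔥) :=
  Derivation.mk'
    { toFun := fun f => mk
        (-(f.eval ∘ₗ LinearMap.mulLeft K (UniversalEnvelopingAlgebra.ι K ξ)))
      map_add' := by
        intro f g
        ext y
        simp [add_comm]
      map_smul' := by
        intro c f
        ext y
        simp }
    (by
      intro f g
      ext y
      have h := pairing_left f.eval g.eval (UniversalEnvelopingAlgebra.ι K ξ)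
        (Coalgebra.comul (R := K) y)
      rw [← UEnv.comul_ι, ← Bialgebra.comul_mul] at h
      rw [smul_eq_mul, smul_eq_mul, mul_comm g, eval_add, LinearMap.add_apply, eval_mul, eval_mul]
      change -(f * g).eval (UniversalEnvelopingAlgebra.ι K ξ * y) =
        LinearMap.mul' K K (TensorProduct.map f.eval
          (-(g.eval ∘ₗ LinearMap.mulLeft K (UniversalEnvelopingAlgebra.ι K ξ)))
          (Coalgebra.comul (R := K) y)) +
        LinearMap.mul' K K (TensorProduct.map
          (-(f.eval ∘ₗ LinearMap.mulLeft K (UniversalEnvelopingAlgebra.ι K ξ))) g.eval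
          (Coalgebra.comul (R := K) y))
      rw [eval_mul]
      rw [h, ← neg_one_smul K (g.eval ∘ₗ _), ← neg_one_smul K (f.eval ∘ₗ _),
        TensorProduct.map_smul_left, TensorProduct.map_smul_right]
      simp only [LinearMap.smul_apply, map_smul, smul_eq_mul]
      ring)

theorem leftDer_apply (ξ : Module.Dual K 𝔥) (f : FormalFun K 𝔥)
    (y : UniversalEnvelopingAlgebra K (Module.Dual K 𝔥)) :
    (leftDer ξ f).eval y = -f.eval (UniversalEnvelopingAlgebra.ι K ξ * y) := rfl

/-- The right translation `(R_ξ f)(x) = d/dε f(x e^{εξ})`, that is `(R_ξ f)(y) = f(y ξ)` for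
`y ∈ U(𝔥*)`. -/
noncomputable def rightDer (ξ : Module.Dual K 𝔥) :
    Derivation K (FormalFun K 𝔥) (FormalFun K 𝔥) :=
  Derivation.mk'
    { toFun := fun f => mk
        (f.eval ∘ₗ LinearMap.mulRight K (UniversalEnvelopingAlgebra.ι K ξ))
      map_add' := by
        intro f g
        ext y
        simp
      map_smul' := by
        intro c f
        ext y
        simp }
    (by
      intro f g
      ext y
      have h := pairing_right f.eval g.eval (UniversalEnvelopingAlgebra.ι K ξ)
        (Coalgebra.comul (R := K) y)
      rw [← UEnv.comul_ι, ← Bialgebra.comul_mul] at h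
      rw [smul_eq_mul, smul_eq_mul, mul_comm g, add_comm]
      exact h)

theorem rightDer_apply (ξ : Module.Dual K 𝔥) (f : FormalFun K 𝔥)
    (y : UniversalEnvelopingAlgebra K (Module.Dual K 𝔥)) :
    (rightDer ξ f).eval y = f.eval (y * UniversalEnvelopingAlgebra.ι K ξ) := rfl

variable (K 𝔥) in
/-- The action `x ↦ Ad(x⁻¹)` of `H*` on `𝔡(𝔥)`, as the antihomomorphism
`U(𝔥*) → End(𝔡(𝔥))` that extends `ξ ↦ -ad ξ`. -/
noncomputable def adInv :
    UniversalEnvelopingAlgebra K (Module.Dual K 𝔥) →ₐ[K] (Module.End K (Double K 𝔥))ᵐᵒᵖ :=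
  UniversalEnvelopingAlgebra.lift K
    { toFun := fun ξ =>
        -MulOpposite.op (LieModule.toEnd K (Double K 𝔥) (Double K 𝔥) (Double.inr K 𝔥 ξ))
      map_add' := by
        intro ξ η
        simp only [map_add, MulOpposite.op_add, neg_add]
      map_smul' := by
        intro c ξ
        simp only [map_smul, MulOpposite.op_smul, smul_neg, RingHom.id_apply]
      map_lie' := by
        intro ξ η
        rw [Double.inr_lie, LieHom.map_lie]
        apply MulOpposite.unop_injective
        simp [LieRing.of_associative_ring_bracket] }

/-- The function `x ↦ φ(Ad(x⁻¹) v)` on `H*`. -/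
noncomputable def adInvCoeff (φ : Module.Dual K (Double K 𝔥)) (v : Double K 𝔥) :
    FormalFun K 𝔥 :=
  mk
    { toFun := fun y => φ ((adInv K 𝔥 y).unop v)
      map_add' := by
        intro y z
        simp
      map_smul' := by
        intro c y
        simp }

section Finite

variable [FiniteDimensional K 𝔥]

/-- The left dressing action of `𝔡(𝔥)`:
`(dress_a f)(x) = -(R_{(Ad(x⁻¹) a)_{𝔥*}} f)(x)`. The `𝔥*`-component is expanded in the basis dual
to a basis `e` of `𝔥`. -/
noncomputable def dress (a : Double K 𝔥) : Derivation K (FormalFun K 𝔥) (FormalFun K 𝔥) :=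
  -∑ i, adInvCoeff (Module.Dual.eval K 𝔥 (Module.finBasis K 𝔥 i) ∘ₗ Double.snd K 𝔥) a •
    rightDer ((Module.finBasis K 𝔥).coord i)

/-- The function `x ↦ ⟨(Ad(x⁻¹) u)_𝔥, (Ad(x⁻¹) v)_{𝔥*}⟩` on `H*`. -/
noncomputable def omega (u v : Double K 𝔥) : FormalFun K 𝔥 :=
  ∑ i, adInvCoeff ((Module.finBasis K 𝔥).coord i ∘ₗ Double.fst K 𝔥) u *
    adInvCoeff (Module.Dual.eval K 𝔥 (Module.finBasis K 𝔥 i) ∘ₗ Double.snd K 𝔥) v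

end Finite

variable {𝔩 : Type*} [LieRing 𝔩] [LieAlgebra K 𝔩] [LieBialgebra K 𝔩]

/-- The restriction `K[[G*]] → K[[L*]]` along a morphism of Lie algebras `𝔩* → 𝔤*`. -/
noncomputable def comap (f : Module.Dual K 𝔩 →ₗ⁅K⁆ Module.Dual K 𝔥) :
    FormalFun K 𝔥 →ₐ[K] FormalFun K 𝔩 where
  toFun F := mk (F.eval ∘ₗ (UEnv.map f).toLinearMap)
  map_one' := by
    ext y
    exact UEnv.counit_map f y
  map_mul' F G := by
    ext y
    rw [eval_mul, eval_mk, LinearMap.comp_apply, AlgHom.toLinearMap_apply, eval_mul]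
    rw [UEnv.comul_map, eval_mk, eval_mk, TensorProduct.map_comp, LinearMap.comp_apply]
  map_zero' := by
    ext y
    simp
  map_add' F G := by
    ext y
    simp
  commutes' c := by
    ext y
    exact congrArg (c * ·) (UEnv.counit_map f y)

end FormalFun

end FormalGroup

section Localizations

variable {K : Type*} [Field K] {R : Type*} [CommRing R] [Algebra K R]

/-- The ring homomorphism `f ↦ f + ε D f` from `R` to the dual numbers over `R[1/P]`. -/
noncomputable def awayDual (D : Derivation K R R) (P : R) :
    R →+* TrivSqZeroExt (Localization.Away P) (Localization.Away P) where
  toFun f := ((algebraMap R (Localization.Away P) f, algebraMap R (Localization.Away P) (D f)) :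
    Localization.Away P × Localization.Away P)
  map_one' := Prod.ext (map_one _) (by simp; rfl)
  map_mul' f g := Prod.ext (map_mul _ _ _) (by
    change algebraMap R (Localization.Away P) (D (f * g)) =
      algebraMap R (Localization.Away P) f • algebraMap R (Localization.Away P) (D g) +
        MulOpposite.op (algebraMap R (Localization.Away P) g) •
          algebraMap R (Localization.Away P) (D f)
    rw [D.leibniz, map_add, smul_eq_mul, smul_eq_mul, map_mul, map_mul, op_smul_eq_smul,
      smul_eq_mul, smul_eq_mul])
  map_zero' := Prod.ext (map_zero _) (by simp; rfl)
  map_add' f g := Prod.ext (map_add _ _ _) (by simp; rfl)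

theorem fst_awayDual (D : Derivation K R R) (P f : R) :
    (awayDual D P f).fst = algebraMap R (Localization.Away P) f := rfl

theorem snd_awayDual (D : Derivation K R R) (P f : R) :
    (awayDual D P f).snd = algebraMap R (Localization.Away P) (D f) := rfl

theorem awayDual_isUnit (D : Derivation K R R) (P : R) : IsUnit (awayDual D P P) := by
  rw [TrivSqZeroExt.isUnit_iff_isUnit_fst]
  simpa [fst_awayDual] using IsLocalization.Away.algebraMap_isUnit (S := Localization.Away P) P

/-- The lift of `awayDual` to `R[1/P]`. -/
noncomputable def awayDualLift (D : Derivation K R R) (P : R) :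
    Localization.Away P →+* TrivSqZeroExt (Localization.Away P) (Localization.Away P) :=
  IsLocalization.Away.lift P (awayDual_isUnit D P)

theorem awayDualLift_algebraMap (D : Derivation K R R) (P f : R) :
    awayDualLift D P (algebraMap R (Localization.Away P) f) = awayDual D P f :=
  IsLocalization.Away.lift_eq P (awayDual_isUnit D P) f

theorem fst_awayDualLift (D : Derivation K R R) (P : R) (f : Localization.Away P) :
    (awayDualLift D P f).fst = f := by
  have h : (TrivSqZeroExt.fstHom (Localization.Away P) (Localization.Away P)
      (Localization.Away P)).toRingHom.comp (awayDualLift D P) = RingHom.id _ := by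
    apply IsLocalization.ringHom_ext (Submonoid.powers P)
    ext f
    simp [awayDualLift_algebraMap, fst_awayDual]
  exact RingHom.congr_fun h f

/-- The extension of a derivation of `R` to the localization `R[1/P]`. -/
noncomputable def awayDer (D : Derivation K R R) (P : R) :
    Derivation K (Localization.Away P) (Localization.Away P) :=
  Derivation.mk'
    { toFun := fun f => (awayDualLift D P f).snd
      map_add' := by
        intro f g
        simp
      map_smul' := by
        intro c f
        rw [Algebra.smul_def, map_mul, TrivSqZeroExt.snd_mul, fst_awayDualLift, fst_awayDualLift,
          IsScalarTower.algebraMap_apply K R (Localization.Away P), awayDualLift_algebraMap]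
        simp [snd_awayDual, Algebra.smul_def,
          IsScalarTower.algebraMap_apply K R (Localization.Away P)] }
    (by
      intro f g
      change (awayDualLift D P (f * g)).snd = f • (awayDualLift D P g).snd +
        g • (awayDualLift D P f).snd
      rw [map_mul, TrivSqZeroExt.snd_mul, fst_awayDualLift, fst_awayDualLift]
      simp [mul_comm])

theorem awayDer_algebraMap (D : Derivation K R R) (P f : R) :
    awayDer D P (algebraMap R (Localization.Away P) f) =
      algebraMap R (Localization.Away P) (D f) := by
  change (awayDualLift D P _).snd = _
  rw [awayDualLift_algebraMap, snd_awayDual]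

/-- The homomorphism `R[1/P] → S[1/Q]` induced by `φ : R → S` when `φ P` divides `Q`. -/
noncomputable def awayHom {S : Type*} [CommRing S] [Algebra K S] (φ : R →ₐ[K] S) (P : R) (Q : S)
    (h : φ P ∣ Q) : Localization.Away P →ₐ[K] Localization.Away Q :=
  IsLocalization.Away.liftAlgHom P (A := K) (S := Localization.Away P)
    (f := (IsScalarTower.toAlgHom K S (Localization.Away Q)).comp φ)
    (isUnit_of_dvd_unit (map_dvd (algebraMap S (Localization.Away Q)) h)
      (IsLocalization.Away.algebraMap_isUnit Q))

end Localizations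

section RMatrices

open LieBialgebra

variable {K : Type*} [Field K] [CharZero K]

section Tensors

variable (K) (𝔤 : Type*) [LieRing 𝔤] [LieAlgebra K 𝔤]

/-- The bracket as a map `𝔤 ⊗ 𝔤 → 𝔤`. -/
noncomputable def bracketMap : 𝔤 ⊗[K] 𝔤 →ₗ[K] 𝔤 :=
  TensorProduct.lift (LieModule.toEnd K 𝔤 𝔤 : 𝔤 →ₗ[K] 𝔤 →ₗ[K] 𝔤)

/-- `(s, t) ↦ [s^{1,2}, t^{1,3}]`, i.e. `(x ⊗ y, x' ⊗ y') ↦ [x, x'] ⊗ y ⊗ y'`. -/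
noncomputable def lie₁₂₁₃ : 𝔤 ⊗[K] 𝔤 →ₗ[K] 𝔤 ⊗[K] 𝔤 →ₗ[K] (𝔤 ⊗[K] 𝔤) ⊗[K] 𝔤 :=
  (TensorProduct.map₂ (LieModule.toEnd K 𝔤 𝔤 : 𝔤 →ₗ[K] 𝔤 →ₗ[K] 𝔤)
    (TensorProduct.mk K 𝔤 𝔤)).compr₂ (TensorProduct.assoc K 𝔤 𝔤 𝔤).symm.toLinearMap

/-- `(s, t) ↦ [s^{1,2}, t^{2,3}]`, i.e. `(x ⊗ y, x' ⊗ y') ↦ x ⊗ [y, x'] ⊗ y'`. -/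
noncomputable def lie₁₂₂₃ : 𝔤 ⊗[K] 𝔤 →ₗ[K] 𝔤 ⊗[K] 𝔤 →ₗ[K] (𝔤 ⊗[K] 𝔤) ⊗[K] 𝔤 :=
  (TensorProduct.mk K (𝔤 ⊗[K] 𝔤) (𝔤 ⊗[K] 𝔤)).compr₂
    (((bracketMap K 𝔤).lTensor 𝔤 ∘ₗ (TensorProduct.assoc K 𝔤 𝔤 𝔤).toLinearMap).rTensor 𝔤 ∘ₗ
      (TensorProduct.assoc K (𝔤 ⊗[K] 𝔤) 𝔤 𝔤).symm.toLinearMap)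

/-- `(s, t) ↦ [s^{1,3}, t^{2,3}]`, i.e. `(x ⊗ y, x' ⊗ y') ↦ x ⊗ x' ⊗ [y, y']`. -/
noncomputable def lie₁₃₂₃ : 𝔤 ⊗[K] 𝔤 →ₗ[K] 𝔤 ⊗[K] 𝔤 →ₗ[K] (𝔤 ⊗[K] 𝔤) ⊗[K] 𝔤 :=
  TensorProduct.map₂ (TensorProduct.mk K 𝔤 𝔤)
    (LieModule.toEnd K 𝔤 𝔤 : 𝔤 →ₗ[K] 𝔤 →ₗ[K] 𝔤)

variable {K 𝔤}

@[simp] theorem lie₁₂₁₃_tmul (x y x' y' : 𝔤) :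
    lie₁₂₁₃ K 𝔤 (x ⊗ₜ[K] y) (x' ⊗ₜ[K] y') = (⁅x, x'⁆ ⊗ₜ[K] y) ⊗ₜ[K] y' := rfl

@[simp] theorem lie₁₂₂₃_tmul (x y x' y' : 𝔤) :
    lie₁₂₂₃ K 𝔤 (x ⊗ₜ[K] y) (x' ⊗ₜ[K] y') = (x ⊗ₜ[K] ⁅y, x'⁆) ⊗ₜ[K] y' := rfl

@[simp] theorem lie₁₃₂₃_tmul (x y x' y' : 𝔤) :
    lie₁₃₂₃ K 𝔤 (x ⊗ₜ[K] y) (x' ⊗ₜ[K] y') = (x ⊗ₜ[K] x') ⊗ₜ[K] ⁅y, y'⁆ := rfl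

/-- `CYB(ρ) = [ρ^{1,2}, ρ^{1,3}] + [ρ^{1,2}, ρ^{2,3}] + [ρ^{1,3}, ρ^{2,3}]` for
`ρ ∈ 𝔤 ⊗ 𝔤 ⊗ A`, with `A` a commutative algebra. -/
noncomputable def CYB {A : Type*} [CommRing A] [Algebra K A] (ρ : (𝔤 ⊗[K] 𝔤) ⊗[K] A) :
    ((𝔤 ⊗[K] 𝔤) ⊗[K] 𝔤) ⊗[K] A :=
  TensorProduct.map₂ (lie₁₂₁₃ K 𝔤 + lie₁₂₂₃ K 𝔤 + lie₁₃₂₃ K 𝔤) (LinearMap.mul K A) ρ ρ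

/-- `a ⊗ b ⊗ f ↦ a ⊗ b ⊗ e ⊗ D f`. -/
noncomputable def insertThird {A : Type*} [CommRing A] [Algebra K A] (e : 𝔤) (D : A →ₗ[K] A) :
    (𝔤 ⊗[K] 𝔤) ⊗[K] A →ₗ[K] ((𝔤 ⊗[K] 𝔤) ⊗[K] 𝔤) ⊗[K] A :=
  TensorProduct.map ((TensorProduct.mk K (𝔤 ⊗[K] 𝔤) 𝔤).flip e) D

/-- `Z ∈ ∧³(𝔤)^𝔤`: a totally antisymmetric tensor that is invariant under `𝔤`. -/
structure IsInvariantTrivector (Z : (𝔤 ⊗[K] 𝔤) ⊗[K] 𝔤) : Prop where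
  antisymm : (TensorProduct.comm K 𝔤 𝔤).toLinearMap.rTensor 𝔤 Z = -Z
  cyclic : cyc K 𝔤 Z = Z
  invariant : ∀ x : 𝔤, ⁅x, Z⁆ = 0

end Tensors

/-- An inclusion of Lie bialgebras. -/
structure IsLieBialgebraInclusion {𝔥 𝔤 : Type*} [LieRing 𝔥] [LieAlgebra K 𝔥] [LieBialgebra K 𝔥]
    [LieRing 𝔤] [LieAlgebra K 𝔤] [LieBialgebra K 𝔤] (j : 𝔥 →ₗ⁅K⁆ 𝔤) : Prop where
  injective : Function.Injective j
  map_δ : ∀ x, δ (K := K) (j x) =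
    TensorProduct.map (j : 𝔥 →ₗ[K] 𝔤) (j : 𝔥 →ₗ[K] 𝔤) (δ (K := K) x)

section Dynamical

variable {𝔥 𝔤 : Type*} [LieRing 𝔥] [LieAlgebra K 𝔥] [LieBialgebra K 𝔥] [FiniteDimensional K 𝔥]
  [LieRing 𝔤] [LieAlgebra K 𝔤] [LieBialgebra K 𝔤]

/-- `d^L : 𝔤 ⊗ 𝔤 ⊗ K[[H*]][1/P] → 𝔤 ⊗ 𝔤 ⊗ 𝔤 ⊗ K[[H*]][1/P]`,
`d^L(a ⊗ b ⊗ f) = -∑ᵢ a ⊗ b ⊗ j(eᵢ) ⊗ L_{εⁱ} f` for dual bases `eᵢ`, `εⁱ` of `𝔥`, `𝔥*`. -/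
noncomputable def dL (j : 𝔥 →ₗ⁅K⁆ 𝔤) (P : FormalFun K 𝔥)
    (ρ : (𝔤 ⊗[K] 𝔤) ⊗[K] Localization.Away P) :
    ((𝔤 ⊗[K] 𝔤) ⊗[K] 𝔤) ⊗[K] Localization.Away P :=
  -∑ i, insertThird (j (Module.finBasis K 𝔥 i))
    (awayDer (FormalFun.leftDer ((Module.finBasis K 𝔥).coord i)) P :
      Localization.Away P →ₗ[K] Localization.Away P) ρ

/-- `ρ ∈ ∧²(𝔤) ⊗ K[[H*]][1/P]` is a Poisson-Lie dynamical `r`-matrix for `(H*, 𝔤, Z)`, where `H*`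
is the formal group of `𝔥*` and `j : 𝔥 → 𝔤` is the inclusion of a Lie subbialgebra. -/
structure IsPLDynamicalRMatrix (j : 𝔥 →ₗ⁅K⁆ 𝔤) (Z : (𝔤 ⊗[K] 𝔤) ⊗[K] 𝔤) (P : FormalFun K 𝔥)
    (ρ : (𝔤 ⊗[K] 𝔤) ⊗[K] Localization.Away P) : Prop where
  denominator_ne_zero : P ≠ 0
  antisymm : (TensorProduct.comm K 𝔤 𝔤).toLinearMap.rTensor (Localization.Away P) ρ = -ρ
  /-- `dress_a(ρ) + [a ⊗ 1 + 1 ⊗ a, ρ] = 0`. -/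
  equivariant : ∀ a : 𝔥,
    (awayDer (FormalFun.dress (Double.inl K 𝔥 a)) P :
        Localization.Away P →ₗ[K] Localization.Away P).lTensor (𝔤 ⊗[K] 𝔤) ρ +
      (LieModule.toEnd K 𝔤 (𝔤 ⊗[K] 𝔤) (j a)).rTensor (Localization.Away P) ρ = 0
  /-- `CYB(ρ) + Alt(d^L ρ) + Alt((δ ⊗ id) ρ) = Z`. -/
  dynamical_yang_baxter :
    CYB ρ + (Alt K 𝔤).rTensor (Localization.Away P) (dL j P ρ) +
      (Alt K 𝔤 ∘ₗ (δ (K := K)).rTensor 𝔤).rTensor (Localization.Away P) ρ =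
        Z ⊗ₜ[K] (1 : Localization.Away P)

end Dynamical

section Splitting

variable {𝔩 𝔤 : Type*} [LieRing 𝔩] [LieAlgebra K 𝔩] [LieBialgebra K 𝔩]
  [LieRing 𝔤] [LieAlgebra K 𝔤] [LieBialgebra K 𝔤]

/-- A Lie bialgebra with a splitting `𝔤 = 𝔩 ⊕ 𝔲`, where `i : 𝔩 → 𝔤` is the inclusion of a Lie
subbialgebra. -/
structure IsSplitting (i : 𝔩 →ₗ⁅K⁆ 𝔤) (𝔲 : Submodule K 𝔤) : Prop where
  inclusion : IsLieBialgebraInclusion i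
  isCompl : IsCompl (LinearMap.range (i : 𝔩 →ₗ[K] 𝔤)) 𝔲
  lie_mem : ∀ x : 𝔩, ∀ v ∈ 𝔲, ⁅i x, v⁆ ∈ 𝔲
  δ_mem : ∀ v ∈ 𝔲, δ (K := K) v ∈
    LinearMap.range (TensorProduct.mapIncl (LinearMap.range (i : 𝔩 →ₗ[K] 𝔤)) 𝔲) ⊔
      LinearMap.range (TensorProduct.mapIncl 𝔲 (LinearMap.range (i : 𝔩 →ₗ[K] 𝔤))) ⊔
        LinearMap.range (TensorProduct.mapIncl 𝔲 𝔲)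

namespace IsSplitting

variable {i : 𝔩 →ₗ⁅K⁆ 𝔤} {𝔲 : Submodule K 𝔤} (h : IsSplitting i 𝔲)

/-- The projection `𝔤 → 𝔩` parallel to `𝔲`. -/
noncomputable def proj : 𝔤 →ₗ[K] 𝔩 :=
  LinearMap.linearProjOfIsCompl 𝔲 (i : 𝔩 →ₗ[K] 𝔤) h.inclusion.injective h.isCompl

theorem proj_incl (x : 𝔩) : h.proj (i x) = x :=
  LinearMap.linearProjOfIsCompl_apply_left 𝔲 (i : 𝔩 →ₗ[K] 𝔤) h.inclusion.injective h.isCompl x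

theorem proj_of_mem {v : 𝔤} (hv : v ∈ 𝔲) : h.proj v = 0 :=
  LinearMap.linearProjOfIsCompl_apply_right' 𝔲 (i : 𝔩 →ₗ[K] 𝔤) h.inclusion.injective h.isCompl v hv

theorem pair_proj_eq_zero (ξ η : Module.Dual K 𝔩) {v : 𝔤} (hv : v ∈ 𝔲) :
    pair (ξ ∘ₗ h.proj) (η ∘ₗ h.proj) (δ (K := K) v) = 0 := by
  have key : ∀ (p q : Submodule K 𝔤), p = 𝔲 ∨ q = 𝔲 →
      LinearMap.range (TensorProduct.mapIncl p q) ≤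
        LinearMap.ker (pair (ξ ∘ₗ h.proj) (η ∘ₗ h.proj)) := by
    rintro p q hpq _ ⟨t, rfl⟩
    rw [LinearMap.mem_ker]
    induction t with
    | zero => simp
    | tmul a b =>
      rcases hpq with rfl | rfl
      · simp [TensorProduct.mapIncl, h.proj_of_mem a.2]
      · simp [TensorProduct.mapIncl, h.proj_of_mem b.2]
    | add s t hs ht => simp [hs, ht]
  exact (sup_le (sup_le (key _ _ (.inr rfl)) (key _ _ (.inl rfl))) (key _ _ (.inl rfl)))
    (h.δ_mem v hv)

theorem pair_proj_incl (ξ η : Module.Dual K 𝔩) (t : 𝔩 ⊗[K] 𝔩) :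
    pair (ξ ∘ₗ h.proj) (η ∘ₗ h.proj)
      (TensorProduct.map (i : 𝔩 →ₗ[K] 𝔤) (i : 𝔩 →ₗ[K] 𝔤) t) = pair ξ η t := by
  induction t with
  | zero => simp
  | tmul a b => simp [h.proj_incl]
  | add s t hs ht => simp [hs, ht]

/-- The inclusion of Lie algebras `𝔩* → 𝔤*`: extension of linear forms by zero on `𝔲`. -/
noncomputable def dualIncl : Module.Dual K 𝔩 →ₗ⁅K⁆ Module.Dual K 𝔤 where
  toFun ξ := ξ ∘ₗ h.proj
  map_add' ξ η := LinearMap.add_comp _ _ _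
  map_smul' c ξ := LinearMap.smul_comp _ _ _
  map_lie' := by
    intro ξ η
    ext x
    obtain ⟨_, ⟨a, rfl⟩, v, hv, rfl⟩ :=
      Submodule.mem_sup.mp (h.isCompl.sup_eq_top ▸ Submodule.mem_top : x ∈ _ ⊔ 𝔲)
    change ⁅ξ, η⁆ (h.proj (i a + v)) =
      pair (ξ ∘ₗ h.proj) (η ∘ₗ h.proj) (δ (K := K) (i a + v))
    rw [map_add, map_add, map_add, h.proj_incl, h.proj_of_mem hv, map_add, map_zero, add_zero,
      h.pair_proj_eq_zero ξ η hv, add_zero, h.inclusion.map_δ, h.pair_proj_incl]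
    rfl

/-- The restriction `K[[G*]] → K[[L*]]`. -/
noncomputable def res : FormalFun K 𝔤 →ₐ[K] FormalFun K 𝔩 := FormalFun.comap h.dualIncl

/-- The form `ω₀(ξ)(u, v) = ξ([u, v]_𝔩)` on `𝔲`, for `ξ ∈ 𝔩*`. -/
noncomputable def omegaZero (ξ : Module.Dual K 𝔩) : LinearMap.BilinForm K 𝔲 :=
  ((LieModule.toEnd K 𝔤 𝔤 : 𝔤 →ₗ[K] 𝔤 →ₗ[K] 𝔤).compr₂ (ξ ∘ₗ h.proj)).domRestrict₁₂ 𝔲 𝔲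

theorem omegaZero_apply (ξ : Module.Dual K 𝔩) (u v : 𝔲) :
    h.omegaZero ξ u v = ξ (h.proj ⁅(u : 𝔤), (v : 𝔤)⁆) := rfl

/-- The splitting is nondegenerate: `ω₀(ξ)` is nondegenerate for generic `ξ ∈ 𝔩*`. As the
determinant of `ω₀(ξ)` is polynomial in `ξ` and `K` is infinite, this holds on a nonempty Zariski
open set as soon as it holds for one `ξ`. -/
def Nondegenerate : Prop := ∃ ξ : Module.Dual K 𝔩, (h.omegaZero ξ).Nondegenerate

variable [FiniteDimensional K 𝔤]

/-- The matrix over `K[[L*]]` of the form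
`ω_x(u, v) = ⟨(Ad(x⁻¹) u)_𝔤, (Ad(x⁻¹) v)_{𝔤*}⟩`, `x ∈ L*`, in a basis of `𝔲`. -/
noncomputable def omegaMatrix :
    Matrix (Fin (Module.finrank K 𝔲)) (Fin (Module.finrank K 𝔲)) (FormalFun K 𝔩) :=
  Matrix.of fun s t => h.res (FormalFun.omega
    (Double.inl K 𝔤 (Module.finBasis K 𝔲 s : 𝔤)) (Double.inl K 𝔤 (Module.finBasis K 𝔲 t : 𝔤)))

/-- The function `P_𝔩^𝔤 ∈ K[[L*]]`, the determinant of `ω_x`. -/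
noncomputable def detP : FormalFun K 𝔩 := h.omegaMatrix.det

/-- The coefficients `s_{kl}` of `σ_𝔩^𝔤 = ∑ s_{kl} u_k ⊗ u_l` in `K[[L*]][1/P_𝔩^𝔤]`: the inverse of
the transposed matrix of `ω_x`, so that `∑ s_{kl} ω_x(v, u_l) u_k = v` for all `v ∈ 𝔲`. -/
noncomputable def sigmaMatrix :
    Matrix (Fin (Module.finrank K 𝔲)) (Fin (Module.finrank K 𝔲)) (Localization.Away h.detP) :=
  ((h.omegaMatrix.map (algebraMap (FormalFun K 𝔩) (Localization.Away h.detP))).transpose)⁻¹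

/-- The element `σ_𝔩^𝔤 = ω⁻¹` of `∧²(𝔲) ⊗ K[[L*]][1/P_𝔩^𝔤]`, viewed in
`𝔤 ⊗ 𝔤 ⊗ K[[L*]][1/P_𝔩^𝔤]`. -/
noncomputable def sigma : (𝔤 ⊗[K] 𝔤) ⊗[K] Localization.Away h.detP :=
  ∑ s, ∑ t, ((Module.finBasis K 𝔲 s : 𝔤) ⊗ₜ[K] (Module.finBasis K 𝔲 t : 𝔤)) ⊗ₜ[K]
    h.sigmaMatrix s t

variable {𝔞 : Type*} [LieRing 𝔞] [LieAlgebra K 𝔞] [LieBialgebra K 𝔞]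

/-- The restriction `ρ_{|L*}` of `ρ ∈ 𝔞 ⊗ 𝔞 ⊗ K[[G*]][1/P]`, with values in
`𝔞 ⊗ 𝔞 ⊗ K[[L*]][1/(P_{|L*} P_𝔩^𝔤)]`. -/
noncomputable def restrict (P : FormalFun K 𝔤) :
    (𝔞 ⊗[K] 𝔞) ⊗[K] Localization.Away P →ₗ[K]
      (𝔞 ⊗[K] 𝔞) ⊗[K] Localization.Away (h.res P * h.detP) :=
  (awayHom h.res P (h.res P * h.detP) (dvd_mul_right _ _)).toLinearMap.lTensor (𝔞 ⊗[K] 𝔞)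

/-- The image of `σ_𝔩^𝔤` in `𝔞 ⊗ 𝔞 ⊗ K[[L*]][1/(P_{|L*} P_𝔩^𝔤)]`, for `j : 𝔤 → 𝔞`. -/
noncomputable def sigmaIn (j : 𝔤 →ₗ⁅K⁆ 𝔞) (P : FormalFun K 𝔤) :
    (𝔞 ⊗[K] 𝔞) ⊗[K] Localization.Away (h.res P * h.detP) :=
  TensorProduct.map (TensorProduct.map (j : 𝔤 →ₗ[K] 𝔞) (j : 𝔤 →ₗ[K] 𝔞))
    (awayHom (AlgHom.id K _) h.detP (h.res P * h.detP) (dvd_mul_left _ _)).toLinearMap h.sigma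

end IsSplitting

end Splitting

end RMatrices

/-! A function on a formal group is determined by its iterated left translates at the neutral
element. Hence a family of functions that vanish there and whose span is stable under left
translations is zero (`eq_zero_of_leftDer_mem_span`). The form `ω_x(u, v)` depends on `x` only
through `Ad(x⁻¹)`, so left translation by `ξ` acts on it through the bracket with `ξ` in the double,
and identities for `ω` reduce to `x = 1`. This yields skewness on `𝔤`, the cyclic identity
`cyclic_om_lie`, the formula `dress_a = ∑ ω(e_s, a) L_{ε^s}` and, from the axioms of a splitting,
the fact that on `L*` the form is block diagonal for `𝔤 = 𝔩 ⊕ 𝔲`.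

Two facts then carry the theorem.

(1) `σ` satisfies the two equations for `(L*, 𝔤, 0)`: `sigmaAway_equivariant` and `sigmaAway_dybe`.
Tensors are tested against the forms `ω_x(-, u_m)`, for a basis `u_m` of `𝔲`, and the constant forms
`ξ ∈ 𝔩*`; over the localized ring these generate all forms on `𝔤`. Contracting `σ` with them gives,
up to sign, the constant vector `u_m`, respectively `0`. The Yang-Baxter equation becomes the cyclic
identity, the formula for `L_ξ ω`, or the absence of an `𝔩 ⊗ 𝔩` component in `δ(𝔲)`, according to
the number of constant forms.

(2) Restricting `d^L ρ` from `G*` to `L*` leaves, besides `d^L` of the restriction, the derivatives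
of `ρ` transversal to `L*` (`lTensor_dL`). On `L*` the dressing action of `u ∈ 𝔲` is the transversal
field `∑ ω(u_s, u) L_{u_s*}`. Equivariance of `ρ` under `𝔲` and the inversion of `ω` by `σ` identify
these extra terms with `[ρ^{1,2}, σ^{1,3} + σ^{2,3}]` (`lieThird_sigma`), whose cyclic sum is the
mixed part of `CYB(ρ + σ)` (`CYB_add`).

For the denominator, `K[[L*]]` is a domain because nonzero functions are detected on one-parameter
subgroups, and on `t ↦ exp(tξ)` one has `ω = t ω₀(ξ) + O(t²)`, so nondegeneracy of `ω₀(ξ)` gives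
`P_𝔩^𝔤 ≠ 0`. -/

section EnvelopeInduction

attribute [local instance] LieRing.ofAssociativeRing

/-! ### Generation of the enveloping algebra by the Lie algebra. -/

namespace UEnv

variable {K : Type*} [Field K] {L : Type*} [LieRing L] [LieAlgebra K L]

/-- The map from `L` into the generated subalgebra extends to the whole enveloping algebra; composed
with the inclusion it fixes `L`, so it is the identity by the universal property. -/
theorem adjoin_range_ι :
    Algebra.adjoin K (Set.range (UniversalEnvelopingAlgebra.ι K (L := L))) = ⊤ := by
  set S := Algebra.adjoin K (Set.range (UniversalEnvelopingAlgebra.ι K (L := L))) with hS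
  let f : L →ₗ⁅K⁆ S :=
    { toFun := fun x => ⟨UniversalEnvelopingAlgebra.ι K x, Algebra.subset_adjoin ⟨x, rfl⟩⟩
      map_add' := fun x y => Subtype.ext (map_add _ x y)
      map_smul' := fun c x => Subtype.ext (map_smul _ c x)
      map_lie' := by
        intro x y
        apply Subtype.ext
        simp only [LieRing.of_associative_ring_bracket]
        exact (UniversalEnvelopingAlgebra.ι K).map_lie x y }
  have h : S.val.comp (UniversalEnvelopingAlgebra.lift K f) = AlgHom.id K _ := by
    apply algHom_ext
    intro x
    rw [AlgHom.comp_apply, UniversalEnvelopingAlgebra.lift_ι_apply]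
    rfl
  rw [eq_top_iff]
  intro y _
  have := congrArg (fun F => F y) h
  simp only [AlgHom.comp_apply, AlgHom.id_apply] at this
  rw [← this]
  exact (UniversalEnvelopingAlgebra.lift K f y).2

/-- A subspace that contains `1` and is stable under left multiplication by `L` is everything. -/
theorem mem_of_mulLeft_stable (W : Submodule K (UniversalEnvelopingAlgebra K L)) (h1 : 1 ∈ W)
    (hmul : ∀ x : L, ∀ y ∈ W, UniversalEnvelopingAlgebra.ι K x * y ∈ W)
    (y : UniversalEnvelopingAlgebra K L) : y ∈ W := by
  have key : ∀ a ∈ Algebra.adjoin K (Set.range (UniversalEnvelopingAlgebra.ι K (L := L))),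
      ∀ y ∈ W, a * y ∈ W := by
    intro a ha
    induction ha using Algebra.adjoin_induction with
    | mem a ha =>
      obtain ⟨x, rfl⟩ := ha
      exact hmul x
    | algebraMap c =>
      intro y hy
      rw [← Algebra.smul_def]
      exact W.smul_mem c hy
    | add a b _ _ ha hb =>
      intro y hy
      rw [add_mul]
      exact W.add_mem (ha y hy) (hb y hy)
    | mul a b _ _ ha hb =>
      intro y hy
      rw [mul_assoc]
      exact ha _ (hb y hy)
  simpa using key y (by rw [adjoin_range_ι]; exact Algebra.mem_top) 1 h1

end UEnv

end EnvelopeInduction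

/-- The canonical element `∑ e_s ⊗ ε^s` does not depend on the basis. This allows the arbitrary
basis in the definitions of `d^L` and of the dressing action to be exchanged for one adapted to the
splitting. -/
theorem Module.Basis.sum_apply_coord {K V X ι κ : Type*} [Field K] [AddCommGroup V] [Module K V]
    [AddCommGroup X] [Module K X] [Fintype ι] [Fintype κ] (b : Module.Basis ι K V)
    (c : Module.Basis κ K V) (B : V →ₗ[K] Module.Dual K V →ₗ[K] X) :
    ∑ s, B (b s) (b.coord s) = ∑ t, B (c t) (c.coord t) := by
  have h1 : ∀ s, b s = ∑ t, c.coord t (b s) • c t := fun s => (c.sum_repr (b s)).symm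
  have h2 : ∀ t, c.coord t = ∑ s, c.coord t (b s) • b.coord s := by
    intro t
    apply b.ext
    intro s
    classical simp [Finsupp.single_apply]
  calc ∑ s, B (b s) (b.coord s)
      = ∑ s, ∑ t, c.coord t (b s) • B (c t) (b.coord s) := by
        refine Finset.sum_congr rfl fun s _ => ?_
        conv_lhs => rw [h1 s]
        simp only [map_sum, map_smul, LinearMap.sum_apply, LinearMap.smul_apply]
    _ = ∑ t, B (c t) (c.coord t) := by
        rw [Finset.sum_comm]
        refine Finset.sum_congr rfl fun t _ => ?_
        conv_rhs => rw [h2 t]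
        simp only [map_sum, map_smul]

/-! ### The invariant pairing of the double. -/

section DoublePairing

open LieBialgebra

variable {K : Type*} [Field K] [CharZero K] {𝔥 : Type*} [LieRing 𝔥] [LieAlgebra K 𝔥]
  [LieBialgebra K 𝔥]

namespace LieBialgebra.Double

variable (K 𝔥) in
/-- The canonical symmetric pairing of the double. -/
noncomputable def pairing : Double K 𝔥 →ₗ[K] Double K 𝔥 →ₗ[K] K :=
  (Module.Dual.eval K 𝔥 ∘ₗ fst K 𝔥).compl₂ (snd K 𝔥) +
    ((Module.Dual.eval K 𝔥 ∘ₗ fst K 𝔥).compl₂ (snd K 𝔥)).flip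

theorem pairing_apply (a b : Double K 𝔥) :
    pairing K 𝔥 a b = snd K 𝔥 b (fst K 𝔥 a) + snd K 𝔥 a (fst K 𝔥 b) := rfl

theorem snd_contract (ξ η : Module.Dual K 𝔥) (x : 𝔥) :
    η (contract ξ (δ (K := K) x)) = -ξ (contract η (δ (K := K) x)) := by
  rw [apply_contract_δ, apply_contract_δ, ← lie_skew]
  rfl

theorem pairing_lie (a b c : Double K 𝔥) :
    pairing K 𝔥 ⁅a, b⁆ c = pairing K 𝔥 a ⁅b, c⁆ := by
  simp only [pairing_apply, fst_lie, snd_lie, map_add, map_sub, LinearMap.add_apply,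
    LinearMap.sub_apply, compAd_apply]
  rw [snd_contract (snd K 𝔥 b) (snd K 𝔥 c), ← apply_contract_δ (snd K 𝔥 a) (snd K 𝔥 b),
    ← apply_contract_δ (snd K 𝔥 b) (snd K 𝔥 c),
    snd_contract (snd K 𝔥 b) (snd K 𝔥 a), snd_contract (snd K 𝔥 c) (snd K 𝔥 a),
    ← lie_skew (fst K 𝔥 b) (fst K 𝔥 a),
    ← lie_skew (fst K 𝔥 c) (fst K 𝔥 a), map_neg, map_neg]
  rw [snd_contract (snd K 𝔥 c) (snd K 𝔥 b)]
  ring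

end LieBialgebra.Double

end DoublePairing

/-! ### Left translations and the form `ω_x`. -/

section FormalFunctions

attribute [local instance] LieRing.ofAssociativeRing

open LieBialgebra

namespace FormalFun

variable {K : Type*} [Field K] [CharZero K] {𝔥 : Type*} [LieRing 𝔥] [LieAlgebra K 𝔥]
  [LieBialgebra K 𝔥]

@[simp] theorem eval_sub (f g : FormalFun K 𝔥) : (f - g).eval = f.eval - g.eval := rfl

variable (K 𝔥) in
/-- The value of a function at the neutral element of `H*`. -/
noncomputable def evalOne : FormalFun K 𝔥 →ₐ[K] K where
  toFun f := f.eval 1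
  map_one' := by rw [eval_one, Bialgebra.counit_one]
  map_mul' f g := by
    rw [eval_mul, Bialgebra.comul_one, Algebra.TensorProduct.one_def]
    simp
  map_zero' := rfl
  map_add' _ _ := rfl
  commutes' c := by
    rw [eval_algebraMap, Bialgebra.counit_one, mul_one]
    rfl

theorem evalOne_apply (f : FormalFun K 𝔥) : evalOne K 𝔥 f = f.eval 1 := rfl

theorem evalOne_leftDer (ξ : Module.Dual K 𝔥) (f : FormalFun K 𝔥) :
    evalOne K 𝔥 (leftDer ξ f) = -f.eval (UniversalEnvelopingAlgebra.ι K ξ) := by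
  rw [evalOne_apply, leftDer_apply, mul_one]

theorem evalOne_rightDer (ξ : Module.Dual K 𝔥) (f : FormalFun K 𝔥) :
    evalOne K 𝔥 (rightDer ξ f) = f.eval (UniversalEnvelopingAlgebra.ι K ξ) := by
  rw [evalOne_apply, rightDer_apply, one_mul]

/-- A family of functions that vanish at the neutral element and whose span is stable under left
translations is zero. -/
theorem eq_zero_of_leftDer_mem_span {X : Type*} (F : X → FormalFun K 𝔥)
    (h1 : ∀ x, evalOne K 𝔥 (F x) = 0)
    (hL : ∀ ξ x, leftDer ξ (F x) ∈ Submodule.span K (Set.range F)) (x : X) : F x = 0 := by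
  have h1' : ∀ f ∈ Submodule.span K (Set.range F), f.eval 1 = 0 := by
    intro f hf
    induction hf using Submodule.span_induction with
    | mem f hf =>
      obtain ⟨x, rfl⟩ := hf
      exact h1 x
    | zero => rfl
    | add f g _ _ hf hg => simp [hf, hg]
    | smul c f _ hf => simp [hf]
  have hL' : ∀ ξ, ∀ f ∈ Submodule.span K (Set.range F),
      leftDer ξ f ∈ Submodule.span K (Set.range F) := by
    intro ξ f hf
    induction hf using Submodule.span_induction with
    | mem f hf =>
      obtain ⟨x, rfl⟩ := hf
      exact hL ξ x
    | zero => simp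
    | add f g _ _ hf hg =>
      rw [map_add]
      exact Submodule.add_mem _ hf hg
    | smul c f _ hf =>
      rw [Derivation.map_smul]
      exact Submodule.smul_mem _ _ hf
  -- The common annihilator of the span. It is stable under left multiplication because `f(ξ y) =
  -- -(L_ξ f)(y)` and `L_ξ f` stays in the span.
  let V : Submodule K (UniversalEnvelopingAlgebra K (Module.Dual K 𝔥)) :=
    { carrier := {y | ∀ f ∈ Submodule.span K (Set.range F), f.eval y = 0}
      add_mem' := by
        intro y z hy hz f hf
        rw [map_add, hy f hf, hz f hf, add_zero]
      zero_mem' := fun f _ => map_zero _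
      smul_mem' := by
        intro c y hy f hf
        rw [map_smul, hy f hf, smul_zero] }
  have hV : ∀ y, y ∈ V := UEnv.mem_of_mulLeft_stable V h1' (by
    intro ξ y hy f hf
    have := hy _ (hL' ξ f hf)
    rwa [leftDer_apply, neg_eq_zero] at this)
  ext y
  exact hV y (F x) (Submodule.subset_span ⟨x, rfl⟩)

/-- A family of functions indexed by pairs, vanishing at the neutral element, on which left
translations act through the two indices, is zero. -/
theorem eq_zero_of_leftDer_eq_add {X Y : Type*} (F : X → Y → FormalFun K 𝔥)
    (a : Module.Dual K 𝔥 → X → X) (b : Module.Dual K 𝔥 → Y → Y)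
    (h1 : ∀ x y, evalOne K 𝔥 (F x y) = 0)
    (hL : ∀ ξ x y, leftDer ξ (F x y) = F (a ξ x) y + F x (b ξ y)) (x : X) (y : Y) :
    F x y = 0 :=
  eq_zero_of_leftDer_mem_span (fun p : X × Y => F p.1 p.2) (fun p => h1 p.1 p.2)
    (fun ξ p => by
      rw [hL]
      exact Submodule.add_mem _ (Submodule.subset_span ⟨(a ξ p.1, p.2), rfl⟩)
        (Submodule.subset_span ⟨(p.1, b ξ p.2), rfl⟩)) (x, y)

theorem leftDer_add (ξ η : Module.Dual K 𝔥) (f : FormalFun K 𝔥) :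
    leftDer (ξ + η) f = leftDer ξ f + leftDer η f := by
  ext y
  simp only [leftDer_apply, map_add, add_mul, eval_add, LinearMap.add_apply, neg_add]

theorem leftDer_smul (c : K) (ξ : Module.Dual K 𝔥) (f : FormalFun K 𝔥) :
    leftDer (c • ξ) f = c • leftDer ξ f := by
  ext y
  simp only [leftDer_apply, map_smul, smul_mul_assoc, eval_smul, LinearMap.smul_apply, smul_neg]

theorem leftDer_lie (ξ η : Module.Dual K 𝔥) (f : FormalFun K 𝔥) :
    leftDer ⁅ξ, η⁆ f = leftDer ξ (leftDer η f) - leftDer η (leftDer ξ f) := by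
  ext y
  simp only [leftDer_apply, LieHom.map_lie, LieRing.of_associative_ring_bracket, eval_sub,
    LinearMap.sub_apply, sub_mul, map_sub, mul_assoc]
  ring

theorem leftDer_rightDer (ξ η : Module.Dual K 𝔥) (f : FormalFun K 𝔥) :
    leftDer ξ (rightDer η f) = rightDer η (leftDer ξ f) := by
  ext y
  simp only [leftDer_apply, rightDer_apply, mul_assoc]

theorem adInvCoeff_eval (φ : Module.Dual K (Double K 𝔥)) (v : Double K 𝔥)
    (y : UniversalEnvelopingAlgebra K (Module.Dual K 𝔥)) :
    (adInvCoeff φ v).eval y = φ ((adInv K 𝔥 y).unop v) := rfl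

theorem adInv_ι (ξ : Module.Dual K 𝔥) (v : Double K 𝔥) :
    (adInv K 𝔥 (UniversalEnvelopingAlgebra.ι K ξ)).unop v = -⁅Double.inr K 𝔥 ξ, v⁆ := by
  rw [adInv, UniversalEnvelopingAlgebra.lift_ι_apply]
  rfl

/-- Replacing `x` by `e^{-εξ} x` turns `Ad(x⁻¹) v` into `Ad(x⁻¹) Ad(e^{εξ}) v`. Thus left
translations act through `v` alone, which makes matrix coefficients accessible to the vanishing
criterion. -/
theorem leftDer_adInvCoeff (ξ : Module.Dual K 𝔥) (φ : Module.Dual K (Double K 𝔥))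
    (v : Double K 𝔥) :
    leftDer ξ (adInvCoeff φ v) = adInvCoeff φ ⁅Double.inr K 𝔥 ξ, v⁆ := by
  ext y
  rw [leftDer_apply, adInvCoeff_eval, adInvCoeff_eval, map_mul, MulOpposite.unop_mul,
    Module.End.mul_apply, adInv_ι, map_neg, map_neg, neg_neg]

theorem evalOne_adInvCoeff (φ : Module.Dual K (Double K 𝔥)) (v : Double K 𝔥) :
    evalOne K 𝔥 (adInvCoeff φ v) = φ v := by
  rw [evalOne_apply, adInvCoeff_eval, map_one]
  rfl

theorem adInvCoeff_add (φ : Module.Dual K (Double K 𝔥)) (v w : Double K 𝔥) :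
    adInvCoeff φ (v + w) = adInvCoeff φ v + adInvCoeff φ w := by
  ext y
  simp [adInvCoeff_eval]

theorem adInvCoeff_smul (φ : Module.Dual K (Double K 𝔥)) (c : K) (v : Double K 𝔥) :
    adInvCoeff φ (c • v) = c • adInvCoeff φ v := by
  ext y
  simp [adInvCoeff_eval]

section Finite

variable [FiniteDimensional K 𝔥]

variable (K 𝔥) in
/-- `omega` as a bilinear map. -/
noncomputable def omegaBilin : Double K 𝔥 →ₗ[K] Double K 𝔥 →ₗ[K] FormalFun K 𝔥 :=
  LinearMap.mk₂ K omega
    (fun u u' v => by simp only [omega, adInvCoeff_add, add_mul, Finset.sum_add_distrib])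
    (fun c u v => by simp only [omega, adInvCoeff_smul, smul_mul_assoc, Finset.smul_sum])
    (fun u v v' => by simp only [omega, adInvCoeff_add, mul_add, Finset.sum_add_distrib])
    (fun c u v => by simp only [omega, adInvCoeff_smul, mul_smul_comm, Finset.smul_sum])

theorem omegaBilin_apply (u v : Double K 𝔥) : omegaBilin K 𝔥 u v = omega u v := rfl

theorem leftDer_omegaBilin (ξ : Module.Dual K 𝔥) (u v : Double K 𝔥) :
    leftDer ξ (omegaBilin K 𝔥 u v) = omegaBilin K 𝔥 ⁅Double.inr K 𝔥 ξ, u⁆ v +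
      omegaBilin K 𝔥 u ⁅Double.inr K 𝔥 ξ, v⁆ := by
  simp only [omegaBilin_apply, omega, map_sum, Derivation.leibniz, leftDer_adInvCoeff,
    smul_eq_mul, ← Finset.sum_add_distrib]
  refine Finset.sum_congr rfl fun s _ => ?_
  ring

theorem evalOne_omegaBilin (u v : Double K 𝔥) :
    evalOne K 𝔥 (omegaBilin K 𝔥 u v) = Double.snd K 𝔥 v (Double.fst K 𝔥 u) := by
  simp only [omegaBilin_apply, omega, map_sum, map_mul, evalOne_adInvCoeff]
  conv_rhs => rw [← (Module.finBasis K 𝔥).sum_repr (Double.fst K 𝔥 u), map_sum]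
  simp

/-- The left side is the canonical pairing of `Ad(x⁻¹) u` and `Ad(x⁻¹) v`, which does not depend on
`x` by invariance. -/
theorem omegaBilin_add_swap (u v : Double K 𝔥) :
    omegaBilin K 𝔥 u v + omegaBilin K 𝔥 v u =
      algebraMap K (FormalFun K 𝔥) (Double.pairing K 𝔥 u v) := by
  rw [← sub_eq_zero]
  refine eq_zero_of_leftDer_eq_add (fun u v => omegaBilin K 𝔥 u v + omegaBilin K 𝔥 v u -
      algebraMap K (FormalFun K 𝔥) (Double.pairing K 𝔥 u v))
    (fun ξ u => ⁅Double.inr K 𝔥 ξ, u⁆) (fun ξ u => ⁅Double.inr K 𝔥 ξ, u⁆) ?_ ?_ u v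
  · intro u v
    simp only [map_sub, map_add, evalOne_omegaBilin, AlgHom.commutes, Double.pairing_apply,
      Algebra.algebraMap_self, RingHom.id_apply]
    ring
  · intro ξ u v
    have e : Double.pairing K 𝔥 ⁅Double.inr K 𝔥 ξ, u⁆ v +
        Double.pairing K 𝔥 u ⁅Double.inr K 𝔥 ξ, v⁆ = 0 := by
      rw [← Double.pairing_lie u, ← lie_skew, map_neg, LinearMap.neg_apply]
      ring
    simp only [map_sub, map_add, leftDer_omegaBilin, Derivation.map_algebraMap]
    have e_map := congrArg (algebraMap K (FormalFun K 𝔥)) e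
    rw [map_add, map_zero] at e_map
    linear_combination e_map

/-- `Ad(x⁻¹)` preserves the subalgebra `𝔥*`, so the `𝔥`-component of `Ad(x⁻¹) ξ` is zero. -/
theorem omegaBilin_inr (ξ : Module.Dual K 𝔥) (v : Double K 𝔥) :
    omegaBilin K 𝔥 (Double.inr K 𝔥 ξ) v = 0 := by
  refine eq_zero_of_leftDer_eq_add (fun ξ v => omegaBilin K 𝔥 (Double.inr K 𝔥 ξ) v)
    (fun η ξ => ⁅η, ξ⁆) (fun ξ u => ⁅Double.inr K 𝔥 ξ, u⁆) ?_ ?_ ξ v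
  · intro ξ v
    simp [evalOne_omegaBilin]
  · intro η ξ v
    rw [leftDer_omegaBilin, ← Double.inr_lie]

theorem inr_lie_inl (ξ : Module.Dual K 𝔥) (u : 𝔥) :
    ⁅Double.inr K 𝔥 ξ, Double.inl K 𝔥 u⁆ =
      Double.inl K 𝔥 (-contract ξ (δ (K := K) u)) + Double.inr K 𝔥 (compAd u ξ) := by
  ext1
  · simp [Double.fst_lie, contract]
  · simp only [Double.snd_lie, map_add, Double.snd_inr, Double.snd_inl, Double.fst_inr,
      Double.fst_inl]
    ext
    simp

variable (K 𝔥) in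
/-- The function `x ↦ ω_x(u, v)` for `u, v ∈ 𝔥`. -/
noncomputable def om : 𝔥 →ₗ[K] 𝔥 →ₗ[K] FormalFun K 𝔥 :=
  (omegaBilin K 𝔥).compl₁₂ (Double.inl K 𝔥) (Double.inl K 𝔥)

theorem om_apply (u v : 𝔥) : om K 𝔥 u v = omegaBilin K 𝔥 (Double.inl K 𝔥 u) (Double.inl K 𝔥 v) :=
  rfl

/-- `𝔥` is isotropic for the canonical pairing. -/
theorem om_skew (u v : 𝔥) : om K 𝔥 u v = -om K 𝔥 v u := by
  rw [← add_eq_zero_iff_eq_neg, om_apply, om_apply, omegaBilin_add_swap]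
  simp [Double.pairing_apply]

theorem evalOne_om (u v : 𝔥) : evalOne K 𝔥 (om K 𝔥 u v) = 0 := by
  simp [om_apply, evalOne_omegaBilin]

theorem omegaBilin_inl_inr (u : 𝔥) (ξ : Module.Dual K 𝔥) :
    omegaBilin K 𝔥 (Double.inl K 𝔥 u) (Double.inr K 𝔥 ξ) = algebraMap K (FormalFun K 𝔥) (ξ u) := by
  have := omegaBilin_add_swap (Double.inl K 𝔥 u) (Double.inr K 𝔥 ξ)
  rw [omegaBilin_inr, add_zero] at this
  rw [this, Double.pairing_apply]
  simp

/-- The bracket of `ξ` with an element of `𝔥` has two components. The `𝔥`-component gives the two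
coadjoint terms. The `𝔥*`-component vanishes in the first argument of `ω` and gives the constant
term in the second. -/
theorem leftDer_om (ξ : Module.Dual K 𝔥) (u v : 𝔥) :
    leftDer ξ (om K 𝔥 u v) = -om K 𝔥 (contract ξ (δ (K := K) u)) v
      - om K 𝔥 u (contract ξ (δ (K := K) v)) + algebraMap K (FormalFun K 𝔥) (ξ ⁅v, u⁆) := by
  rw [om_apply, leftDer_omegaBilin, inr_lie_inl, inr_lie_inl, map_add, map_add,
    LinearMap.add_apply, omegaBilin_inr, omegaBilin_inl_inr, map_neg, map_neg, map_neg, map_neg,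
    LinearMap.neg_apply, compAd_apply, om_apply, om_apply]
  ring

theorem leftDer_omegaBilin_inl_left (ξ : Module.Dual K 𝔥) (u : 𝔥) (v : Double K 𝔥) :
    leftDer ξ (omegaBilin K 𝔥 (Double.inl K 𝔥 u) v) =
      -omegaBilin K 𝔥 (Double.inl K 𝔥 (contract ξ (δ (K := K) u))) v +
        omegaBilin K 𝔥 (Double.inl K 𝔥 u) ⁅Double.inr K 𝔥 ξ, v⁆ := by
  rw [leftDer_omegaBilin, inr_lie_inl, map_add, LinearMap.add_apply, omegaBilin_inr, map_neg,
    map_neg, LinearMap.neg_apply, add_zero]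

end Finite

end FormalFun

end FormalFunctions

/-! ### Pairings with values in a commutative algebra, and the canonical element. -/

section PairInto

variable {K : Type*} [Field K] {V : Type*} [AddCommGroup V] [Module K V]
  {A : Type*} [CommRing A] [Algebra K A]

/-- The map `V ⊗ V → A`, `x ⊗ y ↦ φ(x) ψ(y)`. -/
noncomputable def pairInto (φ ψ : V →ₗ[K] A) : V ⊗[K] V →ₗ[K] A :=
  LinearMap.mul' K A ∘ₗ TensorProduct.map φ ψ

@[simp] theorem pairInto_tmul (φ ψ : V →ₗ[K] A) (x y : V) :
    pairInto φ ψ (x ⊗ₜ[K] y) = φ x * ψ y := rfl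

theorem pairInto_comm (φ ψ : V →ₗ[K] A) (t : V ⊗[K] V) :
    pairInto φ ψ (TensorProduct.comm K V V t) = pairInto ψ φ t := by
  induction t with
  | zero => simp
  | tmul x y => simp [mul_comm]
  | add s t hs ht => simp [hs, ht]

theorem pairInto_add_left (φ φ' ψ : V →ₗ[K] A) (t : V ⊗[K] V) :
    pairInto (φ + φ') ψ t = pairInto φ ψ t + pairInto φ' ψ t := by
  simp [pairInto, TensorProduct.map_add_left]

theorem pairInto_add_right (φ ψ ψ' : V →ₗ[K] A) (t : V ⊗[K] V) :
    pairInto φ (ψ + ψ') t = pairInto φ ψ t + pairInto φ ψ' t := by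
  simp [pairInto, TensorProduct.map_add_right]

theorem pairInto_comp_rTensor (φ ψ : V →ₗ[K] A) (T : V →ₗ[K] V) (t : V ⊗[K] V) :
    pairInto (φ ∘ₗ T) ψ t = pairInto φ ψ (T.rTensor V t) := by
  induction t with
  | zero => simp
  | tmul x y => simp
  | add s t hs ht => simp [hs, ht]

theorem pairInto_comp_lTensor (φ ψ : V →ₗ[K] A) (T : V →ₗ[K] V) (t : V ⊗[K] V) :
    pairInto φ (ψ ∘ₗ T) t = pairInto φ ψ (T.lTensor V t) := by
  induction t with
  | zero => simp
  | tmul x y => simp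
  | add s t hs ht => simp [hs, ht]

theorem derivation_pairInto (D : Derivation K A A) (φ ψ : V →ₗ[K] A) (t : V ⊗[K] V) :
    D (pairInto φ ψ t) =
      pairInto ((D : A →ₗ[K] A) ∘ₗ φ) ψ t + pairInto φ ((D : A →ₗ[K] A) ∘ₗ ψ) t := by
  induction t with
  | zero => simp
  | tmul x y => simp [mul_comm, add_comm]
  | add s t hs ht =>
    simp only [map_add, hs, ht]
    abel

theorem map_pairInto {B : Type*} [CommRing B] [Algebra K B] (F : A →ₐ[K] B) (φ ψ : V →ₗ[K] A)
    (t : V ⊗[K] V) :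
    F (pairInto φ ψ t) = pairInto (F.toLinearMap ∘ₗ φ) (F.toLinearMap ∘ₗ ψ) t := by
  induction t with
  | zero => simp
  | tmul x y => simp
  | add s t hs ht => simp only [map_add, hs, ht]

/-- The canonical element of `V ⊗ V*` takes the same value under `T ⊗ 1` and `1 ⊗ Tᵗ`. -/
theorem Module.Basis.sum_apply_coord_comp {X ι : Type*} [AddCommGroup X] [Module K X] [Fintype ι]
    (b : Module.Basis ι K V) (B : V →ₗ[K] Module.Dual K V →ₗ[K] X) (T : V →ₗ[K] V) :
    ∑ s, B (T (b s)) (b.coord s) = ∑ s, B (b s) (b.coord s ∘ₗ T) := by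
  have h1 : ∀ s, T (b s) = ∑ t, b.coord t (T (b s)) • b t := fun s => (b.sum_repr _).symm
  have h2 : ∀ t, b.coord t ∘ₗ T = ∑ s, b.coord t (T (b s)) • b.coord s := by
    intro t
    apply b.ext
    intro s
    classical simp [Finsupp.single_apply]
  calc ∑ s, B (T (b s)) (b.coord s)
      = ∑ s, ∑ t, b.coord t (T (b s)) • B (b t) (b.coord s) := by
        refine Finset.sum_congr rfl fun s _ => ?_
        conv_lhs => rw [h1 s]
        simp only [map_sum, map_smul, LinearMap.sum_apply, LinearMap.smul_apply]
    _ = ∑ t, B (b t) (b.coord t ∘ₗ T) := by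
        rw [Finset.sum_comm]
        refine Finset.sum_congr rfl fun t _ => ?_
        rw [h2 t]
        simp only [map_sum, map_smul]

theorem Module.Basis.sum_coord_smul_apply {X ι : Type*} [AddCommGroup X] [Module K X] [Fintype ι]
    (b : Module.Basis ι K V) (φ : V →ₗ[K] X) (z : V) : ∑ s, b.coord s z • φ (b s) = φ z := by
  conv_rhs => rw [← b.sum_repr z, map_sum]
  simp

end PairInto

/-! ### The coadjoint action and the cobracket. -/

namespace LieBialgebra

variable {K : Type*} [Field K] [CharZero K] {𝔥 : Type*} [LieRing 𝔥] [LieAlgebra K 𝔥]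
  [LieBialgebra K 𝔥]

/-- The coadjoint action of `𝔥*` on `𝔥` (up to sign): `x ↦ (ξ ⊗ id)(δ x)`. -/
noncomputable def coact (ξ : Module.Dual K 𝔥) : 𝔥 →ₗ[K] 𝔥 := contract ξ ∘ₗ δ

theorem coact_apply (ξ : Module.Dual K 𝔥) (x : 𝔥) : coact ξ x = contract ξ (δ (K := K) x) := rfl

theorem comp_coact (ξ η : Module.Dual K 𝔥) : η ∘ₗ coact ξ = ⁅ξ, η⁆ :=
  LinearMap.ext fun x => apply_contract_δ ξ η x

theorem eq_zero_of_pair_eq_zero (t : 𝔥 ⊗[K] 𝔥) (h : ∀ ξ η, pair ξ η t = 0) : t = 0 := by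
  let b := Module.Basis.ofVectorSpace K 𝔥
  apply (b.tensorProduct b).ext_elem
  rintro ⟨s, r⟩
  rw [map_zero, Finsupp.zero_apply, ← h (b.coord s) (b.coord r)]
  clear h
  induction t with
  | zero => simp
  | tmul x y => simp [mul_comm]
  | add s t hs ht => simp [hs, ht]

theorem pair_eq_pairInto (ξ η : Module.Dual K 𝔥) : pair ξ η = pairInto ξ η := rfl

/-- Paired with `η ⊗ ζ`, this is the Jacobi identity for `ξ, η, ζ` in the dual Lie algebra. -/
theorem δ_coact (ξ : Module.Dual K 𝔥) (x : 𝔥) :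
    δ (K := K) (coact ξ x) =
      (coact ξ).rTensor 𝔥 (δ (K := K) x) + (coact ξ).lTensor 𝔥 (δ (K := K) x) := by
  rw [← sub_eq_zero]
  apply eq_zero_of_pair_eq_zero
  intro η ζ
  rw [map_sub, map_add, pair_eq_pairInto, ← pairInto_comp_lTensor, ← pairInto_comp_rTensor,
    ← pair_eq_pairInto, ← dual_lie_apply, comp_coact, comp_coact, ← pair_eq_pairInto,
    ← pair_eq_pairInto, ← dual_lie_apply, ← dual_lie_apply, ← LinearMap.add_apply, ← leibniz_lie,
    ← comp_coact ξ ⁅η, ζ⁆, LinearMap.comp_apply, sub_self]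

end LieBialgebra

/-! ### The cyclic identity for `ω` and the dressing action. -/

namespace FormalFun

open LieBialgebra

variable {K : Type*} [Field K] [CharZero K] {𝔥 : Type*} [LieRing 𝔥] [LieAlgebra K 𝔥]
  [LieBialgebra K 𝔥]

theorem eq_zero_of_leftDer_eq_add₃ {X : Type*} (F : X → X → X → FormalFun K 𝔥)
    (a : Module.Dual K 𝔥 → X → X) (h1 : ∀ x y z, evalOne K 𝔥 (F x y z) = 0)
    (hL : ∀ ξ x y z, leftDer ξ (F x y z) = F (a ξ x) y z + F x (a ξ y) z + F x y (a ξ z))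
    (x y z : X) : F x y z = 0 :=
  eq_zero_of_leftDer_mem_span (fun p : X × X × X => F p.1 p.2.1 p.2.2) (fun p => h1 _ _ _)
    (fun ξ p => by
      rw [hL]
      exact Submodule.add_mem _ (Submodule.add_mem _
        (Submodule.subset_span ⟨(a ξ p.1, p.2.1, p.2.2), rfl⟩)
        (Submodule.subset_span ⟨(p.1, a ξ p.2.1, p.2.2), rfl⟩))
        (Submodule.subset_span ⟨(p.1, p.2.1, a ξ p.2.2), rfl⟩)) (x, y, z)

variable [FiniteDimensional K 𝔥]

/-- The function `x ↦ ω_x(-, v)` with values in `𝔥*`. -/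
noncomputable def omegaForm (v : Double K 𝔥) : 𝔥 →ₗ[K] FormalFun K 𝔥 :=
  (omegaBilin K 𝔥).flip v ∘ₗ Double.inl K 𝔥

theorem omegaForm_apply (v : Double K 𝔥) (y : 𝔥) :
    omegaForm v y = omegaBilin K 𝔥 (Double.inl K 𝔥 y) v := rfl

theorem leftDer_comp_omegaForm (ξ : Module.Dual K 𝔥) (v : Double K 𝔥) :
    ((leftDer ξ : Derivation K (FormalFun K 𝔥) (FormalFun K 𝔥)) :
        FormalFun K 𝔥 →ₗ[K] FormalFun K 𝔥) ∘ₗ omegaForm v =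
      omegaForm ⁅Double.inr K 𝔥 ξ, v⁆ - omegaForm v ∘ₗ coact ξ := by
  ext1 y
  simp only [LinearMap.comp_apply, Derivation.coeFn_coe, omegaForm_apply, LinearMap.sub_apply,
    leftDer_omegaBilin_inl_left, coact_apply]
  ring

theorem pairInto_neg_left {A : Type*} [CommRing A] [Algebra K A] (φ ψ : 𝔥 →ₗ[K] A)
    (t : 𝔥 ⊗[K] 𝔥) : pairInto (-φ) ψ t = -pairInto φ ψ t := by
  rw [eq_neg_iff_add_eq_zero, ← pairInto_add_left, neg_add_cancel]
  simp [pairInto]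

theorem pairInto_neg_right {A : Type*} [CommRing A] [Algebra K A] (φ ψ : 𝔥 →ₗ[K] A)
    (t : 𝔥 ⊗[K] 𝔥) : pairInto φ (-ψ) t = -pairInto φ ψ t := by
  rw [eq_neg_iff_add_eq_zero, ← pairInto_add_right, neg_add_cancel]
  simp [pairInto]

/-- The function `x ↦ ⟨[ω_x(-, u), ω_x(-, v)], w⟩`. -/
noncomputable def omegaCobracket (u v w : Double K 𝔥) : FormalFun K 𝔥 :=
  pairInto (omegaForm u) (omegaForm v) (δ (K := K) (Double.fst K 𝔥 w))

theorem leftDer_omegaCobracket (ξ : Module.Dual K 𝔥) (u v w : Double K 𝔥) :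
    leftDer ξ (omegaCobracket u v w) = omegaCobracket ⁅Double.inr K 𝔥 ξ, u⁆ v w +
      omegaCobracket u ⁅Double.inr K 𝔥 ξ, v⁆ w + omegaCobracket u v ⁅Double.inr K 𝔥 ξ, w⁆ := by
  have hw : Double.fst K 𝔥 ⁅Double.inr K 𝔥 ξ, w⁆ = -coact ξ (Double.fst K 𝔥 w) := by
    simp [Double.fst_lie, coact_apply]
  simp only [omegaCobracket]
  rw [derivation_pairInto, leftDer_comp_omegaForm, leftDer_comp_omegaForm, hw, map_neg, δ_coact,
    sub_eq_add_neg, sub_eq_add_neg, pairInto_add_left, pairInto_add_right, pairInto_neg_left,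
    pairInto_neg_right, pairInto_comp_rTensor, pairInto_comp_lTensor, map_neg, map_add]
  ring

theorem evalOne_omegaCobracket (u v w : Double K 𝔥) :
    evalOne K 𝔥 (omegaCobracket u v w) =
      Double.snd K 𝔥 v (contract (Double.snd K 𝔥 u) (δ (K := K) (Double.fst K 𝔥 w))) := by
  rw [omegaCobracket, map_pairInto, apply_contract_δ, dual_lie_apply, pair_eq_pairInto]
  congr 2 <;>
  · ext y
    simp [omegaForm_apply, evalOne_omegaBilin]

/-- Both sides at `x` are obtained from their values at `x = 1` by applying `Ad(x⁻¹)` to `u, v, w`.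
At `x = 1` the identity is an expansion of the bracket of the double, in which the cobracket terms
account for the `𝔥`-components of brackets between `𝔥` and `𝔥*`. -/
theorem cyclic_omega_lie (u v w : Double K 𝔥) :
    omegaBilin K 𝔥 ⁅u, v⁆ w + omegaBilin K 𝔥 ⁅v, w⁆ u + omegaBilin K 𝔥 ⁅w, u⁆ v =
      omegaCobracket u v w + omegaCobracket v w u + omegaCobracket w u v +
        algebraMap K (FormalFun K 𝔥) (Double.pairing K 𝔥 ⁅u, v⁆ w) := by
  rw [← sub_eq_zero]
  refine eq_zero_of_leftDer_eq_add₃ (fun u v w =>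
    omegaBilin K 𝔥 ⁅u, v⁆ w + omegaBilin K 𝔥 ⁅v, w⁆ u + omegaBilin K 𝔥 ⁅w, u⁆ v -
      (omegaCobracket u v w + omegaCobracket v w u + omegaCobracket w u v +
        algebraMap K (FormalFun K 𝔥) (Double.pairing K 𝔥 ⁅u, v⁆ w)))
    (fun ξ u => ⁅Double.inr K 𝔥 ξ, u⁆) ?_ ?_ u v w
  · intro u v w
    simp only [map_sub, map_add, evalOne_omegaBilin, AlgHom.commutes, evalOne_omegaCobracket,
      Algebra.algebraMap_self, RingHom.id_apply]
    simp only [Double.pairing_apply, Double.fst_lie, Double.snd_lie, map_add, map_sub,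
      LinearMap.add_apply, LinearMap.sub_apply, compAd_apply, ← apply_contract_δ]
    rw [← lie_skew (Double.fst K 𝔥 w) (Double.fst K 𝔥 u), map_neg,
      Double.snd_contract (Double.snd K 𝔥 u) (Double.snd K 𝔥 w),
      Double.snd_contract (Double.snd K 𝔥 v) (Double.snd K 𝔥 u),
      Double.snd_contract (Double.snd K 𝔥 w) (Double.snd K 𝔥 v)]
    ring
  · intro ξ u v w
    -- The trilinear form `⟨[u, v], w⟩` is invariant, in accordance with the constancy of this term
    -- in `x`.
    have e : Double.pairing K 𝔥 ⁅⁅Double.inr K 𝔥 ξ, u⁆, v⁆ w +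
        Double.pairing K 𝔥 ⁅u, ⁅Double.inr K 𝔥 ξ, v⁆⁆ w +
        Double.pairing K 𝔥 ⁅u, v⁆ ⁅Double.inr K 𝔥 ξ, w⁆ = 0 := by
      rw [← LinearMap.add_apply, ← map_add, ← leibniz_lie, ← Double.pairing_lie,
        ← lie_skew (Double.inr K 𝔥 ξ) ⁅u, v⁆, map_neg, LinearMap.neg_apply]
      ring
    have e_map := congrArg (algebraMap K (FormalFun K 𝔥)) e
    rw [map_add, map_add, map_zero] at e_map
    simp only [map_sub, map_add, leftDer_omegaBilin, Derivation.map_algebraMap,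
      leftDer_omegaCobracket, leibniz_lie (Double.inr K 𝔥 ξ), LinearMap.add_apply]
    linear_combination e_map

/-- The form `ω_x(-, v)` on `𝔥`, for `v ∈ 𝔥`. -/
noncomputable def omForm (v : 𝔥) : 𝔥 →ₗ[K] FormalFun K 𝔥 := (om K 𝔥).flip v

theorem omForm_apply (v y : 𝔥) : omForm v y = om K 𝔥 y v := rfl

/-- `𝔥` is an isotropic subalgebra, so the constant term `⟨[u, v], w⟩` disappears. This identity
serves both the dressing derivative of `ω` and the Yang-Baxter equation for its inverse. -/
theorem cyclic_om_lie (u v w : 𝔥) :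
    om K 𝔥 ⁅u, v⁆ w + om K 𝔥 ⁅v, w⁆ u + om K 𝔥 ⁅w, u⁆ v =
      pairInto (omForm u) (omForm v) (δ (K := K) w) +
        pairInto (omForm v) (omForm w) (δ (K := K) u) +
          pairInto (omForm w) (omForm u) (δ (K := K) v) := by
  have hl : ∀ a b : 𝔥, Double.inl K 𝔥 ⁅a, b⁆ = ⁅Double.inl K 𝔥 a, Double.inl K 𝔥 b⁆ := by
    intro a b
    ext1
    · simp [Double.fst_lie, contract]
    · ext
      simp [Double.snd_lie]
  have h := cyclic_omega_lie (Double.inl K 𝔥 u) (Double.inl K 𝔥 v) (Double.inl K 𝔥 w)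
  rw [← hl, ← hl, ← hl, Double.pairing_apply] at h
  simp only [Double.snd_inl, LinearMap.zero_apply, add_zero, map_zero] at h
  exact h

/-- `ξ ↦ L_ξ f`. -/
noncomputable def leftDerLin (f : FormalFun K 𝔥) : Module.Dual K 𝔥 →ₗ[K] FormalFun K 𝔥 where
  toFun ξ := leftDer ξ f
  map_add' ξ η := leftDer_add ξ η f
  map_smul' c ξ := leftDer_smul c ξ f

theorem dress_apply (a : Double K 𝔥) (f : FormalFun K 𝔥) :
    dress a f = -∑ s, adInvCoeff (Module.Dual.eval K 𝔥 (Module.finBasis K 𝔥 s) ∘ₗ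
      Double.snd K 𝔥) a * rightDer ((Module.finBasis K 𝔥).coord s) f := by
  rw [dress, Derivation.neg_apply, ← Derivation.coeFnAddMonoidHom_apply, map_sum,
    Finset.sum_apply]
  rfl

/-- The dressing action in terms of left translations. -/
theorem dress_eq_sum_leftDer (a : Double K 𝔥) (f : FormalFun K 𝔥) :
    dress a f = ∑ s, omegaForm a (Module.finBasis K 𝔥 s) *
      leftDer ((Module.finBasis K 𝔥).coord s) f := by
  rw [← sub_eq_zero]
  refine eq_zero_of_leftDer_eq_add (fun a f => dress a f - ∑ s,
    omegaForm a (Module.finBasis K 𝔥 s) * leftDer ((Module.finBasis K 𝔥).coord s) f)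
    (fun ξ u => ⁅Double.inr K 𝔥 ξ, u⁆) (fun ξ f => leftDer ξ f) ?_ ?_ a f
  · intro a f
    simp only [dress_apply, map_sub, map_neg, map_sum, map_mul, evalOne_adInvCoeff,
      evalOne_rightDer, evalOne_leftDer, omegaForm_apply, evalOne_omegaBilin]
    simp
  · intro ξ a f
    -- The derivative of the coefficient `ω(e_s, a)` contains `-ω(coact ξ e_s, a)`. Transposing
    -- `coact ξ` onto the dual basis turns this into `L_{[ξ, ε^s]}`, which cancels the commutator of
    -- `L_ξ` and `L_{ε^s}`.
    have e := (Module.finBasis K 𝔥).sum_apply_coord_comp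
      ((LinearMap.mul K (FormalFun K 𝔥)).compl₁₂ (omegaForm a) (leftDerLin f)) (coact ξ)
    simp only [LinearMap.compl₁₂_apply, LinearMap.mul_apply', comp_coact] at e
    have hl : ∀ s, leftDer ξ (omegaForm a (Module.finBasis K 𝔥 s)) =
        omegaForm ⁅Double.inr K 𝔥 ξ, a⁆ (Module.finBasis K 𝔥 s) -
          omegaForm a (coact ξ (Module.finBasis K 𝔥 s)) := fun s =>
      LinearMap.congr_fun (leftDer_comp_omegaForm ξ a) _
    have e2 : ∀ η, leftDerLin f ⁅ξ, η⁆ = leftDer ξ (leftDer η f) - leftDer η (leftDer ξ f) :=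
      fun η => leftDer_lie ξ η f
    simp only [e2] at e
    change ∑ s, _ * leftDer _ f = _ at e
    simp only [dress_apply, map_sub, map_neg, map_sum, Derivation.leibniz, smul_eq_mul,
      leftDer_adInvCoeff, leftDer_rightDer, hl, Finset.sum_add_distrib]
    simp only [mul_sub, Finset.sum_sub_distrib] at e ⊢
    simp only [mul_comm (leftDer _ f), mul_comm (rightDer _ f)] at e ⊢
    linear_combination e

theorem dress_inl_eq_sum_leftDer (a : 𝔥) (f : FormalFun K 𝔥) :
    dress (Double.inl K 𝔥 a) f = ∑ s, omForm a (Module.finBasis K 𝔥 s) *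
      leftDer ((Module.finBasis K 𝔥).coord s) f :=
  dress_eq_sum_leftDer _ f

theorem sum_mul_contract {V A : Type*} [LieRing V] [LieAlgebra K V] [CommRing A]
    [Algebra K A] {ι : Type*} [Fintype ι] (b : Module.Basis ι K V) (φ ψ : V →ₗ[K] A)
    (t : V ⊗[K] V) :
    ∑ s, φ (b s) * ψ (contract (b.coord s) t) = pairInto φ ψ t := by
  induction t with
  | zero => simp
  | tmul x y =>
    rw [pairInto_tmul, ← b.sum_coord_smul_apply φ x, Finset.sum_mul]
    refine Finset.sum_congr rfl fun s _ => ?_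
    simp
  | add s t hs ht => simp only [map_add, mul_add, Finset.sum_add_distrib, hs, ht]

/-- Expanding `dress_a` in left translations and applying `leftDer_om` leaves `ω([v, u], a)` and two
cobracket terms; the cyclic identity for `a, u, v` exchanges them for the right hand side. The last
term measures the failure of `ω` to be equivariant. -/
theorem dress_om (a u v : 𝔥) :
    dress (Double.inl K 𝔥 a) (om K 𝔥 u v) = om K 𝔥 ⁅a, u⁆ v + om K 𝔥 u ⁅a, v⁆ -
      pairInto (omForm u) (omForm v) (δ (K := K) a) := by
  have h := cyclic_om_lie (K := K) a u v
  have e1 := sum_mul_contract (Module.finBasis K 𝔥) (omForm a) (omForm v) (δ (K := K) u)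
  have e2 := sum_mul_contract (Module.finBasis K 𝔥) (omForm a) (omForm u) (δ (K := K) v)
  have e3 := (Module.finBasis K 𝔥).sum_coord_smul_apply (omForm a) ⁅v, u⁆
  have e4 : pairInto (omForm a) (omForm v) (δ (K := K) u) =
      -pairInto (omForm v) (omForm a) (δ (K := K) u) := by
    rw [← pairInto_comm, LieBialgebra.antisymm, map_neg]
  have e5 : ∀ s, omForm a (Module.finBasis K 𝔥 s) *
      leftDer ((Module.finBasis K 𝔥).coord s) (om K 𝔥 u v) =
      -(omForm a (Module.finBasis K 𝔥 s) *
        omForm v (contract ((Module.finBasis K 𝔥).coord s) (δ (K := K) u))) +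
      omForm a (Module.finBasis K 𝔥 s) *
        omForm u (contract ((Module.finBasis K 𝔥).coord s) (δ (K := K) v)) +
      (Module.finBasis K 𝔥).coord s ⁅v, u⁆ • omForm a (Module.finBasis K 𝔥 s) := by
    intro s
    rw [leftDer_om, om_skew u, Algebra.smul_def]
    simp only [omForm_apply]
    ring
  rw [dress_inl_eq_sum_leftDer]
  simp only [e5, Finset.sum_add_distrib, Finset.sum_neg_distrib, e1, e2, e3]
  simp only [omForm_apply]
  rw [e4, om_skew u ⁅a, v⁆, ← lie_skew a v, ← lie_skew v u]
  simp only [map_neg, LinearMap.neg_apply]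
  linear_combination -h

end FormalFun

/-! ### Powers of Lie algebra elements span the enveloping algebra. -/

section PowersSpan

attribute [local instance] LieRing.ofAssociativeRing

open Polynomial in
theorem eq_zero_of_forall_sum_pow_eq_zero {K : Type*} [Field K] [CharZero K] (n : ℕ) (c : ℕ → K)
    (h : ∀ t : K, ∑ k ∈ Finset.range n, t ^ k * c k = 0) (k : ℕ) (hk : k < n) : c k = 0 := by
  have hp : (∑ k ∈ Finset.range n, C (c k) * X ^ k : K[X]) = 0 := by
    apply Polynomial.funext
    intro t
    simp only [eval_finsetSum, eval_mul, eval_C, eval_pow, eval_X, eval_zero]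
    rw [← h t]
    exact Finset.sum_congr rfl fun k _ => mul_comm _ _
  have := congrArg (fun p => p.coeff k) hp
  simpa [finsetSum_coeff, coeff_C_mul, coeff_X_pow, hk] using this

namespace UEnv

variable {K : Type*} [Field K] [CharZero K] {L : Type*} [LieRing L] [LieAlgebra K L]

/-- The coefficients of `(ξ + t η) ^ n` as a polynomial in `t`. -/
noncomputable def powCoeff {R : Type*} [Ring R] (x z : R) (n : ℕ) : ℕ → R :=
  fun k => ((Polynomial.C x + Polynomial.C z * Polynomial.X) ^ n).coeff k

theorem powCoeff_succ_zero {R : Type*} [Ring R] (x z : R) (n : ℕ) :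
    powCoeff x z (n + 1) 0 = x * powCoeff x z n 0 := by
  rw [powCoeff, powCoeff, pow_succ', add_mul, Polynomial.coeff_add, mul_assoc,
    Polynomial.coeff_C_mul, Polynomial.coeff_C_mul, Polynomial.coeff_X_mul_zero, mul_zero,
    add_zero]

theorem powCoeff_succ_succ {R : Type*} [Ring R] (x z : R) (n k : ℕ) :
    powCoeff x z (n + 1) (k + 1) = x * powCoeff x z n (k + 1) + z * powCoeff x z n k := by
  rw [powCoeff, powCoeff, powCoeff, pow_succ', add_mul, Polynomial.coeff_add, mul_assoc,
    Polynomial.coeff_C_mul, Polynomial.coeff_C_mul, Polynomial.coeff_X_mul]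

theorem powCoeff_zero {R : Type*} [Ring R] (x z : R) (n : ℕ) : powCoeff x z n 0 = x ^ n := by
  induction n with
  | zero => simp [powCoeff]
  | succ n ih => rw [powCoeff_succ_zero, ih, pow_succ']

theorem powCoeff_of_lt {R : Type*} [Ring R] (x z : R) (n k : ℕ) (h : n < k) :
    powCoeff x z n k = 0 := by
  induction n generalizing k with
  | zero =>
    have hk : k ≠ 0 := by omega
    simp [powCoeff, Polynomial.coeff_one, hk]
  | succ n ih =>
    obtain ⟨k, rfl⟩ : ∃ m, k = m + 1 := ⟨k - 1, by omega⟩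
    rw [powCoeff_succ_succ, ih _ (by omega), ih _ (by omega), mul_zero, mul_zero, add_zero]

theorem add_smul_pow {R : Type*} [Ring R] [Algebra K R] (x z : R) (t : K) (n : ℕ) :
    (x + t • z) ^ n = ∑ k ∈ Finset.range (n + 1), t ^ k • powCoeff x z n k := by
  induction n with
  | zero => simp [powCoeff]
  | succ n ih =>
    rw [pow_succ', ih, add_mul, Finset.sum_range_succ' _ (n + 1), powCoeff_succ_zero]
    simp only [powCoeff_succ_succ, smul_add, Finset.sum_add_distrib, Finset.mul_sum]
    have e1 : ∑ k ∈ Finset.range (n + 1), t ^ (k + 1) • (x * powCoeff x z n (k + 1)) +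
        t ^ 0 • (x * powCoeff x z n 0) =
        ∑ k ∈ Finset.range (n + 1), x * t ^ k • powCoeff x z n k := by
      rw [← Finset.sum_range_succ' (fun k => t ^ k • (x * powCoeff x z n k)),
        Finset.sum_range_succ, powCoeff_of_lt x z n (n + 1) (by omega), mul_zero, smul_zero,
        add_zero]
      exact Finset.sum_congr rfl fun k _ => (mul_smul_comm _ _ _).symm
    rw [← e1]
    have e2 : ∀ k, t • z * t ^ k • powCoeff x z n k = t ^ (k + 1) • (z * powCoeff x z n k) := by
      intro k
      rw [smul_mul_smul_comm, pow_succ']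
    simp only [e2]
    abel

open UniversalEnvelopingAlgebra in
/-- The linear coefficient of `(ξ + t η) ^ (n + 1)` is `(n + 1) η ξ ^ n` up to
terms `η' ξ ^ k` with `k < n`. -/
theorem powCoeff_one_sub_mem (x z : L) (n : ℕ) :
    powCoeff (ι K x) (ι K z) (n + 1) 1 - ((n : K) + 1) • (ι K z * ι K x ^ n) ∈
      Submodule.span K {y | ∃ (z' : L) (k : ℕ), k < n ∧ y = ι K z' * ι K x ^ k} := by
  induction n generalizing z with
  | zero =>
    simp [-ι_apply, powCoeff_succ_succ, powCoeff_zero, powCoeff_of_lt (ι K x) (ι K z) 0 1]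
  | succ n ih =>
    have hmono : ∀ y ∈ Submodule.span K {y | ∃ (z' : L) (k : ℕ), k < n ∧
        y = ι K z' * ι K x ^ k}, ι K x * y ∈
        Submodule.span K {y | ∃ (z' : L) (k : ℕ), k < n + 1 ∧ y = ι K z' * ι K x ^ k} := by
      intro y hy
      induction hy using Submodule.span_induction with
      | mem y hy =>
        obtain ⟨z', k, hk, rfl⟩ := hy
        have e : ι K x * (ι K z' * ι K x ^ k) =
            ι K ⁅x, z'⁆ * ι K x ^ k + ι K z' * ι K x ^ (k + 1) := by
          rw [LieHom.map_lie, LieRing.of_associative_ring_bracket, pow_succ']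
          noncomm_ring
        rw [e]
        exact Submodule.add_mem _ (Submodule.subset_span ⟨⁅x, z'⁆, k, by omega, rfl⟩)
          (Submodule.subset_span ⟨z', k + 1, by omega, rfl⟩)
      | zero => simp
      | add y y' _ _ hy hy' =>
        rw [mul_add]
        exact Submodule.add_mem _ hy hy'
      | smul c y _ hy =>
        rw [mul_smul_comm]
        exact Submodule.smul_mem _ _ hy
    -- The linear coefficient is `∑ x^a z x^b` with `a + b = n + 1`. Moving one factor `x` past `z`
    -- adds one copy of `z x^(n+1)` and produces `[x, z] x^n` terms of lower order.
    have key : powCoeff (ι K x) (ι K z) (n + 1 + 1) 1 -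
        (((n + 1 : ℕ) : K) + 1) • (ι K z * ι K x ^ (n + 1)) =
        ι K x * (powCoeff (ι K x) (ι K z) (n + 1) 1 - ((n : K) + 1) • (ι K z * ι K x ^ n)) +
          ((n : K) + 1) • (ι K ⁅x, z⁆ * ι K x ^ n) := by
      rw [powCoeff_succ_succ _ _ (n + 1) 0, powCoeff_zero, LieHom.map_lie,
        LieRing.of_associative_ring_bracket, pow_succ' _ n]
      simp only [mul_sub, sub_mul, mul_smul_comm, smul_sub, mul_assoc]
      push_cast
      module
    rw [key]
    exact Submodule.add_mem _ (hmono _ (ih z))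
      (Submodule.smul_mem _ _ (Submodule.subset_span ⟨⁅x, z⁆, n, by omega, rfl⟩))

open UniversalEnvelopingAlgebra in
/-- In characteristic zero the enveloping algebra is spanned by the powers of elements of `L`. -/
theorem eq_zero_of_forall_pow (f : UniversalEnvelopingAlgebra K L →ₗ[K] K)
    (hf : ∀ (x : L) (n : ℕ), f (ι K x ^ n) = 0) : f = 0 := by
  have key : ∀ (f : UniversalEnvelopingAlgebra K L →ₗ[K] K),
      (∀ (x : L) (n : ℕ), f (ι K x ^ n) = 0) → ∀ (n : ℕ) (x z : L), f (ι K z * ι K x ^ n) = 0 := by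
    intro f hf n
    induction n using Nat.strong_induction_on with
    | _ n ih =>
      intro x z
      -- Polarization: `f((x + t z)^(n+1))` is a polynomial in `t` with `n + 2` coefficients that
      -- vanishes for every `t`.
      have h1 : f (powCoeff (ι K x) (ι K z) (n + 1) 1) = 0 := by
        refine eq_zero_of_forall_sum_pow_eq_zero (n + 2)
          (fun k => f (powCoeff (ι K x) (ι K z) (n + 1) k)) (fun t => ?_) 1 (by omega)
        rw [← hf (x + t • z) (n + 1), map_add, map_smul, add_smul_pow, map_sum]
        simp
      have h2 : ∀ y ∈ Submodule.span K {y | ∃ (z' : L) (k : ℕ), k < n ∧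
          y = ι K z' * ι K x ^ k}, f y = 0 := by
        intro y hy
        induction hy using Submodule.span_induction with
        | mem y hy =>
          obtain ⟨z', k, hk, rfl⟩ := hy
          exact ih k hk x z'
        | zero => simp
        | add y y' _ _ hy hy' => rw [map_add, hy, hy', add_zero]
        | smul c y _ hy => rw [map_smul, hy, smul_zero]
      have h3 := h2 _ (powCoeff_one_sub_mem x z n)
      rw [map_sub, h1, map_smul, zero_sub, neg_eq_zero, smul_eq_zero] at h3
      -- Characteristic zero is needed to divide by `n + 1`.
      exact h3.resolve_left (by exact_mod_cast Nat.succ_ne_zero n)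
  let V : Submodule K (UniversalEnvelopingAlgebra K L) :=
    { carrier := {y | ∀ f : UniversalEnvelopingAlgebra K L →ₗ[K] K,
        (∀ (x : L) (n : ℕ), f (ι K x ^ n) = 0) → f y = 0}
      add_mem' := by
        intro y z hy hz f hf
        rw [map_add, hy f hf, hz f hf, add_zero]
      zero_mem' := fun f _ => map_zero _
      smul_mem' := by
        intro c y hy f hf
        rw [map_smul, hy f hf, smul_zero] }
  ext y
  refine mem_of_mulLeft_stable V ?_ ?_ y f hf
  · intro f hf
    simpa using hf 0 0
  · intro x y hy f hf
    -- By `key`, the functional `y ↦ f(x y)` again vanishes on all powers. This is why the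
    -- annihilator is defined with all such `f` at once.
    exact hy (f ∘ₗ LinearMap.mulLeft K (ι K x)) fun x' n => key f hf n x' x

end UEnv

end PowersSpan

/-! ### Restriction to one-parameter subgroups; `K[[H*]]` is a domain. -/

namespace FormalFun

open LieBialgebra

variable {K : Type*} [Field K] [CharZero K] {𝔥 : Type*} [LieRing 𝔥] [LieAlgebra K 𝔥]
  [LieBialgebra K 𝔥]

open UniversalEnvelopingAlgebra in
-- `ξ` is primitive and `ξ ⊗ 1` commutes with `1 ⊗ ξ`, so the coproduct of `ξ^n` is given by the
-- binomial theorem. Dividing by `n!` turns the formula into the Cauchy product of power series.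
theorem eval_mul_ι_pow (ξ : Module.Dual K 𝔥) (f g : FormalFun K 𝔥) (n : ℕ) :
    (f * g).eval (ι K ξ ^ n) = ∑ m ∈ Finset.HasAntidiagonal.antidiagonal n,
      (n.choose m.1 : K) * (f.eval (ι K ξ ^ m.1) * g.eval (ι K ξ ^ m.2)) := by
  have hc : Commute ((ι K ξ : UniversalEnvelopingAlgebra K (Module.Dual K 𝔥)) ⊗ₜ[K]
      (1 : UniversalEnvelopingAlgebra K (Module.Dual K 𝔥))) (1 ⊗ₜ[K] ι K ξ) := by
    simp [Commute, SemiconjBy, -ι_apply]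
  rw [eval_mul, Bialgebra.comul_pow, UEnv.comul_ι, hc.add_pow']
  simp only [Algebra.TensorProduct.tmul_pow, one_pow, Algebra.TensorProduct.tmul_mul_tmul, mul_one,
    one_mul, map_sum]
  refine Finset.sum_congr rfl fun m _ => ?_
  rw [map_nsmul, map_nsmul, TensorProduct.map_tmul, LinearMap.mul'_apply, nsmul_eq_mul]

/-- The restriction of functions to the one-parameter subgroup `t ↦ exp(t ξ)`. -/
noncomputable def line (ξ : Module.Dual K 𝔥) : FormalFun K 𝔥 →+* PowerSeries K where
  toFun f := PowerSeries.mk fun n =>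
    (n.factorial : K)⁻¹ * f.eval (UniversalEnvelopingAlgebra.ι K ξ ^ n)
  map_zero' := by
    ext n
    simp
  map_add' f g := by
    ext n
    simp [mul_add]
  map_one' := by
    ext n
    rw [PowerSeries.coeff_mk, eval_one, Bialgebra.counit_pow, UEnv.counit_ι, PowerSeries.coeff_one]
    rcases n with _ | n <;> simp
  map_mul' f g := by
    ext n
    rw [PowerSeries.coeff_mk, PowerSeries.coeff_mul, eval_mul_ι_pow, Finset.mul_sum]
    refine Finset.sum_congr rfl fun m hm => ?_
    rw [Finset.HasAntidiagonal.mem_antidiagonal] at hm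
    subst hm
    rw [PowerSeries.coeff_mk, PowerSeries.coeff_mk, Nat.cast_add_choose]
    have h0 : ((m.1 + m.2).factorial : K) ≠ 0 := by exact_mod_cast Nat.factorial_ne_zero _
    field_simp

theorem coeff_line (ξ : Module.Dual K 𝔥) (f : FormalFun K 𝔥) (n : ℕ) :
    PowerSeries.coeff n (line ξ f) =
      (n.factorial : K)⁻¹ * f.eval (UniversalEnvelopingAlgebra.ι K ξ ^ n) :=
  PowerSeries.coeff_mk n fun n =>
    (n.factorial : K)⁻¹ * f.eval (UniversalEnvelopingAlgebra.ι K ξ ^ n)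

theorem line_ne_zero {ξ : Module.Dual K 𝔥} {f : FormalFun K 𝔥} {n : ℕ}
    (h : f.eval (UniversalEnvelopingAlgebra.ι K ξ ^ n) ≠ 0) : line ξ f ≠ 0 := by
  intro h0
  have := coeff_line ξ f n
  rw [h0, map_zero] at this
  exact mul_ne_zero (inv_ne_zero (by exact_mod_cast Nat.factorial_ne_zero n)) h this.symm

theorem exists_eval_pow_ne_zero {f : FormalFun K 𝔥} (hf : f ≠ 0) :
    ∃ (ξ : Module.Dual K 𝔥) (n : ℕ), f.eval (UniversalEnvelopingAlgebra.ι K ξ ^ n) ≠ 0 := by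
  by_contra! h
  exact hf (ext' fun y => LinearMap.congr_fun (UEnv.eq_zero_of_forall_pow f.eval h) y)

open Polynomial in
theorem exists_polynomial_eval_pow (f : FormalFun K 𝔥) (ξ η : Module.Dual K 𝔥) (n : ℕ) :
    ∃ p : K[X], ∀ t : K,
      p.eval t = f.eval (UniversalEnvelopingAlgebra.ι K (ξ + t • η) ^ n) := by
  refine ⟨∑ k ∈ Finset.range (n + 1), C (f.eval (UEnv.powCoeff
    (UniversalEnvelopingAlgebra.ι K ξ) (UniversalEnvelopingAlgebra.ι K η) n k)) * X ^ k,
    fun t => ?_⟩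
  rw [map_add, map_smul, UEnv.add_smul_pow, map_sum, eval_finsetSum]
  exact Finset.sum_congr rfl fun k _ => by
    rw [Polynomial.eval_mul, eval_C, eval_pow, eval_X, map_smul, smul_eq_mul, mul_comm]

/-- Let `f` and `g` be nonzero on powers of `ξ` and `η` respectively. On the affine line through `ξ`
and `η` the two values are polynomials in the parameter, nonzero at `t = 0` and at `t = 1`. As `K`
is infinite, some point of the line makes both nonzero, and along its one-parameter subgroup `f` and
`g` become nonzero elements of the domain `K[[t]]`. -/
instance instNoZeroDivisors : NoZeroDivisors (FormalFun K 𝔥) where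
  eq_zero_or_eq_zero_of_mul_eq_zero := by
    intro f g hfg
    by_contra! hne
    obtain ⟨ξ, n, hξ⟩ := exists_eval_pow_ne_zero hne.1
    obtain ⟨η, m, hη⟩ := exists_eval_pow_ne_zero hne.2
    obtain ⟨p, hp⟩ := exists_polynomial_eval_pow f ξ (η - ξ) n
    obtain ⟨q, hq⟩ := exists_polynomial_eval_pow g ξ (η - ξ) m
    have hp0 : p ≠ 0 := by
      rintro rfl
      have := hp 0
      rw [zero_smul, add_zero, Polynomial.eval_zero] at this
      exact hξ this.symm
    have hq0 : q ≠ 0 := by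
      rintro rfl
      have := hq 1
      rw [one_smul, add_sub_cancel, Polynomial.eval_zero] at this
      exact hη this.symm
    obtain ⟨t, ht⟩ : ∃ t, (p * q).eval t ≠ 0 := by
      by_contra! h
      exact mul_ne_zero hp0 hq0 (Polynomial.funext fun t => by rw [h t, Polynomial.eval_zero])
    rw [Polynomial.eval_mul, hp, hq] at ht
    have h1 := line_ne_zero (left_ne_zero_of_mul ht)
    have h2 := line_ne_zero (right_ne_zero_of_mul ht)
    exact mul_ne_zero h1 h2 (by rw [← map_mul, hfg, map_zero])

end FormalFun

/-! ### The determinant of `ω` on `𝔲` is nonzero. -/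

namespace IsSplitting

open LieBialgebra FormalFun

variable {K : Type*} [Field K] [CharZero K] {𝔩 𝔤 : Type*} [LieRing 𝔩] [LieAlgebra K 𝔩]
  [LieBialgebra K 𝔩] [LieRing 𝔤] [LieAlgebra K 𝔤] [LieBialgebra K 𝔤] {i : 𝔩 →ₗ⁅K⁆ 𝔤}
  {𝔲 : Submodule K 𝔤} (h : IsSplitting i 𝔲)

theorem evalOne_res (f : FormalFun K 𝔤) : evalOne K 𝔩 (h.res f) = evalOne K 𝔤 f := by
  change f.eval (UEnv.map h.dualIncl 1) = f.eval 1
  rw [map_one]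

theorem leftDer_res (ξ : Module.Dual K 𝔩) (f : FormalFun K 𝔤) :
    leftDer ξ (h.res f) = h.res (leftDer (h.dualIncl ξ) f) := by
  ext y
  change -f.eval (UEnv.map h.dualIncl (UniversalEnvelopingAlgebra.ι K ξ * y)) =
    -f.eval (UniversalEnvelopingAlgebra.ι K (h.dualIncl ξ) * UEnv.map h.dualIncl y)
  rw [map_mul, UEnv.map_ι]

theorem dualIncl_apply (ξ : Module.Dual K 𝔩) (x : 𝔤) : h.dualIncl ξ x = ξ (h.proj x) := rfl

variable [FiniteDimensional K 𝔤]

theorem omegaMatrix_apply (s t : Fin (Module.finrank K 𝔲)) :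
    h.omegaMatrix s t =
      h.res (om K 𝔤 (Module.finBasis K 𝔲 s : 𝔤) (Module.finBasis K 𝔲 t : 𝔤)) := rfl

/-- Along `t ↦ exp(tξ)` the matrix of `ω` is `t M(t)` with `M(0)` the matrix of `ω₀(ξ)`. Its
determinant is a power of `t` times a series whose constant term is `det ω₀(ξ) ≠ 0`. -/
theorem detP_ne_zero (hnd : h.Nondegenerate) : h.detP ≠ 0 := by
  obtain ⟨ξ, hξ⟩ := hnd
  let M : Matrix (Fin (Module.finrank K 𝔲)) (Fin (Module.finrank K 𝔲)) (PowerSeries K) :=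
    Matrix.of fun s t => PowerSeries.mk fun n =>
      PowerSeries.coeff (n + 1) (line ξ (h.omegaMatrix s t))
  have hM : (line ξ).mapMatrix h.omegaMatrix = (PowerSeries.X : PowerSeries K) • M := by
    ext s t n
    rw [RingHom.mapMatrix_apply, Matrix.map_apply, Matrix.smul_apply, smul_eq_mul]
    rcases n with _ | n
    · rw [PowerSeries.coeff_zero_X_mul, coeff_line, pow_zero]
      change _ * evalOne K 𝔩 (h.omegaMatrix s t) = 0
      rw [omegaMatrix_apply, evalOne_res, evalOne_om, mul_zero]
    · rw [PowerSeries.coeff_succ_X_mul]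
      simp [M]
  -- The coefficient of `t` is `-(L_ξ ω)(1)`. As `ω` vanishes at the neutral element, only the
  -- constant term of `leftDer_om` contributes.
  have hM0 : (PowerSeries.constantCoeff (R := K)).mapMatrix M =
      LinearMap.toMatrix₂ (Module.finBasis K 𝔲) (Module.finBasis K 𝔲) (h.omegaZero ξ) := by
    ext s t
    rw [RingHom.mapMatrix_apply, Matrix.map_apply, LinearMap.toMatrix₂_apply, omegaZero_apply]
    rw [← PowerSeries.coeff_zero_eq_constantCoeff_apply]
    change PowerSeries.coeff 0 (PowerSeries.mk fun n =>
      PowerSeries.coeff (n + 1) (line ξ (h.omegaMatrix s t))) = _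
    rw [PowerSeries.coeff_mk, zero_add, coeff_line, pow_one, Nat.factorial_one, Nat.cast_one,
      inv_one, one_mul, ← neg_inj, ← evalOne_leftDer, omegaMatrix_apply, leftDer_res, evalOne_res,
      leftDer_om, map_add, map_sub, map_neg, evalOne_om, evalOne_om, AlgHom.commutes,
      ← lie_skew, map_neg, dualIncl_apply]
    simp
  intro hdet
  have h1 : ((line ξ).mapMatrix h.omegaMatrix).det = 0 := by
    rw [← RingHom.map_det]
    exact (congrArg (line ξ) hdet).trans (map_zero _)
  rw [hM, Matrix.det_smul] at h1
  have h2 : M.det = 0 := (mul_eq_zero.mp h1).resolve_left (pow_ne_zero _ PowerSeries.X_ne_zero)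
  have h3 : ((PowerSeries.constantCoeff (R := K)).mapMatrix M).det = 0 := by
    rw [← RingHom.map_det, h2, map_zero]
  rw [hM0] at h3
  exact (LinearMap.BilinForm.nondegenerate_iff_det_ne_zero (Module.finBasis K 𝔲)).mp hξ h3

end IsSplitting

/-! ### Derivations of localizations. -/

section AwayDerivations

variable {K : Type*} [Field K] {R : Type*} [CommRing R] [Algebra K R]

/-- A derivation on `R[1/P]` along a ring homomorphism is determined by its values on `R`. -/
theorem away_leibniz_eq_zero {B : Type*} [CommRing B] (P : R) (θ : Localization.Away P →+* B)
    (d : Localization.Away P → B) (hd : ∀ x y, d (x * y) = θ x * d y + θ y * d x)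
    (h0 : ∀ r, d (algebraMap R (Localization.Away P) r) = 0) (z : Localization.Away P) :
    d z = 0 := by
  obtain ⟨n, r, hr⟩ := IsLocalization.Away.surj P z
  have h1 := hd z (algebraMap R (Localization.Away P) (P ^ n))
  rw [map_pow, hr, h0, ← map_pow, h0, mul_zero, zero_add] at h1
  have hu : IsUnit (θ (algebraMap R (Localization.Away P) (P ^ n))) := by
    rw [map_pow, map_pow]
    exact ((IsLocalization.Away.algebraMap_isUnit P).map θ).pow n
  exact (hu.mul_right_eq_zero).mp h1.symm

theorem awayDer_mul (D : Derivation K R R) (P : R) (x y : Localization.Away P) :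
    awayDer D P (x * y) = x * awayDer D P y + y * awayDer D P x := by
  rw [Derivation.leibniz, smul_eq_mul, smul_eq_mul]

theorem awayDer_add (D D' : Derivation K R R) (P : R) (z : Localization.Away P) :
    awayDer (D + D') P z = awayDer D P z + awayDer D' P z := by
  rw [← sub_eq_zero]
  refine away_leibniz_eq_zero P (RingHom.id _)
    (fun z => awayDer (D + D') P z - (awayDer D P z + awayDer D' P z)) ?_ ?_ z
  · intro x y
    simp only [awayDer_mul, RingHom.id_apply]
    ring
  · intro r
    simp only [awayDer_algebraMap, Derivation.add_apply, map_add, sub_self]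

theorem awayDer_smul (c : K) (D : Derivation K R R) (P : R) (z : Localization.Away P) :
    awayDer (c • D) P z = c • awayDer D P z := by
  rw [← sub_eq_zero]
  refine away_leibniz_eq_zero P (RingHom.id _)
    (fun z => awayDer (c • D) P z - c • awayDer D P z) ?_ ?_ z
  · intro x y
    simp only [awayDer_mul, RingHom.id_apply, smul_add, mul_sub, mul_smul_comm]
    ring
  · intro r
    simp only [awayDer_algebraMap, Derivation.smul_apply, algebraMap.coe_smul, sub_self]

theorem awayHom_algebraMap {S : Type*} [CommRing S] [Algebra K S] (φ : R →ₐ[K] S) (P : R) (Q : S)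
    (h : φ P ∣ Q) (f : R) :
    awayHom φ P Q h (algebraMap R (Localization.Away P) f) =
      algebraMap S (Localization.Away Q) (φ f) :=
  IsLocalization.Away.lift_eq (S := Localization.Away P) P
    (g := ((IsScalarTower.toAlgHom K S (Localization.Away Q)).comp φ).toRingHom)
    (isUnit_of_dvd_unit (map_dvd (algebraMap S (Localization.Away Q)) h)
      (IsLocalization.Away.algebraMap_isUnit Q)) f

end AwayDerivations

/-! ### Restriction of `ω` and of the dressing action to `L*`. -/

namespace IsSplitting

open LieBialgebra FormalFun

variable {K : Type*} [Field K] [CharZero K] {𝔩 𝔤 : Type*} [LieRing 𝔩] [LieAlgebra K 𝔩]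
  [LieBialgebra K 𝔩] [LieRing 𝔤] [LieAlgebra K 𝔤] [LieBialgebra K 𝔤] {i : 𝔩 →ₗ⁅K⁆ 𝔤}
  {𝔲 : Submodule K 𝔤} (h : IsSplitting i 𝔲)

theorem dualIncl_incl (ξ : Module.Dual K 𝔩) (a : 𝔩) : h.dualIncl ξ (i a) = ξ a := by
  rw [dualIncl_apply, h.proj_incl]

theorem dualIncl_of_mem (ξ : Module.Dual K 𝔩) {u : 𝔤} (hu : u ∈ 𝔲) : h.dualIncl ξ u = 0 := by
  rw [dualIncl_apply, h.proj_of_mem hu, map_zero]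

theorem coact_incl (ξ : Module.Dual K 𝔩) (a : 𝔩) :
    coact (h.dualIncl ξ) (i a) = i (coact ξ a) := by
  rw [coact_apply, coact_apply, h.inclusion.map_δ]
  generalize δ (K := K) a = t
  induction t with
  | zero => simp
  | tmul x y => simp [h.dualIncl_incl]
  | add s t hs ht => simp only [map_add, hs, ht]

/-- The extension of `ξ` kills the components of `δ(u)` whose first leg lies in `𝔲`; those that
survive lie in `𝔩 ⊗ 𝔲`. -/
theorem coact_mem (ξ : Module.Dual K 𝔩) {u : 𝔤} (hu : u ∈ 𝔲) :
    coact (h.dualIncl ξ) u ∈ 𝔲 := by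
  have key : ∀ (p q : Submodule K 𝔤), p = 𝔲 ∨ q = 𝔲 →
      LinearMap.range (TensorProduct.mapIncl p q) ≤
        Submodule.comap (contract (h.dualIncl ξ)) 𝔲 := by
    rintro p q hpq _ ⟨t, rfl⟩
    rw [Submodule.mem_comap]
    induction t with
    | zero => simp
    | tmul a b =>
      rcases hpq with rfl | rfl
      · simp [TensorProduct.mapIncl, h.dualIncl_of_mem _ a.2]
      · simpa [TensorProduct.mapIncl] using Submodule.smul_mem _ _ b.2
    | add s t hs ht =>
      rw [map_add, map_add]
      exact Submodule.add_mem _ hs ht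
  exact (sup_le (sup_le (key _ _ (.inr rfl)) (key _ _ (.inl rfl))) (key _ _ (.inl rfl)))
    (h.δ_mem u hu)

section Basis

variable [FiniteDimensional K 𝔩] [FiniteDimensional K 𝔤]

/-- The decomposition `𝔩 × 𝔲 ≃ 𝔤`. -/
noncomputable def prodEquiv : (𝔩 × 𝔲) ≃ₗ[K] 𝔤 :=
  (LinearEquiv.prodCongr (LinearEquiv.ofInjective (i : 𝔩 →ₗ[K] 𝔤) h.inclusion.injective)
    (LinearEquiv.refl K 𝔲)).trans (Submodule.prodEquivOfIsCompl _ 𝔲 h.isCompl)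

theorem prodEquiv_apply (p : 𝔩 × 𝔲) : h.prodEquiv p = i p.1 + p.2 := rfl

/-- A basis of `𝔤` adapted to the splitting. -/
noncomputable def adaptedBasis :
    Module.Basis (Fin (Module.finrank K 𝔩) ⊕ Fin (Module.finrank K 𝔲)) K 𝔤 :=
  ((Module.finBasis K 𝔩).prod (Module.finBasis K 𝔲)).map h.prodEquiv

theorem adaptedBasis_inl (s : Fin (Module.finrank K 𝔩)) :
    h.adaptedBasis (Sum.inl s) = i (Module.finBasis K 𝔩 s) := by
  simp [adaptedBasis, prodEquiv_apply]

theorem adaptedBasis_inr (s : Fin (Module.finrank K 𝔲)) :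
    h.adaptedBasis (Sum.inr s) = Module.finBasis K 𝔲 s := by
  simp [adaptedBasis, prodEquiv_apply]

theorem coord_adaptedBasis_inl (s : Fin (Module.finrank K 𝔩)) :
    h.adaptedBasis.coord (Sum.inl s) = h.dualIncl ((Module.finBasis K 𝔩).coord s) := by
  apply h.adaptedBasis.ext
  rintro (t | t)
  · rw [Module.Basis.coord_apply, Module.Basis.repr_self, adaptedBasis_inl, dualIncl_incl]
    classical simp [Finsupp.single_apply]
  · rw [Module.Basis.coord_apply, Module.Basis.repr_self, adaptedBasis_inr,
      h.dualIncl_of_mem _ (Module.finBasis K 𝔲 t).2]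
    simp

/-- The linear form `u_k*` on `𝔤` that vanishes on `𝔩`. -/
noncomputable def uCoord (s : Fin (Module.finrank K 𝔲)) : Module.Dual K 𝔤 :=
  h.adaptedBasis.coord (Sum.inr s)

theorem uCoord_incl (s : Fin (Module.finrank K 𝔲)) (a : 𝔩) : h.uCoord s (i a) = 0 := by
  have e : h.prodEquiv.symm (i a) = (a, 0) := by
    rw [LinearEquiv.symm_apply_eq, prodEquiv_apply]
    simp
  simp [uCoord, adaptedBasis, e]

theorem uCoord_coe (s : Fin (Module.finrank K 𝔲)) (u : 𝔲) :
    h.uCoord s u = (Module.finBasis K 𝔲).coord s u := by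
  have e : h.prodEquiv.symm u = (0, u) := by
    rw [LinearEquiv.symm_apply_eq, prodEquiv_apply]
    simp
  simp [uCoord, adaptedBasis, e]

theorem sum_finBasis_coord {X : Type*} [AddCommGroup X] [Module K X]
    (B : 𝔤 →ₗ[K] Module.Dual K 𝔤 →ₗ[K] X) :
    ∑ s, B (Module.finBasis K 𝔤 s) ((Module.finBasis K 𝔤).coord s) =
      ∑ s, B (i (Module.finBasis K 𝔩 s)) (h.dualIncl ((Module.finBasis K 𝔩).coord s)) +
        ∑ s, B (Module.finBasis K 𝔲 s) (h.uCoord s) := by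
  rw [Module.Basis.sum_apply_coord (Module.finBasis K 𝔤) h.adaptedBasis, Fintype.sum_sum_type]
  simp only [adaptedBasis_inl, adaptedBasis_inr, coord_adaptedBasis_inl]
  rfl

end Basis

section Restriction

variable [FiniteDimensional K 𝔤]

theorem leftDer_res_om (ξ : Module.Dual K 𝔩) (u v : 𝔤) :
    leftDer ξ (h.res (om K 𝔤 u v)) = h.res (om K 𝔤 (-coact (h.dualIncl ξ) u) v) +
      h.res (om K 𝔤 u (-coact (h.dualIncl ξ) v)) +
        algebraMap K (FormalFun K 𝔩) (h.dualIncl ξ ⁅v, u⁆) := by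
  rw [leftDer_res, leftDer_om, map_add, map_sub, map_neg, AlgHom.commutes, coact_apply,
    coact_apply]
  simp only [map_neg, LinearMap.neg_apply]
  ring

/-- The family is stable under left translations by `𝔩*`: the coadjoint action preserves both `𝔩`
and `𝔲`, and the constant term `ξ([u, a])` vanishes because `[𝔩, 𝔲] ⊂ 𝔲`. -/
theorem res_om_incl_of_mem (a : 𝔩) {u : 𝔤} (hu : u ∈ 𝔲) : h.res (om K 𝔤 (i a) u) = 0 := by
  refine eq_zero_of_leftDer_eq_add (fun (a : 𝔩) (u : 𝔲) => h.res (om K 𝔤 (i a) u))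
    (fun ξ a => -coact ξ a) (fun ξ u => ⟨-coact (h.dualIncl ξ) u,
      𝔲.neg_mem (h.coact_mem ξ u.2)⟩) ?_ ?_ a ⟨u, hu⟩
  · intro a u
    rw [evalOne_res, evalOne_om]
  · intro ξ a u
    rw [leftDer_res_om, coact_incl, ← lie_skew, h.dualIncl_of_mem ξ
      (𝔲.neg_mem (h.lie_mem a u u.2)), map_zero, add_zero, map_neg i]

theorem res_om_incl [FiniteDimensional K 𝔩] (a b : 𝔩) :
    h.res (om K 𝔤 (i a) (i b)) = om K 𝔩 a b := by
  rw [← sub_eq_zero]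
  refine eq_zero_of_leftDer_eq_add
    (fun (a b : 𝔩) => h.res (om K 𝔤 (i a) (i b)) - om K 𝔩 a b)
    (fun ξ a => -coact ξ a) (fun ξ a => -coact ξ a) ?_ ?_ a b
  · intro a u
    rw [map_sub, evalOne_res, evalOne_om, evalOne_om, sub_zero]
  · intro ξ a b
    rw [map_sub, leftDer_res_om, coact_incl, coact_incl, leftDer_om, ← LieHom.map_lie,
      dualIncl_incl, coact_apply, coact_apply]
    simp only [map_neg, LinearMap.neg_apply]
    ring

/-- The bilinear expression whose trace is the restriction of the dressing action. -/
noncomputable def dressForm (a : 𝔤) (f : FormalFun K 𝔤) :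
    𝔤 →ₗ[K] Module.Dual K 𝔤 →ₗ[K] FormalFun K 𝔩 :=
  (LinearMap.mul K (FormalFun K 𝔩)).compl₁₂ (h.res.toLinearMap ∘ₗ omForm a)
    (h.res.toLinearMap ∘ₗ leftDerLin f)

variable [FiniteDimensional K 𝔩]

theorem res_dress (a : 𝔤) (f : FormalFun K 𝔤) :
    h.res (dress (Double.inl K 𝔤 a) f) =
      ∑ s, h.res (om K 𝔤 (i (Module.finBasis K 𝔩 s)) a) *
          leftDer ((Module.finBasis K 𝔩).coord s) (h.res f) +
        ∑ s, h.res (om K 𝔤 (Module.finBasis K 𝔲 s) a) * h.res (leftDer (h.uCoord s) f) := by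
  simp only [leftDer_res]
  refine Eq.trans ?_ (h.sum_finBasis_coord (h.dressForm a f))
  rw [dress_inl_eq_sum_leftDer, map_sum]
  exact Finset.sum_congr rfl fun s _ => map_mul _ _ _

/-- The transversal coefficients `ω(u_s, a)` vanish on `L*`, so the dressing field of `a ∈ 𝔩` is
tangent to `L*`. -/
theorem res_dress_incl (a : 𝔩) (f : FormalFun K 𝔤) :
    h.res (dress (Double.inl K 𝔤 (i a)) f) = dress (Double.inl K 𝔩 a) (h.res f) := by
  rw [res_dress, dress_inl_eq_sum_leftDer]
  have e : ∀ s, h.res (om K 𝔤 (Module.finBasis K 𝔲 s) (i a)) = 0 := by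
    intro s
    rw [om_skew, map_neg, h.res_om_incl_of_mem a (Module.finBasis K 𝔲 s).2, neg_zero]
  simp only [e, zero_mul, Finset.sum_const_zero, add_zero, res_om_incl, omForm_apply]

/-- On `L*` the dressing field of `u ∈ 𝔲` has no component along `𝔩*`. This is what converts
equivariance of `ρ` under `𝔲` into a statement on its transversal derivatives. -/
theorem res_dress_of_mem {u : 𝔤} (hu : u ∈ 𝔲) (f : FormalFun K 𝔤) :
    h.res (dress (Double.inl K 𝔤 u) f) =
      ∑ s, h.res (om K 𝔤 (Module.finBasis K 𝔲 s) u) * h.res (leftDer (h.uCoord s) f) := by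
  rw [res_dress]
  simp only [h.res_om_incl_of_mem _ hu, zero_mul, Finset.sum_const_zero, zero_add]

/-- The defect in `dress_om` pairs `ω(-, u)` with a leg of `δ(a) ∈ 𝔩 ⊗ 𝔩`, and on `L*` the form `ω`
vanishes on `𝔩 × 𝔲`. -/
theorem dress_res_om (a : 𝔩) {u v : 𝔤} (hu : u ∈ 𝔲) :
    dress (Double.inl K 𝔩 a) (h.res (om K 𝔤 u v)) =
      h.res (om K 𝔤 ⁅i a, u⁆ v) + h.res (om K 𝔤 u ⁅i a, v⁆) := by
  rw [← res_dress_incl, dress_om, map_sub, map_add, map_pairInto, sub_eq_self,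
    h.inclusion.map_δ]
  generalize δ (K := K) a = t
  induction t with
  | zero => simp
  | tmul x y => simp [omForm_apply, h.res_om_incl_of_mem _ hu]
  | add s t hs ht => simp only [map_add, hs, ht, add_zero]

section Localized

variable (P : FormalFun K 𝔤) (Q : FormalFun K 𝔩) (hQ : h.res P ∣ Q)

theorem awayHom_awayDer_leftDer (ξ : Module.Dual K 𝔩) (z : Localization.Away P) :
    awayHom h.res P Q hQ (awayDer (leftDer (h.dualIncl ξ)) P z) =
      awayDer (leftDer ξ) Q (awayHom h.res P Q hQ z) := by
  rw [← sub_eq_zero]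
  refine away_leibniz_eq_zero P (awayHom h.res P Q hQ : Localization.Away P →+* _)
    (fun z => awayHom h.res P Q hQ (awayDer (leftDer (h.dualIncl ξ)) P z) -
      awayDer (leftDer ξ) Q (awayHom h.res P Q hQ z)) ?_ ?_ z
  · intro x y
    simp only [awayDer_mul, map_mul, map_add, RingHom.coe_coe]
    ring
  · intro r
    simp only [awayDer_algebraMap, awayHom_algebraMap, leftDer_res, sub_self]

theorem awayHom_awayDer_dress_incl (a : 𝔩) (z : Localization.Away P) :
    awayHom h.res P Q hQ (awayDer (dress (Double.inl K 𝔤 (i a))) P z) =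
      awayDer (dress (Double.inl K 𝔩 a)) Q (awayHom h.res P Q hQ z) := by
  rw [← sub_eq_zero]
  refine away_leibniz_eq_zero P (awayHom h.res P Q hQ : Localization.Away P →+* _)
    (fun z => awayHom h.res P Q hQ (awayDer (dress (Double.inl K 𝔤 (i a))) P z) -
      awayDer (dress (Double.inl K 𝔩 a)) Q (awayHom h.res P Q hQ z)) ?_ ?_ z
  · intro x y
    simp only [awayDer_mul, map_mul, map_add, RingHom.coe_coe]
    ring
  · intro r
    simp only [awayDer_algebraMap, awayHom_algebraMap, res_dress_incl, sub_self]

theorem awayHom_awayDer_dress_of_mem {u : 𝔤} (hu : u ∈ 𝔲) (z : Localization.Away P) :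
    awayHom h.res P Q hQ (awayDer (dress (Double.inl K 𝔤 u)) P z) =
      ∑ s, algebraMap _ (Localization.Away Q) (h.res (om K 𝔤 (Module.finBasis K 𝔲 s) u)) *
        awayHom h.res P Q hQ (awayDer (leftDer (h.uCoord s)) P z) := by
  rw [← sub_eq_zero]
  refine away_leibniz_eq_zero P (awayHom h.res P Q hQ : Localization.Away P →+* _)
    (fun z => awayHom h.res P Q hQ (awayDer (dress (Double.inl K 𝔤 u)) P z) -
      ∑ s, algebraMap _ (Localization.Away Q) (h.res (om K 𝔤 (Module.finBasis K 𝔲 s) u)) *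
        awayHom h.res P Q hQ (awayDer (leftDer (h.uCoord s)) P z)) ?_ ?_ z
  · intro x y
    simp only [awayDer_mul, map_mul, map_add, RingHom.coe_coe, mul_add, Finset.sum_add_distrib,
      mul_sub, Finset.mul_sum, mul_left_comm]
    ring
  · intro r
    simp only [awayDer_algebraMap, awayHom_algebraMap, h.res_dress_of_mem hu, map_sum, map_mul,
      sub_self]

end Localized

end Restriction

end IsSplitting

/-! ### Testing tensors against linear forms. -/

section Contractions

open LieBialgebra

variable {K : Type*} [Field K] {V : Type*} [LieRing V] [LieAlgebra K V]
  {A : Type*} [CommRing A] [Algebra K A]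

/-- `x ⊗ f ↦ φ(x) f`. -/
noncomputable def evOne (φ : V →ₗ[K] A) : V ⊗[K] A →ₗ[K] A :=
  LinearMap.mul' K A ∘ₗ TensorProduct.map φ LinearMap.id

/-- `x ⊗ y ⊗ f ↦ φ(x) ψ(y) f`. -/
noncomputable def evTwo (φ ψ : V →ₗ[K] A) : (V ⊗[K] V) ⊗[K] A →ₗ[K] A :=
  LinearMap.mul' K A ∘ₗ TensorProduct.map (pairInto φ ψ) LinearMap.id

/-- `x ⊗ y ⊗ z ⊗ f ↦ φ(x) ψ(y) χ(z) f`. -/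
noncomputable def evThree (φ ψ χ : V →ₗ[K] A) : ((V ⊗[K] V) ⊗[K] V) ⊗[K] A →ₗ[K] A :=
  LinearMap.mul' K A ∘ₗ TensorProduct.map
    (LinearMap.mul' K A ∘ₗ TensorProduct.map (pairInto φ ψ) χ) LinearMap.id

/-- `x ⊗ y ⊗ f ↦ x ⊗ φ(y) f`. -/
noncomputable def scalarContractRight (φ : V →ₗ[K] A) : (V ⊗[K] V) ⊗[K] A →ₗ[K] V ⊗[K] A :=
  (LinearMap.mul' K A).lTensor V ∘ₗ (TensorProduct.assoc K V A A).toLinearMap ∘ₗ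
    (φ.lTensor V).rTensor A

/-- `x ⊗ y ⊗ f ↦ y ⊗ φ(x) f`. -/
noncomputable def scalarContractLeft (φ : V →ₗ[K] A) : (V ⊗[K] V) ⊗[K] A →ₗ[K] V ⊗[K] A :=
  scalarContractRight φ ∘ₗ (TensorProduct.comm K V V).toLinearMap.rTensor A

@[simp] theorem evOne_tmul (φ : V →ₗ[K] A) (x : V) (f : A) : evOne φ (x ⊗ₜ[K] f) = φ x * f := rfl

@[simp] theorem evTwo_tmul (φ ψ : V →ₗ[K] A) (x y : V) (f : A) :
    evTwo φ ψ ((x ⊗ₜ[K] y) ⊗ₜ[K] f) = φ x * ψ y * f := rfl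

@[simp] theorem evThree_tmul (φ ψ χ : V →ₗ[K] A) (x y z : V) (f : A) :
    evThree φ ψ χ (((x ⊗ₜ[K] y) ⊗ₜ[K] z) ⊗ₜ[K] f) = φ x * ψ y * χ z * f := rfl

@[simp] theorem scalarContractRight_tmul (φ : V →ₗ[K] A) (x y : V) (f : A) :
    scalarContractRight φ ((x ⊗ₜ[K] y) ⊗ₜ[K] f) = x ⊗ₜ[K] (φ y * f) := rfl

@[simp] theorem scalarContractLeft_tmul (φ : V →ₗ[K] A) (x y : V) (f : A) :
    scalarContractLeft φ ((x ⊗ₜ[K] y) ⊗ₜ[K] f) = y ⊗ₜ[K] (φ x * f) := rfl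

/-- Two linear maps on `V ⊗ V ⊗ A` that agree on pure tensors are equal. -/
theorem tensorTwo_ext {X : Type*} [AddCommGroup X] [Module K X]
    {F G : (V ⊗[K] V) ⊗[K] A →ₗ[K] X}
    (h : ∀ x y f, F ((x ⊗ₜ[K] y) ⊗ₜ[K] f) = G ((x ⊗ₜ[K] y) ⊗ₜ[K] f)) : F = G :=
  TensorProduct.ext_threefold h

/-- Two linear maps on `V ⊗ V ⊗ V ⊗ A` that agree on pure tensors are equal. -/
theorem tensorThree_ext {X : Type*} [AddCommGroup X] [Module K X]
    {F G : ((V ⊗[K] V) ⊗[K] V) ⊗[K] A →ₗ[K] X}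
    (h : ∀ x y z f, F (((x ⊗ₜ[K] y) ⊗ₜ[K] z) ⊗ₜ[K] f) = G (((x ⊗ₜ[K] y) ⊗ₜ[K] z) ⊗ₜ[K] f)) :
    F = G :=
  TensorProduct.ext_fourfold h

theorem evTwo_eq_scalarContractLeft (φ ψ : V →ₗ[K] A) (s : (V ⊗[K] V) ⊗[K] A) :
    evTwo φ ψ s = evOne ψ (scalarContractLeft φ s) := by
  refine LinearMap.congr_fun (tensorTwo_ext (F := evTwo φ ψ) (G := evOne ψ ∘ₗ scalarContractLeft φ)
    fun x y f => ?_) s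
  simp only [evTwo_tmul, LinearMap.comp_apply, scalarContractLeft_tmul, evOne_tmul]
  ring

theorem evTwo_eq_scalarContractRight (φ ψ : V →ₗ[K] A) (s : (V ⊗[K] V) ⊗[K] A) :
    evTwo φ ψ s = evOne φ (scalarContractRight ψ s) := by
  refine LinearMap.congr_fun (tensorTwo_ext (F := evTwo φ ψ) (G := evOne φ ∘ₗ scalarContractRight ψ)
    fun x y f => ?_) s
  simp only [evTwo_tmul, LinearMap.comp_apply, scalarContractRight_tmul, evOne_tmul]
  ring

theorem evTwo_comm (φ ψ : V →ₗ[K] A) (s : (V ⊗[K] V) ⊗[K] A) :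
    evTwo φ ψ ((TensorProduct.comm K V V).toLinearMap.rTensor A s) = evTwo ψ φ s := by
  refine LinearMap.congr_fun (tensorTwo_ext
    (F := evTwo φ ψ ∘ₗ (TensorProduct.comm K V V).toLinearMap.rTensor A) (G := evTwo ψ φ)
    fun x y f => ?_) s
  simp [mul_comm]

/-- The Leibniz rule for `φ(x) ψ(y) f`, solved for the term in `D f`. It gives the derivatives of
`σ` from those of `ω`, without differentiating an inverse matrix. -/
theorem evTwo_lTensor (D : Derivation K A A) (φ ψ : V →ₗ[K] A) (s : (V ⊗[K] V) ⊗[K] A) :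
    evTwo φ ψ ((D : A →ₗ[K] A).lTensor (V ⊗[K] V) s) =
      D (evTwo φ ψ s) - evTwo ((D : A →ₗ[K] A) ∘ₗ φ) ψ s - evTwo φ ((D : A →ₗ[K] A) ∘ₗ ψ) s := by
  refine LinearMap.congr_fun (tensorTwo_ext
    (F := evTwo φ ψ ∘ₗ (D : A →ₗ[K] A).lTensor (V ⊗[K] V))
    (G := (D : A →ₗ[K] A) ∘ₗ evTwo φ ψ - evTwo ((D : A →ₗ[K] A) ∘ₗ φ) ψ -
      evTwo φ ((D : A →ₗ[K] A) ∘ₗ ψ)) fun x y f => ?_) s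
  simp only [LinearMap.comp_apply, LinearMap.lTensor_tmul, evTwo_tmul, LinearMap.sub_apply,
    Derivation.coeFn_coe, Derivation.leibniz, smul_eq_mul]
  ring

theorem evTwo_rTensor_toEnd (a : V) (φ ψ : V →ₗ[K] A) (s : (V ⊗[K] V) ⊗[K] A) :
    evTwo φ ψ ((LieModule.toEnd K V (V ⊗[K] V) a).rTensor A s) =
      evTwo (φ ∘ₗ (LieModule.toEnd K V V a : V →ₗ[K] V)) ψ s +
        evTwo φ (ψ ∘ₗ (LieModule.toEnd K V V a : V →ₗ[K] V)) s := by
  refine LinearMap.congr_fun (tensorTwo_ext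
    (F := evTwo φ ψ ∘ₗ (LieModule.toEnd K V (V ⊗[K] V) a).rTensor A)
    (G := evTwo (φ ∘ₗ (LieModule.toEnd K V V a : V →ₗ[K] V)) ψ +
        evTwo φ (ψ ∘ₗ (LieModule.toEnd K V V a : V →ₗ[K] V))) fun x y f => ?_) s
  simp [TensorProduct.LieModule.lie_tmul_right, TensorProduct.add_tmul]

theorem evThree_cyc (φ ψ χ : V →ₗ[K] A) (t : ((V ⊗[K] V) ⊗[K] V) ⊗[K] A) :
    evThree φ ψ χ ((cyc K V).rTensor A t) = evThree χ φ ψ t := by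
  refine LinearMap.congr_fun (tensorThree_ext
    (F := evThree φ ψ χ ∘ₗ (cyc K V).rTensor A) (G := evThree χ φ ψ) fun x y z f => ?_) t
  simp only [LinearMap.comp_apply, LinearMap.rTensor_tmul, cyc, LinearEquiv.coe_coe,
    TensorProduct.assoc_tmul, TensorProduct.comm_tmul, evThree_tmul]
  ring

theorem evThree_Alt (φ ψ χ : V →ₗ[K] A) (t : ((V ⊗[K] V) ⊗[K] V) ⊗[K] A) :
    evThree φ ψ χ ((Alt K V).rTensor A t) =
      evThree φ ψ χ t + evThree χ φ ψ t + evThree ψ χ φ t := by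
  rw [Alt, LinearMap.rTensor_add, LinearMap.rTensor_add, LinearMap.rTensor_comp,
    LinearMap.add_apply, LinearMap.add_apply, map_add, map_add, LinearMap.rTensor_id,
    LinearMap.id_apply, LinearMap.comp_apply, evThree_cyc, evThree_cyc, evThree_cyc]

theorem evThree_insertThird (e : V) (D : A →ₗ[K] A) (φ ψ χ : V →ₗ[K] A)
    (s : (V ⊗[K] V) ⊗[K] A) :
    evThree φ ψ χ (insertThird e D s) = χ e * evTwo φ ψ (D.lTensor (V ⊗[K] V) s) := by
  refine LinearMap.congr_fun (tensorTwo_ext (F := evThree φ ψ χ ∘ₗ insertThird e D)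
    (G := LinearMap.mulLeft K (χ e) ∘ₗ evTwo φ ψ ∘ₗ D.lTensor (V ⊗[K] V)) fun x y f => ?_) s
  change φ x * ψ y * χ e * D f = χ e * (φ x * ψ y * D f)
  ring

theorem evThree_rTensor_δ [LieBialgebra K V] (φ ψ χ : V →ₗ[K] A) (s : (V ⊗[K] V) ⊗[K] A) :
    evThree φ ψ χ (((δ (K := K) (𝔤 := V)).rTensor V).rTensor A s) =
      evOne (pairInto φ ψ ∘ₗ δ (K := K)) (scalarContractRight χ s) := by
  refine LinearMap.congr_fun (tensorTwo_ext
    (F := evThree φ ψ χ ∘ₗ ((δ (K := K) (𝔤 := V)).rTensor V).rTensor A)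
    (G := evOne (pairInto φ ψ ∘ₗ δ (K := K)) ∘ₗ scalarContractRight χ) fun x y f => ?_) s
  change pairInto φ ψ (δ (K := K) x) * χ y * f = pairInto φ ψ (δ (K := K) x) * (χ y * f)
  ring

/-- The bracket of `V ⊗ A`. -/
noncomputable def lieScalars : V ⊗[K] A →ₗ[K] V ⊗[K] A →ₗ[K] V ⊗[K] A :=
  TensorProduct.map₂ (LieModule.toEnd K V V : V →ₗ[K] V →ₗ[K] V) (LinearMap.mul K A)

@[simp] theorem lieScalars_tmul (x y : V) (f g : A) :
    lieScalars (K := K) (x ⊗ₜ[K] f) (y ⊗ₜ[K] g) = ⁅x, y⁆ ⊗ₜ[K] (f * g) := rfl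

/-- Two bilinear maps on `V ⊗ V ⊗ A` that agree on pure tensors are equal. -/
theorem tensorTwo_ext₂ {X : Type*} [AddCommGroup X] [Module K X] {B : Type*} [CommRing B]
    [Algebra K B]
    {F G : (V ⊗[K] V) ⊗[K] A →ₗ[K] (V ⊗[K] V) ⊗[K] B →ₗ[K] X}
    (h : ∀ x y f x' y' g, F ((x ⊗ₜ[K] y) ⊗ₜ[K] f) ((x' ⊗ₜ[K] y') ⊗ₜ[K] g) =
      G ((x ⊗ₜ[K] y) ⊗ₜ[K] f) ((x' ⊗ₜ[K] y') ⊗ₜ[K] g)) : F = G :=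
  tensorTwo_ext fun x y f => tensorTwo_ext fun x' y' g => h x y f x' y' g

theorem evThree_lie₁₂₁₃ (φ ψ χ : V →ₗ[K] A) (s t : (V ⊗[K] V) ⊗[K] A) :
    evThree φ ψ χ (TensorProduct.map₂ (lie₁₂₁₃ K V) (LinearMap.mul K A) s t) =
      evOne φ (lieScalars (scalarContractRight ψ s) (scalarContractRight χ t)) := by
  refine LinearMap.congr_fun₂ (tensorTwo_ext₂
    (F := (TensorProduct.map₂ (lie₁₂₁₃ K V) (LinearMap.mul K A)).compr₂ (evThree φ ψ χ))
    (G := (lieScalars.compl₁₂ (scalarContractRight ψ) (scalarContractRight χ)).compr₂ (evOne φ))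
    fun x y f x' y' g => ?_) s t
  change φ ⁅x, x'⁆ * ψ y * χ y' * (f * g) = φ ⁅x, x'⁆ * (ψ y * f * (χ y' * g))
  ring

theorem evThree_lie₁₂₂₃ (φ ψ χ : V →ₗ[K] A) (s t : (V ⊗[K] V) ⊗[K] A) :
    evThree φ ψ χ (TensorProduct.map₂ (lie₁₂₂₃ K V) (LinearMap.mul K A) s t) =
      evOne ψ (lieScalars (scalarContractLeft φ s) (scalarContractRight χ t)) := by
  refine LinearMap.congr_fun₂ (tensorTwo_ext₂
    (F := (TensorProduct.map₂ (lie₁₂₂₃ K V) (LinearMap.mul K A)).compr₂ (evThree φ ψ χ))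
    (G := (lieScalars.compl₁₂ (scalarContractLeft φ) (scalarContractRight χ)).compr₂ (evOne ψ))
    fun x y f x' y' g => ?_) s t
  change φ x * ψ ⁅y, x'⁆ * χ y' * (f * g) = ψ ⁅y, x'⁆ * (φ x * f * (χ y' * g))
  ring

theorem evThree_lie₁₃₂₃ (φ ψ χ : V →ₗ[K] A) (s t : (V ⊗[K] V) ⊗[K] A) :
    evThree φ ψ χ (TensorProduct.map₂ (lie₁₃₂₃ K V) (LinearMap.mul K A) s t) =
      evOne χ (lieScalars (scalarContractLeft φ s) (scalarContractLeft ψ t)) := by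
  refine LinearMap.congr_fun₂ (tensorTwo_ext₂
    (F := (TensorProduct.map₂ (lie₁₃₂₃ K V) (LinearMap.mul K A)).compr₂ (evThree φ ψ χ))
    (G := (lieScalars.compl₁₂ (scalarContractLeft φ) (scalarContractLeft ψ)).compr₂ (evOne χ))
    fun x y f x' y' g => ?_) s t
  change φ x * ψ x' * χ ⁅y, y'⁆ * (f * g) = χ ⁅y, y'⁆ * (φ x * f * (ψ x' * g))
  ring

theorem map₂_lie_add (s t : (V ⊗[K] V) ⊗[K] A) :
    TensorProduct.map₂ (lie₁₂₁₃ K V + lie₁₂₂₃ K V + lie₁₃₂₃ K V) (LinearMap.mul K A) s t =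
      TensorProduct.map₂ (lie₁₂₁₃ K V) (LinearMap.mul K A) s t +
        TensorProduct.map₂ (lie₁₂₂₃ K V) (LinearMap.mul K A) s t +
          TensorProduct.map₂ (lie₁₃₂₃ K V) (LinearMap.mul K A) s t := by
  refine LinearMap.congr_fun₂ (tensorTwo_ext₂
    (F := TensorProduct.map₂ (lie₁₂₁₃ K V + lie₁₂₂₃ K V + lie₁₃₂₃ K V) (LinearMap.mul K A))
    (G := TensorProduct.map₂ (lie₁₂₁₃ K V) (LinearMap.mul K A) +
        TensorProduct.map₂ (lie₁₂₂₃ K V) (LinearMap.mul K A) +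
          TensorProduct.map₂ (lie₁₃₂₃ K V) (LinearMap.mul K A))
    fun x y f x' y' g => ?_) s t
  simp only [TensorProduct.map₂_apply_tmul, LinearMap.add_apply, TensorProduct.map_tmul,
    TensorProduct.add_tmul]

theorem evThree_CYB (φ ψ χ : V →ₗ[K] A) (s : (V ⊗[K] V) ⊗[K] A) :
    evThree φ ψ χ (CYB s) =
      evOne φ (lieScalars (scalarContractRight ψ s) (scalarContractRight χ s)) +
        evOne ψ (lieScalars (scalarContractLeft φ s) (scalarContractRight χ s)) +
          evOne χ (lieScalars (scalarContractLeft φ s) (scalarContractLeft ψ s)) := by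
  rw [CYB, map₂_lie_add, map_add, map_add, evThree_lie₁₂₁₃, evThree_lie₁₂₂₃, evThree_lie₁₃₂₃]

theorem evTwo_add_left (φ φ' ψ : V →ₗ[K] A) (s : (V ⊗[K] V) ⊗[K] A) :
    evTwo (φ + φ') ψ s = evTwo φ ψ s + evTwo φ' ψ s := by
  refine LinearMap.congr_fun (tensorTwo_ext (F := evTwo (φ + φ') ψ)
    (G := evTwo φ ψ + evTwo φ' ψ) fun x y f => ?_) s
  simp [add_mul]

theorem evTwo_smul_left (a : A) (φ ψ : V →ₗ[K] A) (s : (V ⊗[K] V) ⊗[K] A) :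
    evTwo (a • φ) ψ s = a * evTwo φ ψ s := by
  refine LinearMap.congr_fun (tensorTwo_ext (F := evTwo (a • φ) ψ)
    (G := LinearMap.mulLeft K a ∘ₗ evTwo φ ψ) fun x y f => ?_) s
  simp [mul_assoc]

theorem evThree_add_left (φ φ' ψ χ : V →ₗ[K] A) (t : ((V ⊗[K] V) ⊗[K] V) ⊗[K] A) :
    evThree (φ + φ') ψ χ t = evThree φ ψ χ t + evThree φ' ψ χ t := by
  refine LinearMap.congr_fun (tensorThree_ext (F := evThree (φ + φ') ψ χ)
    (G := evThree φ ψ χ + evThree φ' ψ χ) fun x y z f => ?_) t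
  simp [add_mul]

theorem evThree_smul_left (a : A) (φ ψ χ : V →ₗ[K] A) (t : ((V ⊗[K] V) ⊗[K] V) ⊗[K] A) :
    evThree (a • φ) ψ χ t = a * evThree φ ψ χ t := by
  refine LinearMap.congr_fun (tensorThree_ext (F := evThree (a • φ) ψ χ)
    (G := LinearMap.mulLeft K a ∘ₗ evThree φ ψ χ) fun x y z f => ?_) t
  simp [mul_assoc]

/-- In a product basis of `V ⊗ V ⊗ A`, every coordinate factors through the contraction with two
constant coordinate forms. -/
theorem eq_zero_of_evTwo_coord {ι : Type*} (b : Module.Basis ι K V) (s : (V ⊗[K] V) ⊗[K] A)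
    (h : ∀ p q, evTwo (Algebra.linearMap K A ∘ₗ b.coord p) (Algebra.linearMap K A ∘ₗ b.coord q) s
      = 0) : s = 0 := by
  let c := Module.Basis.ofVectorSpace K A
  apply ((b.tensorProduct b).tensorProduct c).ext_elem
  rintro ⟨⟨p, q⟩, l⟩
  rw [map_zero, Finsupp.zero_apply]
  have e : ((b.tensorProduct b).tensorProduct c).coord ((p, q), l) = c.coord l ∘ₗ
      evTwo (Algebra.linearMap K A ∘ₗ b.coord p) (Algebra.linearMap K A ∘ₗ b.coord q) := by
    apply tensorTwo_ext
    intro x y f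
    simp only [Module.Basis.coord_apply, Module.Basis.tensorProduct_repr_tmul_apply,
      LinearMap.comp_apply, evTwo_tmul, Algebra.linearMap_apply, ← map_mul, ← Algebra.smul_def,
      map_smul, smul_eq_mul]
    ring
  rw [← Module.Basis.coord_apply, e, LinearMap.comp_apply, h, map_zero]

theorem eq_zero_of_evThree_coord {ι : Type*} (b : Module.Basis ι K V)
    (t : ((V ⊗[K] V) ⊗[K] V) ⊗[K] A)
    (h : ∀ p q r, evThree (Algebra.linearMap K A ∘ₗ b.coord p) (Algebra.linearMap K A ∘ₗ b.coord q)
      (Algebra.linearMap K A ∘ₗ b.coord r) t = 0) : t = 0 := by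
  let c := Module.Basis.ofVectorSpace K A
  apply (((b.tensorProduct b).tensorProduct b).tensorProduct c).ext_elem
  rintro ⟨⟨⟨p, q⟩, r⟩, l⟩
  rw [map_zero, Finsupp.zero_apply]
  have e : (((b.tensorProduct b).tensorProduct b).tensorProduct c).coord (((p, q), r), l) =
      c.coord l ∘ₗ evThree (Algebra.linearMap K A ∘ₗ b.coord p)
        (Algebra.linearMap K A ∘ₗ b.coord q) (Algebra.linearMap K A ∘ₗ b.coord r) := by
    apply tensorThree_ext
    intro x y z f
    simp only [Module.Basis.coord_apply, Module.Basis.tensorProduct_repr_tmul_apply,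
      LinearMap.comp_apply, evThree_tmul, Algebra.linearMap_apply, ← map_mul, ← Algebra.smul_def,
      map_smul, smul_eq_mul]
    ring
  rw [← Module.Basis.coord_apply, e, LinearMap.comp_apply, h, map_zero]

variable {ι : Type*} (b : Module.Basis ι K V) (Φ : Set (V →ₗ[K] A))

/-- A tensor is zero if it is killed by a set of forms that generates the constant ones. -/
theorem eq_zero_of_evTwo (hΦ : ∀ p, Algebra.linearMap K A ∘ₗ b.coord p ∈ Submodule.span A Φ)
    (s : (V ⊗[K] V) ⊗[K] A) (h : ∀ φ ∈ Φ, ∀ ψ ∈ Φ, evTwo φ ψ s = 0) : s = 0 := by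
  have step : ∀ (s : (V ⊗[K] V) ⊗[K] A) (ψ : V →ₗ[K] A), (∀ φ ∈ Φ, evTwo φ ψ s = 0) →
      ∀ φ ∈ Submodule.span A Φ, evTwo φ ψ s = 0 := by
    intro s ψ h φ hφ
    induction hφ using Submodule.span_induction with
    | mem φ hφ => exact h φ hφ
    | zero => simpa using evTwo_smul_left (0 : A) 0 ψ s
    | add φ φ' _ _ hφ hφ' => rw [evTwo_add_left, hφ, hφ', add_zero]
    | smul a φ _ hφ => rw [evTwo_smul_left, hφ, mul_zero]
  refine eq_zero_of_evTwo_coord b s fun p q => ?_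
  refine step s _ (fun φ hφ => ?_) _ (hΦ p)
  rw [← evTwo_comm]
  exact step _ φ (fun ψ hψ => by rw [evTwo_comm]; exact h φ hφ ψ hψ) _ (hΦ q)

theorem evThree_eq_zero_of_mem_span (t : ((V ⊗[K] V) ⊗[K] V) ⊗[K] A) (ψ χ : V →ₗ[K] A)
    (h : ∀ φ ∈ Φ, evThree φ ψ χ t = 0) (φ : V →ₗ[K] A) (hφ : φ ∈ Submodule.span A Φ) :
    evThree φ ψ χ t = 0 := by
  induction hφ using Submodule.span_induction with
  | mem φ hφ => exact h φ hφ
  | zero => simpa using evThree_smul_left (0 : A) 0 ψ χ t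
  | add φ φ' _ _ hφ hφ' => rw [evThree_add_left, hφ, hφ', add_zero]
  | smul a φ _ hφ => rw [evThree_smul_left, hφ, mul_zero]

/-- A tensor is zero if it is killed by a set of forms that generates the constant ones. -/
theorem eq_zero_of_evThree (hΦ : ∀ p, Algebra.linearMap K A ∘ₗ b.coord p ∈ Submodule.span A Φ)
    (t : ((V ⊗[K] V) ⊗[K] V) ⊗[K] A)
    (h : ∀ φ ∈ Φ, ∀ ψ ∈ Φ, ∀ χ ∈ Φ, evThree φ ψ χ t = 0) : t = 0 := by
  -- The passage from `Φ` to its span is available in the first slot; cyclic permutations bring the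
  -- other slots there.
  have h3 : ∀ φ ∈ Φ, ∀ ψ ∈ Φ, ∀ χ ∈ Submodule.span A Φ, evThree φ ψ χ t = 0 := by
    intro φ hφ ψ hψ χ hχ
    have e : ∀ χ, evThree χ φ ψ ((cyc K V).rTensor A ((cyc K V).rTensor A t)) =
        evThree φ ψ χ t := fun χ => (evThree_cyc _ _ _ _).trans (evThree_cyc _ _ _ _)
    exact (e χ).symm.trans (evThree_eq_zero_of_mem_span Φ _ φ ψ
      (fun χ hχ => (e χ).trans (h φ hφ ψ hψ χ hχ)) χ hχ)
  have h2 : ∀ φ ∈ Φ, ∀ ψ ∈ Submodule.span A Φ, ∀ χ ∈ Submodule.span A Φ,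
      evThree φ ψ χ t = 0 := by
    intro φ hφ ψ hψ χ hχ
    have e : ∀ ψ, evThree ψ χ φ ((cyc K V).rTensor A t) = evThree φ ψ χ t :=
      fun ψ => evThree_cyc _ _ _ _
    exact (e ψ).symm.trans (evThree_eq_zero_of_mem_span Φ _ χ φ
      (fun ψ hψ => (e ψ).trans (h3 φ hφ ψ hψ χ hχ)) ψ hψ)
  exact eq_zero_of_evThree_coord b t fun p q r => evThree_eq_zero_of_mem_span Φ t _ _
    (fun φ hφ => h2 φ hφ _ (hΦ q) _ (hΦ r)) _ (hΦ p)

end Contractions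

/-! ### The tensor `σ` satisfies the dynamical equations for `(L*, 𝔤, 0)`. -/

namespace IsSplitting

open LieBialgebra FormalFun

variable {K : Type*} [Field K] [CharZero K] {𝔩 𝔤 : Type*} [LieRing 𝔩] [LieAlgebra K 𝔩]
  [LieBialgebra K 𝔩] [LieRing 𝔤] [LieAlgebra K 𝔤] [LieBialgebra K 𝔤] {i : 𝔩 →ₗ⁅K⁆ 𝔤}
  {𝔲 : Submodule K 𝔤} (h : IsSplitting i 𝔲) [FiniteDimensional K 𝔤] (Q : FormalFun K 𝔩)

/-- The restriction `K[[G*]] → K[[L*]][1/Q]`. -/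
noncomputable def resAway : FormalFun K 𝔤 →ₐ[K] Localization.Away Q :=
  (IsScalarTower.toAlgHom K (FormalFun K 𝔩) (Localization.Away Q)).comp h.res

/-- The form `ω_x(-, v)`, `x ∈ L*`, with values in `K[[L*]][1/Q]`. -/
noncomputable def resForm (v : 𝔤) : 𝔤 →ₗ[K] Localization.Away Q :=
  (h.resAway Q).toLinearMap ∘ₗ omForm v

theorem resForm_apply (v y : 𝔤) :
    h.resForm Q v y = algebraMap _ (Localization.Away Q) (h.res (om K 𝔤 y v)) := rfl

theorem resForm_skew (u v : 𝔤) : h.resForm Q u v = -h.resForm Q v u := by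
  rw [resForm_apply, resForm_apply, om_skew, map_neg, map_neg]

theorem resForm_incl {u : 𝔤} (hu : u ∈ 𝔲) (a : 𝔩) : h.resForm Q u (i a) = 0 := by
  rw [resForm_apply, h.res_om_incl_of_mem a hu, map_zero]

theorem cyclic_resForm_lie (u v w : 𝔤) :
    h.resForm Q w ⁅u, v⁆ + h.resForm Q u ⁅v, w⁆ + h.resForm Q v ⁅w, u⁆ =
      pairInto (h.resForm Q u) (h.resForm Q v) (δ (K := K) w) +
        pairInto (h.resForm Q v) (h.resForm Q w) (δ (K := K) u) +
          pairInto (h.resForm Q w) (h.resForm Q u) (δ (K := K) v) := by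
  have e := congrArg (h.resAway Q) (cyclic_om_lie u v w)
  simp only [map_add, map_pairInto] at e
  exact e

theorem awayDer_leftDer_resForm (ξ : Module.Dual K 𝔩) (u v : 𝔤) :
    awayDer (leftDer ξ) Q (h.resForm Q v u) =
      -h.resForm Q v (coact (h.dualIncl ξ) u) + h.resForm Q u (coact (h.dualIncl ξ) v) +
        algebraMap K (Localization.Away Q) (h.dualIncl ξ ⁅v, u⁆) := by
  rw [h.resForm_skew Q u, resForm_apply, awayDer_algebraMap, leftDer_res_om, map_add, map_add,
    ← IsScalarTower.algebraMap_apply]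
  simp only [map_neg, LinearMap.neg_apply, resForm_apply]

variable (hd : h.detP ∣ Q)

/-- The homomorphism `K[[L*]][1/P_𝔩^𝔤] → K[[L*]][1/Q]`. -/
noncomputable def detHom : Localization.Away h.detP →ₐ[K] Localization.Away Q :=
  awayHom (AlgHom.id K _) h.detP Q hd

/-- The coefficients of `σ_𝔩^𝔤` in `K[[L*]][1/Q]`. -/
noncomputable def sigmaCoeff :
    Matrix (Fin (Module.finrank K 𝔲)) (Fin (Module.finrank K 𝔲)) (Localization.Away Q) :=
  h.sigmaMatrix.map (h.detHom Q hd)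

theorem sigmaCoeff_mul : h.sigmaCoeff Q hd * (h.omegaMatrix.map
    (algebraMap (FormalFun K 𝔩) (Localization.Away Q))).transpose = 1 := by
  have hu : IsUnit ((h.omegaMatrix.map
      (algebraMap (FormalFun K 𝔩) (Localization.Away h.detP))).transpose).det := by
    rw [Matrix.det_transpose]
    have e : (h.omegaMatrix.map (algebraMap (FormalFun K 𝔩) (Localization.Away h.detP))).det =
        algebraMap (FormalFun K 𝔩) (Localization.Away h.detP) h.detP :=
      (RingHom.map_det _ _).symm
    rw [e]
    exact IsLocalization.Away.algebraMap_isUnit h.detP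
  have h1 := Matrix.nonsing_inv_mul _ hu
  have h2 := congrArg (fun M => M.map (h.detHom Q hd)) h1
  simp only [Matrix.map_mul, Matrix.transpose_map, Matrix.map_map] at h2
  rw [Matrix.map_one _ (map_zero _) (map_one _)] at h2
  rw [← h2]
  congr 2
  ext s t
  simp only [Matrix.map_apply, Function.comp_apply]
  exact (awayHom_algebraMap (AlgHom.id K _) h.detP Q hd _).symm

theorem sum_sigmaCoeff_right (s m : Fin (Module.finrank K 𝔲)) :
    ∑ t, h.resForm Q (Module.finBasis K 𝔲 t : 𝔤) (Module.finBasis K 𝔲 m : 𝔤) *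
      h.sigmaCoeff Q hd s t = if s = m then 1 else 0 := by
  have e := congrFun (congrFun (h.sigmaCoeff_mul Q hd) s) m
  rw [Matrix.mul_apply, Matrix.one_apply] at e
  rw [← e]
  exact Finset.sum_congr rfl fun t _ => mul_comm _ _

theorem sum_sigmaCoeff_left (m t : Fin (Module.finrank K 𝔲)) :
    ∑ s, h.resForm Q (Module.finBasis K 𝔲 m : 𝔤) (Module.finBasis K 𝔲 s : 𝔤) *
      h.sigmaCoeff Q hd s t = if m = t then 1 else 0 := by
  have e' := mul_eq_one_comm.mp (h.sigmaCoeff_mul Q hd)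
  have e := congrFun (congrFun e' m) t
  rw [Matrix.mul_apply, Matrix.one_apply] at e
  rw [← e]
  rfl

/-- The element `σ_𝔩^𝔤` with coefficients in `K[[L*]][1/Q]`. -/
noncomputable def sigmaAway : (𝔤 ⊗[K] 𝔤) ⊗[K] Localization.Away Q :=
  ∑ s, ∑ t, ((Module.finBasis K 𝔲 s : 𝔤) ⊗ₜ[K] (Module.finBasis K 𝔲 t : 𝔤)) ⊗ₜ[K]
    h.sigmaCoeff Q hd s t

/-- `φ` and `v ∈ 𝔤` correspond to each other under `σ_𝔩^𝔤`. -/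
def IsSharp (φ : 𝔤 →ₗ[K] Localization.Away Q) (v : 𝔤) : Prop :=
  scalarContractLeft φ (h.sigmaAway Q hd) = v ⊗ₜ[K] 1 ∧
    scalarContractRight φ (h.sigmaAway Q hd) = -(v ⊗ₜ[K] 1)

/-- `σ` is inverse to `ω` on `𝔲`, so the contraction is a vector with constant coefficients.
Skewness of `ω` gives the opposite sign on the other leg. -/
theorem isSharp_resForm (m : Fin (Module.finrank K 𝔲)) :
    h.IsSharp Q hd (h.resForm Q (Module.finBasis K 𝔲 m : 𝔤)) (Module.finBasis K 𝔲 m : 𝔤) := by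
  constructor
  · simp only [sigmaAway, map_sum, scalarContractLeft_tmul]
    rw [Finset.sum_comm]
    simp only [← TensorProduct.tmul_sum, sum_sigmaCoeff_left]
    simp [TensorProduct.tmul_ite]
  · simp only [sigmaAway, map_sum, scalarContractRight_tmul, h.resForm_skew Q
      (Module.finBasis K 𝔲 m : 𝔤), neg_mul, TensorProduct.tmul_neg, Finset.sum_neg_distrib]
    simp only [← TensorProduct.tmul_sum, sum_sigmaCoeff_right]
    simp [TensorProduct.tmul_ite]

theorem isSharp_zero {φ : 𝔤 →ₗ[K] Localization.Away Q} (hφ : ∀ u ∈ 𝔲, φ u = 0) :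
    h.IsSharp Q hd φ 0 := by
  constructor
  · simp only [sigmaAway, map_sum, scalarContractLeft_tmul]
    simp [hφ]
  · simp only [sigmaAway, map_sum, scalarContractRight_tmul]
    simp [hφ]

/-- The linear form on `𝔤` given by `ξ ∈ 𝔩*`, as a constant function. -/
noncomputable def constForm (ξ : Module.Dual K 𝔩) : 𝔤 →ₗ[K] Localization.Away Q :=
  Algebra.linearMap K _ ∘ₗ h.dualIncl ξ

theorem constForm_apply (ξ : Module.Dual K 𝔩) (y : 𝔤) :
    h.constForm Q ξ y = algebraMap K _ (h.dualIncl ξ y) := rfl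

theorem constForm_of_mem (ξ : Module.Dual K 𝔩) {u : 𝔤} (hu : u ∈ 𝔲) :
    h.constForm Q ξ u = 0 := by
  rw [constForm_apply, h.dualIncl_of_mem ξ hu, map_zero]

theorem isSharp_constForm (ξ : Module.Dual K 𝔩) : h.IsSharp Q hd (h.constForm Q ξ) 0 :=
  h.isSharp_zero Q hd fun _ hu => h.constForm_of_mem Q ξ hu

/-- The forms on `𝔤` against which tensors are tested. -/
def testForms : Set (𝔤 →ₗ[K] Localization.Away Q) :=
  Set.range (fun m => h.resForm Q (Module.finBasis K 𝔲 m : 𝔤)) ∪ Set.range (h.constForm Q)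

variable [FiniteDimensional K 𝔩]

/-- Both sides vanish on `𝔩` and agree on `𝔲`, by the inversion of `ω`. With the constant forms from
`𝔩*`, the forms `ω(-, u_t)` therefore generate all coordinate forms of `𝔤`. -/
theorem sum_sigmaCoeff_resForm (s : Fin (Module.finrank K 𝔲)) :
    Algebra.linearMap K (Localization.Away Q) ∘ₗ h.uCoord s =
      ∑ t, h.sigmaCoeff Q hd s t • h.resForm Q (Module.finBasis K 𝔲 t : 𝔤) := by
  apply h.adaptedBasis.ext
  rintro (m | m)
  · rw [adaptedBasis_inl, LinearMap.comp_apply, uCoord_incl, map_zero, LinearMap.sum_apply]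
    symm
    refine Finset.sum_eq_zero fun t _ => ?_
    rw [LinearMap.smul_apply, h.resForm_incl Q (Module.finBasis K 𝔲 t).2, smul_zero]
  · rw [adaptedBasis_inr, LinearMap.comp_apply, uCoord_coe, LinearMap.sum_apply]
    have e := h.sum_sigmaCoeff_right Q hd s m
    simp only [LinearMap.smul_apply, smul_eq_mul]
    simp only [mul_comm] at e
    rw [e, Module.Basis.coord_apply, Module.Basis.repr_self, Finsupp.single_apply]
    simp only [eq_comm (a := m)]
    split_ifs <;> simp

theorem coord_mem_span_testForms
    (p : Fin (Module.finrank K 𝔩) ⊕ Fin (Module.finrank K 𝔲)) (hd : h.detP ∣ Q) :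
    Algebra.linearMap K (Localization.Away Q) ∘ₗ h.adaptedBasis.coord p ∈
      Submodule.span (Localization.Away Q) (h.testForms Q) := by
  rcases p with s | s
  · rw [coord_adaptedBasis_inl]
    exact Submodule.subset_span (Or.inr ⟨_, rfl⟩)
  · change Algebra.linearMap K (Localization.Away Q) ∘ₗ h.uCoord s ∈ _
    rw [h.sum_sigmaCoeff_resForm Q hd]
    exact Submodule.sum_mem _ fun t _ =>
      Submodule.smul_mem _ _ (Submodule.subset_span (Or.inl ⟨t, rfl⟩))

variable {h Q hd}

theorem IsSharp.evTwo_left {φ : 𝔤 →ₗ[K] Localization.Away Q} {v : 𝔤} (hφ : h.IsSharp Q hd φ v)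
    (ψ : 𝔤 →ₗ[K] Localization.Away Q) : evTwo φ ψ (h.sigmaAway Q hd) = ψ v := by
  rw [evTwo_eq_scalarContractLeft, hφ.1, evOne_tmul, mul_one]

theorem IsSharp.evTwo_right {φ : 𝔤 →ₗ[K] Localization.Away Q} {v : 𝔤} (hφ : h.IsSharp Q hd φ v)
    (ψ : 𝔤 →ₗ[K] Localization.Away Q) : evTwo ψ φ (h.sigmaAway Q hd) = -ψ v := by
  rw [evTwo_eq_scalarContractRight, hφ.2, map_neg, evOne_tmul, mul_one]

/-- The contractions of `σ` are constant vectors, so brackets over the localized ring reduce to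
brackets in `𝔤`. -/
theorem IsSharp.evThree_CYB {φ ψ χ : 𝔤 →ₗ[K] Localization.Away Q} {u v w : 𝔤}
    (hφ : h.IsSharp Q hd φ u) (hψ : h.IsSharp Q hd ψ v) (hχ : h.IsSharp Q hd χ w) :
    evThree φ ψ χ (CYB (h.sigmaAway Q hd)) = φ ⁅v, w⁆ + ψ ⁅w, u⁆ + χ ⁅u, v⁆ := by
  rw [_root_.evThree_CYB, hφ.1, hψ.1, hψ.2, hχ.2]
  simp only [map_neg, LinearMap.neg_apply, lieScalars_tmul, evOne_tmul, mul_one, neg_neg]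
  rw [← lie_skew w u, map_neg]

theorem IsSharp.evThree_rTensor_δ (φ ψ : 𝔤 →ₗ[K] Localization.Away Q)
    {χ : 𝔤 →ₗ[K] Localization.Away Q} {w : 𝔤} (hχ : h.IsSharp Q hd χ w) :
    evThree φ ψ χ (((δ (K := K) (𝔤 := 𝔤)).rTensor 𝔤).rTensor _ (h.sigmaAway Q hd)) =
      -pairInto φ ψ (δ (K := K) w) := by
  rw [_root_.evThree_rTensor_δ, hχ.2, map_neg, evOne_tmul, mul_one]
  rfl

variable (h Q hd)

theorem exists_isSharp {φ : 𝔤 →ₗ[K] Localization.Away Q} (hφ : φ ∈ h.testForms Q) :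
    ∃ v ∈ 𝔲, h.IsSharp Q hd φ v := by
  rcases hφ with ⟨m, rfl⟩ | ⟨ξ, rfl⟩
  · exact ⟨_, (Module.finBasis K 𝔲 m).2, h.isSharp_resForm Q hd m⟩
  · exact ⟨0, 𝔲.zero_mem, h.isSharp_constForm Q hd ξ⟩

theorem sigmaAway_antisymm :
    (TensorProduct.comm K 𝔤 𝔤).toLinearMap.rTensor (Localization.Away Q) (h.sigmaAway Q hd) =
      -h.sigmaAway Q hd := by
  rw [← add_eq_zero_iff_eq_neg]
  refine eq_zero_of_evTwo h.adaptedBasis (h.testForms Q)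
    (fun p => h.coord_mem_span_testForms Q p hd) _ fun φ hφ ψ _ => ?_
  obtain ⟨v, _, hv⟩ := h.exists_isSharp Q hd hφ
  rw [map_add, evTwo_comm, hv.evTwo_right, hv.evTwo_left, neg_add_cancel]

theorem derivation_constForm (D : Derivation K (Localization.Away Q) (Localization.Away Q))
    (ξ : Module.Dual K 𝔩) :
    (D : Localization.Away Q →ₗ[K] Localization.Away Q) ∘ₗ h.constForm Q ξ = 0 := by
  ext y
  exact D.map_algebraMap _

/-- The pairing of a derivative of `σ_𝔩^𝔤` with the forms `ω_x(-, u)`, `ω_x(-, v)`. -/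
theorem evTwo_derivation_resForm (D : Derivation K (Localization.Away Q) (Localization.Away Q))
    (m n : Fin (Module.finrank K 𝔲)) :
    evTwo (h.resForm Q (Module.finBasis K 𝔲 m : 𝔤)) (h.resForm Q (Module.finBasis K 𝔲 n : 𝔤))
      ((D : Localization.Away Q →ₗ[K] Localization.Away Q).lTensor _ (h.sigmaAway Q hd)) =
      -D (h.resForm Q (Module.finBasis K 𝔲 n : 𝔤) (Module.finBasis K 𝔲 m : 𝔤)) := by
  rw [evTwo_lTensor, (h.isSharp_resForm Q hd m).evTwo_left,
    (h.isSharp_resForm Q hd n).evTwo_right, (h.isSharp_resForm Q hd m).evTwo_left,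
    LinearMap.comp_apply, LinearMap.comp_apply, h.resForm_skew Q (Module.finBasis K 𝔲 m : 𝔤),
    Derivation.coeFn_coe, map_neg]
  ring

theorem evTwo_derivation_constForm_left
    (D : Derivation K (Localization.Away Q) (Localization.Away Q))
    (ξ : Module.Dual K 𝔩) (ψ : 𝔤 →ₗ[K] Localization.Away Q) :
    evTwo (h.constForm Q ξ) ψ
      ((D : Localization.Away Q →ₗ[K] Localization.Away Q).lTensor _ (h.sigmaAway Q hd)) = 0 := by
  rw [evTwo_lTensor, derivation_constForm, (h.isSharp_constForm Q hd ξ).evTwo_left,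
    (h.isSharp_constForm Q hd ξ).evTwo_left,
    (h.isSharp_zero Q hd (φ := 0) fun _ _ => rfl).evTwo_left]
  simp

theorem evTwo_derivation_constForm_right
    (D : Derivation K (Localization.Away Q) (Localization.Away Q))
    (ξ : Module.Dual K 𝔩) (ψ : 𝔤 →ₗ[K] Localization.Away Q) :
    evTwo ψ (h.constForm Q ξ)
      ((D : Localization.Away Q →ₗ[K] Localization.Away Q).lTensor _ (h.sigmaAway Q hd)) = 0 := by
  rw [evTwo_lTensor, derivation_constForm, (h.isSharp_constForm Q hd ξ).evTwo_right,
    (h.isSharp_constForm Q hd ξ).evTwo_right,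
    (h.isSharp_zero Q hd (φ := 0) fun _ _ => rfl).evTwo_right]
  simp

theorem awayDer_dress_resForm (a : 𝔩) {u v : 𝔤} (hu : u ∈ 𝔲) :
    awayDer (dress (Double.inl K 𝔩 a)) Q (h.resForm Q v u) =
      h.resForm Q v ⁅i a, u⁆ - h.resForm Q u ⁅i a, v⁆ := by
  rw [h.resForm_skew Q u, resForm_apply, awayDer_algebraMap, h.dress_res_om a hu, map_add,
    sub_neg_eq_add]
  rfl

/-- Against two forms `ω(-, u)`, `ω(-, v)` this is the equivariance of `ω` on `L*` under `𝔩`.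
Against a constant form both terms vanish, since `σ` has its legs in `𝔲`. -/
theorem sigmaAway_equivariant (a : 𝔩) :
    (awayDer (dress (Double.inl K 𝔩 a)) Q :
        Localization.Away Q →ₗ[K] Localization.Away Q).lTensor (𝔤 ⊗[K] 𝔤) (h.sigmaAway Q hd) +
      (LieModule.toEnd K 𝔤 (𝔤 ⊗[K] 𝔤) (i a)).rTensor (Localization.Away Q) (h.sigmaAway Q hd)
      = 0 := by
  -- Composed with `ad a`, the constant form still kills `𝔲`, because `[𝔩, 𝔲] ⊂ 𝔲`.
  have hc : ∀ ξ, h.IsSharp Q hd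
      (h.constForm Q ξ ∘ₗ (LieModule.toEnd K 𝔤 𝔤 (i a) : 𝔤 →ₗ[K] 𝔤)) 0 := fun ξ =>
    h.isSharp_zero Q hd fun u hu => h.constForm_of_mem Q ξ (h.lie_mem a u hu)
  refine eq_zero_of_evTwo h.adaptedBasis (h.testForms Q)
    (fun p => h.coord_mem_span_testForms Q p hd) _ ?_
  rintro _ (⟨m, rfl⟩ | ⟨ξ, rfl⟩) _ (⟨n, rfl⟩ | ⟨η, rfl⟩)
  · rw [map_add, evTwo_derivation_resForm, evTwo_rTensor_toEnd,
      (h.isSharp_resForm Q hd m).evTwo_left, (h.isSharp_resForm Q hd n).evTwo_right,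
      LinearMap.comp_apply, LinearMap.comp_apply, LieModule.toEnd_apply_apply,
      LieModule.toEnd_apply_apply, h.awayDer_dress_resForm Q a (Module.finBasis K 𝔲 m).2]
    ring
  · rw [map_add, evTwo_derivation_constForm_right, evTwo_rTensor_toEnd,
      (h.isSharp_constForm Q hd η).evTwo_right, (hc η).evTwo_right]
    simp
  · rw [map_add, evTwo_derivation_constForm_left, evTwo_rTensor_toEnd,
      (h.isSharp_constForm Q hd ξ).evTwo_left, (hc ξ).evTwo_left]
    simp
  · rw [map_add, evTwo_derivation_constForm_left, evTwo_rTensor_toEnd,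
      (h.isSharp_constForm Q hd ξ).evTwo_left, (hc ξ).evTwo_left]
    simp

theorem evThree_dL (φ ψ χ : 𝔤 →ₗ[K] Localization.Away Q)
    (s : (𝔤 ⊗[K] 𝔤) ⊗[K] Localization.Away Q) :
    evThree φ ψ χ (dL i Q s) = -∑ k, χ (i (Module.finBasis K 𝔩 k)) * evTwo φ ψ
      ((awayDer (leftDer ((Module.finBasis K 𝔩).coord k)) Q :
        Localization.Away Q →ₗ[K] Localization.Away Q).lTensor _ s) := by
  rw [dL, map_neg, map_sum]
  simp only [evThree_insertThird]

/-- The third leg of `d^L` lies in `𝔩`, on which `ω(-, u)` vanishes over `L*`. -/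
theorem evThree_dL_resForm (φ ψ : 𝔤 →ₗ[K] Localization.Away Q)
    (s : (𝔤 ⊗[K] 𝔤) ⊗[K] Localization.Away Q) (n : Fin (Module.finrank K 𝔲)) :
    evThree φ ψ (h.resForm Q (Module.finBasis K 𝔲 n : 𝔤)) (dL i Q s) = 0 := by
  rw [evThree_dL]
  simp only [h.resForm_incl Q (Module.finBasis K 𝔲 n).2, zero_mul, Finset.sum_const_zero, neg_zero]

theorem evThree_dL_constForm_left (ξ : Module.Dual K 𝔩) (ψ χ : 𝔤 →ₗ[K] Localization.Away Q) :
    evThree (h.constForm Q ξ) ψ χ (dL i Q (h.sigmaAway Q hd)) = 0 := by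
  rw [evThree_dL]
  simp only [evTwo_derivation_constForm_left, mul_zero, Finset.sum_const_zero, neg_zero]

theorem evThree_dL_constForm_middle (ξ : Module.Dual K 𝔩) (ψ χ : 𝔤 →ₗ[K] Localization.Away Q) :
    evThree ψ (h.constForm Q ξ) χ (dL i Q (h.sigmaAway Q hd)) = 0 := by
  rw [evThree_dL]
  simp only [evTwo_derivation_constForm_right, mul_zero, Finset.sum_const_zero, neg_zero]

/-- `ξ ↦ L_ξ g` is linear, on the localization. -/
theorem sum_awayDer_leftDer (ξ : Module.Dual K 𝔩) (z : Localization.Away Q) :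
    ∑ k, algebraMap K (Localization.Away Q) (ξ (Module.finBasis K 𝔩 k)) *
      awayDer (leftDer ((Module.finBasis K 𝔩).coord k)) Q z = awayDer (leftDer ξ) Q z := by
  rw [← sub_eq_zero]
  refine away_leibniz_eq_zero Q (RingHom.id _) (fun z =>
    ∑ k, algebraMap K (Localization.Away Q) (ξ (Module.finBasis K 𝔩 k)) *
      awayDer (leftDer ((Module.finBasis K 𝔩).coord k)) Q z - awayDer (leftDer ξ) Q z) ?_ ?_ z
  · intro x y
    simp only [awayDer_mul, RingHom.id_apply, mul_add, Finset.sum_add_distrib,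
      mul_sub, Finset.mul_sum, mul_left_comm]
    ring
  · intro f
    have e : leftDerLin f ξ =
        ∑ k, ξ (Module.finBasis K 𝔩 k) • leftDerLin f ((Module.finBasis K 𝔩).coord k) := by
      have e1 : ξ = ∑ k, ξ (Module.finBasis K 𝔩 k) • (Module.finBasis K 𝔩).coord k := by
        apply (Module.finBasis K 𝔩).ext
        intro l
        simp
      conv_lhs => rw [e1]
      simp only [map_sum, map_smul]
    simp only [awayDer_algebraMap]
    change _ - algebraMap _ _ (leftDerLin f ξ) = 0
    rw [e, map_sum, sub_eq_zero]
    refine Finset.sum_congr rfl fun k _ => ?_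
    rw [Algebra.smul_def, map_mul, ← IsScalarTower.algebraMap_apply]
    rfl

theorem evThree_dL_constForm (ξ : Module.Dual K 𝔩) (m n : Fin (Module.finrank K 𝔲)) :
    evThree (h.resForm Q (Module.finBasis K 𝔲 m : 𝔤)) (h.resForm Q (Module.finBasis K 𝔲 n : 𝔤))
      (h.constForm Q ξ) (dL i Q (h.sigmaAway Q hd)) =
      awayDer (leftDer ξ) Q
        (h.resForm Q (Module.finBasis K 𝔲 n : 𝔤) (Module.finBasis K 𝔲 m : 𝔤)) := by
  rw [evThree_dL]
  simp only [evTwo_derivation_resForm, constForm_apply, dualIncl_incl, mul_neg,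
    Finset.sum_neg_distrib, neg_neg]
  exact sum_awayDer_leftDer Q ξ _

theorem pairInto_constForm_constForm (ξ η : Module.Dual K 𝔩) {u : 𝔤} (hu : u ∈ 𝔲) :
    pairInto (h.constForm Q ξ) (h.constForm Q η) (δ (K := K) u) = 0 := by
  have e := h.pair_proj_eq_zero ξ η hu
  have e2 := congrArg (Algebra.ofId K (Localization.Away Q)) e
  rw [pair_eq_pairInto, map_pairInto, map_zero] at e2
  exact e2

theorem pairInto_constForm_left (ξ : Module.Dual K 𝔩) (φ : 𝔤 →ₗ[K] Localization.Away Q) (u : 𝔤) :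
    pairInto (h.constForm Q ξ) φ (δ (K := K) u) = φ (coact (h.dualIncl ξ) u) := by
  rw [coact_apply]
  generalize δ (K := K) u = t
  induction t with
  | zero => simp
  | tmul x y => simp [constForm_apply, Algebra.smul_def]
  | add s t hs ht => simp only [map_add, hs, ht]

theorem pairInto_constForm_right (ξ : Module.Dual K 𝔩) (φ : 𝔤 →ₗ[K] Localization.Away Q) (u : 𝔤) :
    pairInto φ (h.constForm Q ξ) (δ (K := K) u) = -φ (coact (h.dualIncl ξ) u) := by
  rw [← pairInto_constForm_left, ← pairInto_comm, LieBialgebra.antisymm, map_neg]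

/-- The value of the left hand side of the dynamical Yang-Baxter equation for `σ_𝔩^𝔤` on three
forms. -/
noncomputable def dybeValue (φ ψ χ : 𝔤 →ₗ[K] Localization.Away Q) : Localization.Away Q :=
  evThree φ ψ χ (CYB (h.sigmaAway Q hd) +
    (Alt K 𝔤).rTensor (Localization.Away Q) (dL i Q (h.sigmaAway Q hd)) +
    (Alt K 𝔤 ∘ₗ (δ (K := K)).rTensor 𝔤).rTensor (Localization.Away Q) (h.sigmaAway Q hd))

theorem dybeValue_eq {φ ψ χ : 𝔤 →ₗ[K] Localization.Away Q} {u v w : 𝔤}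
    (hφ : h.IsSharp Q hd φ u) (hψ : h.IsSharp Q hd ψ v) (hχ : h.IsSharp Q hd χ w) :
    h.dybeValue Q hd φ ψ χ = φ ⁅v, w⁆ + ψ ⁅w, u⁆ + χ ⁅u, v⁆ +
      (evThree φ ψ χ (dL i Q (h.sigmaAway Q hd)) + evThree χ φ ψ (dL i Q (h.sigmaAway Q hd)) +
        evThree ψ χ φ (dL i Q (h.sigmaAway Q hd))) -
      (pairInto φ ψ (δ (K := K) w) + pairInto χ φ (δ (K := K) v) +
        pairInto ψ χ (δ (K := K) u)) := by
  rw [dybeValue, map_add, map_add, hφ.evThree_CYB hψ hχ, LinearMap.rTensor_comp,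
    LinearMap.comp_apply, evThree_Alt, evThree_Alt, hχ.evThree_rTensor_δ, hφ.evThree_rTensor_δ,
    hψ.evThree_rTensor_δ]
  ring

/-- On test forms the expression in `dybeValue_eq` is cyclically invariant, so only the number of
constant forms matters, not their position. -/
theorem dybeValue_rotate {φ ψ χ : 𝔤 →ₗ[K] Localization.Away Q} (hφ : φ ∈ h.testForms Q)
    (hψ : ψ ∈ h.testForms Q) (hχ : χ ∈ h.testForms Q) :
    h.dybeValue Q hd φ ψ χ = h.dybeValue Q hd ψ χ φ := by
  obtain ⟨u, _, hu⟩ := h.exists_isSharp Q hd hφ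
  obtain ⟨v, _, hv⟩ := h.exists_isSharp Q hd hψ
  obtain ⟨w, _, hw⟩ := h.exists_isSharp Q hd hχ
  rw [h.dybeValue_eq Q hd hu hv hw, h.dybeValue_eq Q hd hv hw hu]
  ring

/-- The surviving term `L_ξ ω(u_m, u_n)` of `d^L` is given by `awayDer_leftDer_resForm`: its
constant part cancels `ξ([u_m, u_n])` from `CYB`, and its coadjoint part cancels the cobracket
terms. -/
theorem dybeValue_resForm_constForm (m n : Fin (Module.finrank K 𝔲)) (ξ : Module.Dual K 𝔩) :
    h.dybeValue Q hd (h.resForm Q (Module.finBasis K 𝔲 m : 𝔤))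
      (h.resForm Q (Module.finBasis K 𝔲 n : 𝔤)) (h.constForm Q ξ) = 0 := by
  rw [h.dybeValue_eq Q hd (h.isSharp_resForm Q hd m) (h.isSharp_resForm Q hd n)
    (h.isSharp_constForm Q hd ξ), evThree_dL_constForm, evThree_dL_resForm, evThree_dL_resForm,
    awayDer_leftDer_resForm, pairInto_constForm_left, pairInto_constForm_right, constForm_apply,
    ← lie_skew (Module.finBasis K 𝔲 m : 𝔤) (Module.finBasis K 𝔲 n : 𝔤)]
  simp only [lie_zero, zero_lie, map_zero, map_neg]
  ring

/-- In each cyclic arrangement one of the first two slots of `d^L σ` meets a constant form, which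
kills `𝔲`. What remains is the pairing of `ξ ⊗ η` with `δ(u)`, zero because `δ(𝔲)` has no `𝔩 ⊗ 𝔩`
component. -/
theorem dybeValue_constForm_constForm (ξ η : Module.Dual K 𝔩) {φ : 𝔤 →ₗ[K] Localization.Away Q}
    (hφ : φ ∈ h.testForms Q) :
    h.dybeValue Q hd (h.constForm Q ξ) (h.constForm Q η) φ = 0 := by
  obtain ⟨u, hu, hφ⟩ := h.exists_isSharp Q hd hφ
  rw [h.dybeValue_eq Q hd (h.isSharp_constForm Q hd ξ) (h.isSharp_constForm Q hd η) hφ,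
    evThree_dL_constForm_left, evThree_dL_constForm_middle, evThree_dL_constForm_left,
    pairInto_constForm_constForm _ _ _ _ hu]
  simp

theorem sigmaAway_dybe :
    CYB (h.sigmaAway Q hd) +
      (Alt K 𝔤).rTensor (Localization.Away Q) (dL i Q (h.sigmaAway Q hd)) +
      (Alt K 𝔤 ∘ₗ (δ (K := K)).rTensor 𝔤).rTensor (Localization.Away Q) (h.sigmaAway Q hd) = 0 := by
  refine eq_zero_of_evThree h.adaptedBasis (h.testForms Q)
    (fun p => h.coord_mem_span_testForms Q p hd) _ fun φ hφ ψ hψ χ hχ => ?_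
  change h.dybeValue Q hd φ ψ χ = 0
  have hr := h.dybeValue_rotate Q hd hφ hψ hχ
  have hr' := h.dybeValue_rotate Q hd hψ hχ hφ
  rcases hφ with ⟨m, rfl⟩ | ⟨ξ, rfl⟩ <;> rcases hψ with ⟨n, rfl⟩ | ⟨η, rfl⟩ <;>
    rcases hχ with ⟨k, rfl⟩ | ⟨ζ, rfl⟩
  · simp only
    rw [h.dybeValue_eq Q hd (h.isSharp_resForm Q hd m) (h.isSharp_resForm Q hd n)
      (h.isSharp_resForm Q hd k), evThree_dL_resForm, evThree_dL_resForm, evThree_dL_resForm]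
    -- With three forms `ω(-, u)` the terms of `d^L` are absent, and `CYB` and `δ` are the two sides
    -- of the cyclic identity.
    linear_combination h.cyclic_resForm_lie Q (Module.finBasis K 𝔲 m : 𝔤)
      (Module.finBasis K 𝔲 n : 𝔤) (Module.finBasis K 𝔲 k : 𝔤)
  · exact h.dybeValue_resForm_constForm Q hd m n ζ
  · exact hr.trans (hr'.trans (h.dybeValue_resForm_constForm Q hd k m η))
  · exact hr.trans (h.dybeValue_constForm_constForm Q hd η ζ (Or.inl ⟨m, rfl⟩))
  · exact hr.trans (h.dybeValue_resForm_constForm Q hd n k ξ)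
  · exact hr.trans (hr'.trans (h.dybeValue_constForm_constForm Q hd ζ ξ (Or.inl ⟨n, rfl⟩)))
  · exact h.dybeValue_constForm_constForm Q hd ξ η (Or.inl ⟨k, rfl⟩)
  · exact h.dybeValue_constForm_constForm Q hd ξ η (Or.inr ⟨ζ, rfl⟩)

end IsSplitting

/-! ### Functoriality of the equations and the mixed terms of `CYB`. -/

section Functoriality

open LieBialgebra

variable {K : Type*} [Field K] [CharZero K] {V W : Type*} [LieRing V] [LieAlgebra K V]
  [LieRing W] [LieAlgebra K W]
  {A B : Type*} [CommRing A] [Algebra K A] [CommRing B] [Algebra K B]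

theorem rTensor_lTensor_apply {M N : Type*} [AddCommGroup M] [Module K M] [AddCommGroup N]
    [Module K N] (F : M →ₗ[K] N) (θ : A →ₗ[K] B) (s : M ⊗[K] A) :
    F.rTensor B (θ.lTensor M s) = θ.lTensor N (F.rTensor A s) := by
  rw [← LinearMap.comp_apply, ← LinearMap.comp_apply, LinearMap.rTensor_comp_lTensor,
    LinearMap.lTensor_comp_rTensor]

theorem CYB_lTensor (θ : A →ₐ[K] B) (s : (V ⊗[K] V) ⊗[K] A) :
    CYB (θ.toLinearMap.lTensor (V ⊗[K] V) s) =
      θ.toLinearMap.lTensor ((V ⊗[K] V) ⊗[K] V) (CYB s) := by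
  refine LinearMap.congr_fun₂ (tensorTwo_ext₂
    (F := (TensorProduct.map₂ (lie₁₂₁₃ K V + lie₁₂₂₃ K V + lie₁₃₂₃ K V)
      (LinearMap.mul K B)).compl₁₂ (θ.toLinearMap.lTensor (V ⊗[K] V))
        (θ.toLinearMap.lTensor (V ⊗[K] V)))
    (G := (TensorProduct.map₂ (lie₁₂₁₃ K V + lie₁₂₂₃ K V + lie₁₃₂₃ K V)
      (LinearMap.mul K A)).compr₂ (θ.toLinearMap.lTensor ((V ⊗[K] V) ⊗[K] V)))
    fun x y f x' y' g => ?_) s s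
  simp only [LinearMap.compl₁₂_apply, LinearMap.compr₂_apply, LinearMap.lTensor_tmul,
    TensorProduct.map₂_apply_tmul, TensorProduct.map_tmul, LinearMap.mul_apply',
    AlgHom.toLinearMap_apply, map_mul]

variable (j : V →ₗ⁅K⁆ W)

/-- The map `V ⊗ V → W ⊗ W` induced by `j`. -/
noncomputable def mapTwo : V ⊗[K] V →ₗ[K] W ⊗[K] W :=
  TensorProduct.map (j : V →ₗ[K] W) (j : V →ₗ[K] W)

/-- The map `V ⊗ V ⊗ V → W ⊗ W ⊗ W` induced by `j`. -/
noncomputable def mapThree : (V ⊗[K] V) ⊗[K] V →ₗ[K] (W ⊗[K] W) ⊗[K] W :=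
  TensorProduct.map (mapTwo j) (j : V →ₗ[K] W)

theorem comm_mapTwo (s : (V ⊗[K] V) ⊗[K] A) :
    (TensorProduct.comm K W W).toLinearMap.rTensor A ((mapTwo j).rTensor A s) =
      (mapTwo j).rTensor A ((TensorProduct.comm K V V).toLinearMap.rTensor A s) := by
  refine LinearMap.congr_fun (tensorTwo_ext
    (F := (TensorProduct.comm K W W).toLinearMap.rTensor A ∘ₗ (mapTwo j).rTensor A)
    (G := (mapTwo j).rTensor A ∘ₗ (TensorProduct.comm K V V).toLinearMap.rTensor A)
    fun x y f => ?_) s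
  simp [mapTwo]

theorem toEnd_mapTwo (a : V) (s : (V ⊗[K] V) ⊗[K] A) :
    (LieModule.toEnd K W (W ⊗[K] W) (j a)).rTensor A ((mapTwo j).rTensor A s) =
      (mapTwo j).rTensor A ((LieModule.toEnd K V (V ⊗[K] V) a).rTensor A s) := by
  refine LinearMap.congr_fun (tensorTwo_ext
    (F := (LieModule.toEnd K W (W ⊗[K] W) (j a)).rTensor A ∘ₗ (mapTwo j).rTensor A)
    (G := (mapTwo j).rTensor A ∘ₗ (LieModule.toEnd K V (V ⊗[K] V) a).rTensor A)
    fun x y f => ?_) s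
  simp [mapTwo, TensorProduct.LieModule.lie_tmul_right]

theorem CYB_mapTwo (s : (V ⊗[K] V) ⊗[K] A) :
    CYB ((mapTwo j).rTensor A s) = (mapThree j).rTensor A (CYB s) := by
  refine LinearMap.congr_fun₂ (tensorTwo_ext₂
    (F := (TensorProduct.map₂ (lie₁₂₁₃ K W + lie₁₂₂₃ K W + lie₁₃₂₃ K W)
      (LinearMap.mul K A)).compl₁₂ ((mapTwo j).rTensor A) ((mapTwo j).rTensor A))
    (G := (TensorProduct.map₂ (lie₁₂₁₃ K V + lie₁₂₂₃ K V + lie₁₃₂₃ K V)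
      (LinearMap.mul K A)).compr₂ ((mapThree j).rTensor A))
    fun x y f x' y' g => ?_) s s
  simp only [LinearMap.compl₁₂_apply, LinearMap.compr₂_apply, LinearMap.rTensor_tmul,
    TensorProduct.map₂_apply_tmul, TensorProduct.map_tmul, mapTwo, mapThree, LinearMap.add_apply,
    lie₁₂₁₃_tmul, lie₁₂₂₃_tmul, lie₁₃₂₃_tmul, map_add, LieHom.coe_toLinearMap, LieHom.map_lie]

theorem Alt_mapThree (t : ((V ⊗[K] V) ⊗[K] V) ⊗[K] A) :
    (Alt K W).rTensor A ((mapThree j).rTensor A t) =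
      (mapThree j).rTensor A ((Alt K V).rTensor A t) := by
  refine LinearMap.congr_fun (tensorThree_ext
    (F := (Alt K W).rTensor A ∘ₗ (mapThree j).rTensor A)
    (G := (mapThree j).rTensor A ∘ₗ (Alt K V).rTensor A) fun x y z f => ?_) t
  simp [mapThree, mapTwo, Alt, cyc]

theorem rTensor_δ_mapTwo [LieBialgebra K V] [LieBialgebra K W] (hj : IsLieBialgebraInclusion j)
    (s : (V ⊗[K] V) ⊗[K] A) :
    ((δ (K := K) (𝔤 := W)).rTensor W).rTensor A ((mapTwo j).rTensor A s) =
      (mapThree j).rTensor A (((δ (K := K) (𝔤 := V)).rTensor V).rTensor A s) := by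
  refine LinearMap.congr_fun (tensorTwo_ext
    (F := ((δ (K := K) (𝔤 := W)).rTensor W).rTensor A ∘ₗ (mapTwo j).rTensor A)
    (G := (mapThree j).rTensor A ∘ₗ ((δ (K := K) (𝔤 := V)).rTensor V).rTensor A)
    fun x y f => ?_) s
  simp only [LinearMap.comp_apply, LinearMap.rTensor_tmul, mapTwo, mapThree,
    TensorProduct.map_tmul, LieHom.coe_toLinearMap, hj.map_δ]

theorem insertThird_mapTwo (e : V) (D : A →ₗ[K] A) (s : (V ⊗[K] V) ⊗[K] A) :
    insertThird (j e) D ((mapTwo j).rTensor A s) =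
      (mapThree j).rTensor A (insertThird e D s) := by
  refine LinearMap.congr_fun (tensorTwo_ext
    (F := insertThird (j e) D ∘ₗ (mapTwo j).rTensor A)
    (G := (mapThree j).rTensor A ∘ₗ insertThird e D) fun x y f => ?_) s
  rfl

theorem dL_mapTwo {𝔥 : Type*} [LieRing 𝔥] [LieAlgebra K 𝔥] [LieBialgebra K 𝔥]
    [FiniteDimensional K 𝔥] [LieBialgebra K V] [LieBialgebra K W] (i : 𝔥 →ₗ⁅K⁆ V)
    (Q : FormalFun K 𝔥) (s : (V ⊗[K] V) ⊗[K] Localization.Away Q) :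
    dL (j.comp i) Q ((mapTwo j).rTensor _ s) = (mapThree j).rTensor _ (dL i Q s) := by
  rw [dL, dL, map_neg, map_sum]
  simp only [LieHom.comp_apply, insertThird_mapTwo]

theorem dL_add {𝔥 : Type*} [LieRing 𝔥] [LieAlgebra K 𝔥] [LieBialgebra K 𝔥]
    [FiniteDimensional K 𝔥] [LieBialgebra K V] (i : 𝔥 →ₗ⁅K⁆ V)
    (Q : FormalFun K 𝔥) (s t : (V ⊗[K] V) ⊗[K] Localization.Away Q) :
    dL i Q (s + t) = dL i Q s + dL i Q t := by
  simp only [dL, map_add, Finset.sum_add_distrib, neg_add]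

/-- `(ρ, σ) ↦ [ρ^{1,2}, σ^{1,3} + σ^{2,3}]`. -/
noncomputable def lieThird : (V ⊗[K] V) ⊗[K] A →ₗ[K] (V ⊗[K] V) ⊗[K] A →ₗ[K]
    ((V ⊗[K] V) ⊗[K] V) ⊗[K] A :=
  TensorProduct.map₂ (lie₁₂₁₃ K V + lie₁₂₂₃ K V) (LinearMap.mul K A)

/-- The first leg of `σ` acts on `ρ` by the diagonal adjoint action while the second is carried
along. This is the form in which the equivariance of `ρ` can be applied. -/
theorem lieThird_tmul (ρ : (V ⊗[K] V) ⊗[K] A) (x y : V) (f : A) :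
    lieThird ρ ((x ⊗ₜ[K] y) ⊗ₜ[K] f) =
      -insertThird y (LinearMap.mulLeft K f)
        ((LieModule.toEnd K V (V ⊗[K] V) x).rTensor A ρ) := by
  refine LinearMap.congr_fun (tensorTwo_ext (F := lieThird.flip ((x ⊗ₜ[K] y) ⊗ₜ[K] f))
    (G := -(insertThird y (LinearMap.mulLeft K f) ∘ₗ
      (LieModule.toEnd K V (V ⊗[K] V) x).rTensor A)) fun a b g => ?_) ρ
  change ((⁅a, x⁆ ⊗ₜ[K] b) ⊗ₜ[K] y + (a ⊗ₜ[K] ⁅b, x⁆) ⊗ₜ[K] y) ⊗ₜ[K] (g * f) =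
    -((⁅x, a ⊗ₜ[K] b⁆ ⊗ₜ[K] y) ⊗ₜ[K] (f * g))
  rw [TensorProduct.LieModule.lie_tmul_right, ← lie_skew x a, ← lie_skew x b,
    TensorProduct.neg_tmul, TensorProduct.tmul_neg, ← neg_add, TensorProduct.neg_tmul,
    TensorProduct.neg_tmul, neg_neg, ← TensorProduct.add_tmul, mul_comm]

theorem lie₁₂₂₃_add_lie₁₃₂₃ (ρ σ : (V ⊗[K] V) ⊗[K] A) :
    TensorProduct.map₂ (lie₁₂₂₃ K V) (LinearMap.mul K A) σ ρ +
      TensorProduct.map₂ (lie₁₃₂₃ K V) (LinearMap.mul K A) σ ρ =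
      -(cyc K V).rTensor A ((cyc K V).rTensor A
        (lieThird ρ ((TensorProduct.comm K V V).toLinearMap.rTensor A σ))) := by
  refine LinearMap.congr_fun₂ (tensorTwo_ext₂
    (F := TensorProduct.map₂ (lie₁₂₂₃ K V) (LinearMap.mul K A) +
      TensorProduct.map₂ (lie₁₃₂₃ K V) (LinearMap.mul K A))
    (G := -((lieThird.flip ∘ₗ
      (TensorProduct.comm K V V).toLinearMap.rTensor A).compr₂
        ((cyc K V).rTensor A ∘ₗ (cyc K V).rTensor A)))
    fun x y f a b g => ?_) σ ρ
  change (x ⊗ₜ[K] ⁅y, a⁆) ⊗ₜ[K] b ⊗ₜ[K] (f * g) + (x ⊗ₜ[K] a) ⊗ₜ[K] ⁅y, b⁆ ⊗ₜ[K] (f * g) =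
    -(cyc K V).rTensor A ((cyc K V).rTensor A
      (lieThird ((a ⊗ₜ[K] b) ⊗ₜ[K] g) ((y ⊗ₜ[K] x) ⊗ₜ[K] f)))
  simp only [lieThird, TensorProduct.map₂_apply_tmul, TensorProduct.map_tmul,
    LinearMap.add_apply, lie₁₂₁₃_tmul, lie₁₂₂₃_tmul, LinearMap.mul_apply', map_add,
    LinearMap.rTensor_tmul, cyc, LinearMap.comp_apply, LinearEquiv.coe_coe,
    TensorProduct.assoc_tmul, TensorProduct.comm_tmul, TensorProduct.add_tmul]
  rw [← lie_skew y a, ← lie_skew y b]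
  simp only [TensorProduct.neg_tmul, TensorProduct.tmul_neg, mul_comm, neg_add]

theorem lie₁₃₂₃_sub_lie₁₂₁₃ (ρ σ : (V ⊗[K] V) ⊗[K] A) :
    TensorProduct.map₂ (lie₁₃₂₃ K V) (LinearMap.mul K A) ρ
        ((TensorProduct.comm K V V).toLinearMap.rTensor A σ) -
      TensorProduct.map₂ (lie₁₂₁₃ K V) (LinearMap.mul K A) σ ρ =
      (cyc K V).rTensor A
        (lieThird ((TensorProduct.comm K V V).toLinearMap.rTensor A ρ) σ) := by
  refine LinearMap.congr_fun₂ (tensorTwo_ext₂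
    (F := (TensorProduct.map₂ (lie₁₃₂₃ K V) (LinearMap.mul K A)).compl₂
      ((TensorProduct.comm K V V).toLinearMap.rTensor A) -
      (TensorProduct.map₂ (lie₁₂₁₃ K V) (LinearMap.mul K A)).flip)
    (G := (lieThird ∘ₗ (TensorProduct.comm K V V).toLinearMap.rTensor A).compr₂
      ((cyc K V).rTensor A))
    fun a b g x y f => ?_) ρ σ
  change (a ⊗ₜ[K] y) ⊗ₜ[K] ⁅b, x⁆ ⊗ₜ[K] (g * f) - (⁅x, a⁆ ⊗ₜ[K] y) ⊗ₜ[K] b ⊗ₜ[K] (f * g) =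
    (cyc K V).rTensor A (lieThird ((b ⊗ₜ[K] a) ⊗ₜ[K] g) ((x ⊗ₜ[K] y) ⊗ₜ[K] f))
  simp only [lieThird, TensorProduct.map₂_apply_tmul, TensorProduct.map_tmul,
    LinearMap.add_apply, lie₁₂₁₃_tmul, lie₁₂₂₃_tmul, LinearMap.mul_apply', map_add,
    LinearMap.rTensor_tmul, cyc, LinearMap.comp_apply, LinearEquiv.coe_coe,
    TensorProduct.assoc_tmul, TensorProduct.comm_tmul, TensorProduct.add_tmul]
  rw [← lie_skew x a]
  simp only [TensorProduct.neg_tmul, mul_comm f g, sub_neg_eq_add]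

theorem Alt_rTensor_apply (t : ((V ⊗[K] V) ⊗[K] V) ⊗[K] A) :
    (Alt K V).rTensor A t =
      t + (cyc K V).rTensor A t + (cyc K V).rTensor A ((cyc K V).rTensor A t) := by
  rw [Alt, LinearMap.rTensor_add, LinearMap.rTensor_add, LinearMap.rTensor_comp,
    LinearMap.add_apply, LinearMap.add_apply, LinearMap.rTensor_id, LinearMap.id_apply,
    LinearMap.comp_apply]

theorem map₂_lieThird (s t : (V ⊗[K] V) ⊗[K] A) :
    lieThird s t = TensorProduct.map₂ (lie₁₂₁₃ K V) (LinearMap.mul K A) s t +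
        TensorProduct.map₂ (lie₁₂₂₃ K V) (LinearMap.mul K A) s t := by
  refine LinearMap.congr_fun₂ (tensorTwo_ext₂ (F := lieThird)
    (G := TensorProduct.map₂ (lie₁₂₁₃ K V) (LinearMap.mul K A) +
        TensorProduct.map₂ (lie₁₂₂₃ K V) (LinearMap.mul K A))
    fun x y f x' y' g => ?_) s t
  simp only [lieThird, TensorProduct.map₂_apply_tmul, LinearMap.add_apply,
    TensorProduct.map_tmul, TensorProduct.add_tmul]

/-- The mixed terms of `CYB` for antisymmetric tensors. -/
theorem CYB_add {ρ σ : (V ⊗[K] V) ⊗[K] A}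
    (hρ : (TensorProduct.comm K V V).toLinearMap.rTensor A ρ = -ρ)
    (hσ : (TensorProduct.comm K V V).toLinearMap.rTensor A σ = -σ) :
    CYB (ρ + σ) = CYB ρ + CYB σ + (Alt K V).rTensor A (lieThird ρ σ) := by
  have e1 := lie₁₂₂₃_add_lie₁₃₂₃ ρ σ
  have e2 := lie₁₃₂₃_sub_lie₁₂₁₃ ρ σ
  rw [hσ, map_neg, map_neg, map_neg, neg_neg] at e1
  rw [hρ, hσ, map_neg, map_neg, LinearMap.neg_apply, map_neg] at e2
  -- The six mixed brackets group in pairs: those with `ρ^{1,2}` form `lieThird ρ σ`, those with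
  -- `ρ^{1,3}` its image under `cyc`, and those with `ρ^{2,3}` its image under `cyc` twice.
  rw [Alt_rTensor_apply, ← e1, ← neg_eq_iff_eq_neg.mpr e2, map₂_lieThird]
  simp only [CYB, map₂_lie_add, map_add, LinearMap.add_apply]
  abel

end Functoriality

/-! ### Restriction of `ρ` and proof of the theorem. -/

namespace IsSplitting

open LieBialgebra FormalFun

variable {K : Type*} [Field K] [CharZero K] {𝔩 𝔤 𝔞 : Type*} [LieRing 𝔩] [LieAlgebra K 𝔩]
  [LieBialgebra K 𝔩] [LieRing 𝔤] [LieAlgebra K 𝔤] [LieBialgebra K 𝔤] [LieRing 𝔞]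
  [LieAlgebra K 𝔞] [LieBialgebra K 𝔞] {i : 𝔩 →ₗ⁅K⁆ 𝔤}
  {𝔲 : Submodule K 𝔤} (h : IsSplitting i 𝔲) [FiniteDimensional K 𝔤] [FiniteDimensional K 𝔩]
  (P : FormalFun K 𝔤) (Q : FormalFun K 𝔩) (hQ : h.res P ∣ Q) (hd : h.detP ∣ Q)
  (j : 𝔤 →ₗ⁅K⁆ 𝔞)

theorem sigmaIn_eq : h.sigmaIn j P =
    (mapTwo j).rTensor _ (h.sigmaAway (h.res P * h.detP) (dvd_mul_left _ _)) := by
  rw [sigmaIn, sigma, sigmaAway]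
  simp only [map_sum]
  rfl

/-- The map `x ⊗ y ⊗ f ↦ x ⊗ y ⊗ e ⊗ (L_η f)_{|L*}`. -/
noncomputable def insertRes (e : 𝔞) (η : Module.Dual K 𝔤) :
    (𝔞 ⊗[K] 𝔞) ⊗[K] Localization.Away P →ₗ[K]
      ((𝔞 ⊗[K] 𝔞) ⊗[K] 𝔞) ⊗[K] Localization.Away Q :=
  TensorProduct.map ((TensorProduct.mk K (𝔞 ⊗[K] 𝔞) 𝔞).flip e)
    ((awayHom h.res P Q hQ).toLinearMap ∘ₗ
      (awayDer (leftDer η) P : Localization.Away P →ₗ[K] Localization.Away P))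

theorem leftDer_add' (ξ η : Module.Dual K 𝔤) :
    (leftDer (ξ + η) : Derivation K (FormalFun K 𝔤) (FormalFun K 𝔤)) =
      leftDer ξ + leftDer η :=
  Derivation.ext fun f => leftDer_add ξ η f

theorem leftDer_smul' (c : K) (η : Module.Dual K 𝔤) :
    (leftDer (c • η) : Derivation K (FormalFun K 𝔤) (FormalFun K 𝔤)) = c • leftDer η :=
  Derivation.ext fun f => leftDer_smul c η f

/-- `insertRes` as a bilinear map. -/
noncomputable def insertResBilin (ρ : (𝔞 ⊗[K] 𝔞) ⊗[K] Localization.Away P) :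
    𝔤 →ₗ[K] Module.Dual K 𝔤 →ₗ[K] ((𝔞 ⊗[K] 𝔞) ⊗[K] 𝔞) ⊗[K] Localization.Away Q :=
  LinearMap.mk₂ K (fun y η => h.insertRes P Q hQ (j y) η ρ)
    (fun y y' η => by
      rw [insertRes, map_add, map_add, TensorProduct.map_add_left]
      rfl)
    (fun c y η => by
      rw [insertRes, map_smul, map_smul, TensorProduct.map_smul_left]
      rfl)
    (fun y η η' => by
      have e : (awayHom h.res P Q hQ).toLinearMap ∘ₗ (awayDer (leftDer (η + η')) P :
          Localization.Away P →ₗ[K] Localization.Away P) =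
          (awayHom h.res P Q hQ).toLinearMap ∘ₗ (awayDer (leftDer η) P :
            Localization.Away P →ₗ[K] Localization.Away P) +
          (awayHom h.res P Q hQ).toLinearMap ∘ₗ (awayDer (leftDer η') P :
            Localization.Away P →ₗ[K] Localization.Away P) := by
        ext1 z
        simp only [LinearMap.comp_apply, Derivation.coeFn_coe, LinearMap.add_apply, leftDer_add',
          awayDer_add, map_add]
      rw [insertRes, e, TensorProduct.map_add_right]
      rfl)
    (fun c y η => by
      have e : (awayHom h.res P Q hQ).toLinearMap ∘ₗ (awayDer (leftDer (c • η)) P :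
          Localization.Away P →ₗ[K] Localization.Away P) =
          c • (awayHom h.res P Q hQ).toLinearMap ∘ₗ (awayDer (leftDer η) P :
            Localization.Away P →ₗ[K] Localization.Away P) := by
        ext1 z
        simp only [LinearMap.comp_apply, Derivation.coeFn_coe, LinearMap.smul_apply, leftDer_smul',
          awayDer_smul, map_smul]
      rw [insertRes, e, TensorProduct.map_smul_right]
      rfl)

theorem insertRes_dualIncl (e : 𝔞) (ξ : Module.Dual K 𝔩)
    (ρ : (𝔞 ⊗[K] 𝔞) ⊗[K] Localization.Away P) :
    h.insertRes P Q hQ e (h.dualIncl ξ) ρ =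
      insertThird e (awayDer (leftDer ξ) Q : Localization.Away Q →ₗ[K] Localization.Away Q)
        ((awayHom h.res P Q hQ).toLinearMap.lTensor _ ρ) := by
  refine LinearMap.congr_fun (tensorTwo_ext (F := h.insertRes P Q hQ e (h.dualIncl ξ))
    (G := insertThird e (awayDer (leftDer ξ) Q : Localization.Away Q →ₗ[K] Localization.Away Q) ∘ₗ
      (awayHom h.res P Q hQ).toLinearMap.lTensor _) fun x y f => ?_) ρ
  simp only [insertRes, insertThird, LinearMap.comp_apply, TensorProduct.map_tmul,
    LinearMap.lTensor_tmul, AlgHom.toLinearMap_apply, Derivation.coeFn_coe,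
    awayHom_awayDer_leftDer]

theorem lTensor_insertThird (e : 𝔞) (η : Module.Dual K 𝔤)
    (ρ : (𝔞 ⊗[K] 𝔞) ⊗[K] Localization.Away P) :
    (awayHom h.res P Q hQ).toLinearMap.lTensor _ (insertThird e
      (awayDer (leftDer η) P : Localization.Away P →ₗ[K] Localization.Away P) ρ) =
      h.insertRes P Q hQ e η ρ :=
  LinearMap.congr_fun (tensorTwo_ext (F := (awayHom h.res P Q hQ).toLinearMap.lTensor _ ∘ₗ
    insertThird e (awayDer (leftDer η) P : Localization.Away P →ₗ[K] Localization.Away P))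
    (G := h.insertRes P Q hQ e η) fun _ _ _ => rfl) ρ

/-- In a basis adapted to the splitting, left translations along `𝔩*` commute with restriction to
`L*`; the subtracted sum consists of the derivatives transversal to `L*`. -/
theorem lTensor_dL (ρ : (𝔞 ⊗[K] 𝔞) ⊗[K] Localization.Away P) :
    (awayHom h.res P Q hQ).toLinearMap.lTensor _ (dL j P ρ) =
      dL (j.comp i) Q ((awayHom h.res P Q hQ).toLinearMap.lTensor _ ρ) -
        ∑ s, h.insertRes P Q hQ (j (Module.finBasis K 𝔲 s)) (h.uCoord s) ρ := by
  have e := h.sum_finBasis_coord (h.insertResBilin P Q hQ j ρ)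
  change ∑ s, h.insertRes P Q hQ (j _) _ ρ = ∑ s, h.insertRes P Q hQ (j _) _ ρ +
    ∑ s, h.insertRes P Q hQ (j _) _ ρ at e
  rw [dL, dL, map_neg, map_sum]
  simp only [lTensor_insertThird, LieHom.comp_apply]
  rw [e]
  simp only [insertRes_dualIncl]
  abel

/-- Equivariance replaces the adjoint action of `u_s` on `ρ` by `-dress_{u_s}`, which on `L*` is a
combination of transversal derivatives with coefficients given by `ω`. The coefficients of `σ`
invert `ω`, and single transversal derivatives remain. -/
theorem lieThird_sigma (ρ : (𝔞 ⊗[K] 𝔞) ⊗[K] Localization.Away P)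
    (hρ : ∀ a : 𝔤, (awayDer (FormalFun.dress (Double.inl K 𝔤 a)) P :
        Localization.Away P →ₗ[K] Localization.Away P).lTensor (𝔞 ⊗[K] 𝔞) ρ +
      (LieModule.toEnd K 𝔞 (𝔞 ⊗[K] 𝔞) (j a)).rTensor (Localization.Away P) ρ = 0) :
    lieThird ((awayHom h.res P Q hQ).toLinearMap.lTensor _ ρ)
      ((mapTwo j).rTensor _ (h.sigmaAway Q hd)) =
      -∑ s, h.insertRes P Q hQ (j (Module.finBasis K 𝔲 s)) (h.uCoord s) ρ := by
  have e1 : ∀ s t, lieThird ((awayHom h.res P Q hQ).toLinearMap.lTensor _ ρ)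
      ((j (Module.finBasis K 𝔲 s) ⊗ₜ[K] j (Module.finBasis K 𝔲 t)) ⊗ₜ[K]
        h.sigmaCoeff Q hd s t) =
      TensorProduct.map ((TensorProduct.mk K (𝔞 ⊗[K] 𝔞) 𝔞).flip (j (Module.finBasis K 𝔲 t)))
        (LinearMap.mulLeft K (h.sigmaCoeff Q hd s t) ∘ₗ (awayHom h.res P Q hQ).toLinearMap ∘ₗ
          (awayDer (dress (Double.inl K 𝔤 (Module.finBasis K 𝔲 s : 𝔤))) P :
            Localization.Away P →ₗ[K] Localization.Away P)) ρ := by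
    intro s t
    rw [lieThird_tmul, rTensor_lTensor_apply, eq_neg_of_add_eq_zero_right (hρ _), map_neg, map_neg,
      neg_neg]
    exact LinearMap.congr_fun (tensorTwo_ext
      (F := insertThird (j (Module.finBasis K 𝔲 t))
        (LinearMap.mulLeft K (h.sigmaCoeff Q hd s t)) ∘ₗ
          (awayHom h.res P Q hQ).toLinearMap.lTensor _ ∘ₗ
            (awayDer (dress (Double.inl K 𝔤 (Module.finBasis K 𝔲 s : 𝔤))) P :
              Localization.Away P →ₗ[K] Localization.Away P).lTensor _)
      (G := TensorProduct.map ((TensorProduct.mk K (𝔞 ⊗[K] 𝔞) 𝔞).flip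
        (j (Module.finBasis K 𝔲 t)))
        (LinearMap.mulLeft K (h.sigmaCoeff Q hd s t) ∘ₗ (awayHom h.res P Q hQ).toLinearMap ∘ₗ
          (awayDer (dress (Double.inl K 𝔤 (Module.finBasis K 𝔲 s : 𝔤))) P :
            Localization.Away P →ₗ[K] Localization.Away P))) fun _ _ _ => rfl) ρ
  have e2 : ∀ t, ∑ s, LinearMap.mulLeft K (h.sigmaCoeff Q hd s t) ∘ₗ
      (awayHom h.res P Q hQ).toLinearMap ∘ₗ
        (awayDer (dress (Double.inl K 𝔤 (Module.finBasis K 𝔲 s : 𝔤))) P :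
          Localization.Away P →ₗ[K] Localization.Away P) =
      -((awayHom h.res P Q hQ).toLinearMap ∘ₗ (awayDer (leftDer (h.uCoord t)) P :
        Localization.Away P →ₗ[K] Localization.Away P)) := by
    intro t
    ext1 z
    simp only [LinearMap.sum_apply, LinearMap.comp_apply, LinearMap.neg_apply,
      AlgHom.toLinearMap_apply, Derivation.coeFn_coe, LinearMap.mulLeft_apply,
      h.awayHom_awayDer_dress_of_mem P Q hQ (Module.finBasis K 𝔲 _).2, Finset.mul_sum]
    rw [Finset.sum_comm]
    -- Here `σ` is contracted through its first index, so the inverse relation appears with `ω`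
    -- transposed; skewness of `ω` accounts for the sign.
    have e3 : ∀ m, ∑ s, h.sigmaCoeff Q hd s t *
        algebraMap _ (Localization.Away Q) (h.res (om K 𝔤 (Module.finBasis K 𝔲 m : 𝔤)
          (Module.finBasis K 𝔲 s : 𝔤))) = -if m = t then 1 else 0 := by
      intro m
      rw [← h.sum_sigmaCoeff_left Q hd m t, ← Finset.sum_neg_distrib]
      refine Finset.sum_congr rfl fun s _ => ?_
      rw [← resForm_apply, h.resForm_skew Q (Module.finBasis K 𝔲 s : 𝔤)]
      ring
    simp only [← mul_assoc, ← Finset.sum_mul, e3]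
    simp
  simp only [sigmaAway, map_sum, LinearMap.rTensor_tmul, mapTwo, TensorProduct.map_tmul,
    LieHom.coe_toLinearMap, e1]
  rw [Finset.sum_comm, ← Finset.sum_neg_distrib]
  refine Finset.sum_congr rfl fun t _ => ?_
  have e4 := congrArg (fun F => TensorProduct.map
    ((TensorProduct.mk K (𝔞 ⊗[K] 𝔞) 𝔞).flip (j (Module.finBasis K 𝔲 t))) F ρ) (e2 t)
  simp only [← neg_one_smul K (LinearMap.comp _ _), TensorProduct.map_smul_right] at e4
  rw [insertRes, ← neg_one_smul K]
  refine Eq.trans ?_ e4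
  rw [← TensorProduct.mapBilinear_apply, map_sum, LinearMap.sum_apply]
  rfl

/-- The restriction of a dynamical `r`-matrix plus `σ_𝔩^𝔤` is a dynamical `r`-matrix, for any common
denominator `Q`. -/
theorem isPLDynamicalRMatrix_add (hj : IsLieBialgebraInclusion j) (hQ0 : Q ≠ 0)
    (Z : (𝔞 ⊗[K] 𝔞) ⊗[K] 𝔞) (ρ : (𝔞 ⊗[K] 𝔞) ⊗[K] Localization.Away P)
    (hρ : IsPLDynamicalRMatrix j Z P ρ) :
    IsPLDynamicalRMatrix (j.comp i) Z Q ((awayHom h.res P Q hQ).toLinearMap.lTensor _ ρ +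
      (mapTwo j).rTensor _ (h.sigmaAway Q hd)) := by
  have hρa : (TensorProduct.comm K 𝔞 𝔞).toLinearMap.rTensor (Localization.Away Q)
      ((awayHom h.res P Q hQ).toLinearMap.lTensor _ ρ) =
      -(awayHom h.res P Q hQ).toLinearMap.lTensor _ ρ := by
    rw [rTensor_lTensor_apply, hρ.antisymm, map_neg]
  have hσa : (TensorProduct.comm K 𝔞 𝔞).toLinearMap.rTensor (Localization.Away Q)
      ((mapTwo j).rTensor _ (h.sigmaAway Q hd)) = -(mapTwo j).rTensor _ (h.sigmaAway Q hd) := by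
    rw [comm_mapTwo, h.sigmaAway_antisymm, map_neg]
  refine ⟨hQ0, ?_, fun a => ?_, ?_⟩
  · rw [map_add, hρa, hσa, neg_add]
  · have e1 := congrArg ((awayHom h.res P Q hQ).toLinearMap.lTensor (𝔞 ⊗[K] 𝔞))
      (hρ.equivariant (i a))
    have e2 := congrArg ((mapTwo j).rTensor (Localization.Away Q)) (h.sigmaAway_equivariant Q hd a)
    rw [map_add, map_zero, ← rTensor_lTensor_apply, ← LinearMap.comp_apply,
      ← LinearMap.lTensor_comp] at e1
    rw [map_add, map_zero, rTensor_lTensor_apply, ← toEnd_mapTwo] at e2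
    have e3 : (awayHom h.res P Q hQ).toLinearMap ∘ₗ
        (awayDer (FormalFun.dress (LieBialgebra.Double.inl K 𝔤 (i a))) P :
          Localization.Away P →ₗ[K] Localization.Away P) =
        (awayDer (FormalFun.dress (LieBialgebra.Double.inl K 𝔩 a)) Q :
          Localization.Away Q →ₗ[K] Localization.Away Q) ∘ₗ
            (awayHom h.res P Q hQ).toLinearMap :=
      LinearMap.ext fun z => h.awayHom_awayDer_dress_incl P Q hQ a z
    rw [e3, LinearMap.lTensor_comp, LinearMap.comp_apply] at e1
    rw [map_add, map_add, LieHom.comp_apply, add_add_add_comm, e1, e2, add_zero]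
  -- The equation for `ρ` is restricted to `L*`; its transversal derivatives are rewritten as the
  -- mixed bracket of `ρ` and `σ`. Adding the equation for `σ`, whose right hand side is zero, gives
  -- the equation for the sum by `CYB_add`.
  · have e1 := congrArg ((awayHom h.res P Q hQ).toLinearMap.lTensor ((𝔞 ⊗[K] 𝔞) ⊗[K] 𝔞))
      hρ.dynamical_yang_baxter
    rw [map_add, map_add, ← CYB_lTensor, ← rTensor_lTensor_apply, ← rTensor_lTensor_apply,
      h.lTensor_dL P Q hQ j, LinearMap.lTensor_tmul, AlgHom.toLinearMap_apply, map_one,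
      sub_eq_add_neg, ← h.lieThird_sigma P Q hQ hd j ρ hρ.equivariant, map_add] at e1
    have e2 := congrArg ((mapThree j).rTensor (Localization.Away Q)) (h.sigmaAway_dybe Q hd)
    rw [map_add, map_add, map_zero, ← CYB_mapTwo, ← Alt_mapThree, ← dL_mapTwo,
      LinearMap.rTensor_comp, LinearMap.comp_apply, ← Alt_mapThree,
      ← rTensor_δ_mapTwo j hj] at e2
    rw [← e1, CYB_add hρa hσa, dL_add, map_add, map_add, LinearMap.rTensor_comp,
      LinearMap.comp_apply, LinearMap.comp_apply, ← sub_eq_zero]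
    refine Eq.trans ?_ e2
    abel

end IsSplitting

theorem mainTheorem2 {K : Type*} [Field K] [CharZero K]
    {𝔩 𝔤 𝔞 : Type*}
    [LieRing 𝔩] [LieAlgebra K 𝔩] [LieBialgebra K 𝔩] [FiniteDimensional K 𝔩]
    [LieRing 𝔤] [LieAlgebra K 𝔤] [LieBialgebra K 𝔤] [FiniteDimensional K 𝔤]
    [LieRing 𝔞] [LieAlgebra K 𝔞] [LieBialgebra K 𝔞]
    (i : 𝔩 →ₗ⁅K⁆ 𝔤) (𝔲 : Submodule K 𝔤) (h : IsSplitting i 𝔲) (hnd : h.Nondegenerate)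
    (j : 𝔤 →ₗ⁅K⁆ 𝔞) (hj : IsLieBialgebraInclusion j)
    (Z : (𝔞 ⊗[K] 𝔞) ⊗[K] 𝔞) (hZ : IsInvariantTrivector Z)
    (P : FormalFun K 𝔤) (hP : h.res P ≠ 0)
    (ρ : (𝔞 ⊗[K] 𝔞) ⊗[K] Localization.Away P) (hρ : IsPLDynamicalRMatrix j Z P ρ) :
    IsPLDynamicalRMatrix (j.comp i) Z (h.res P * h.detP)
      (h.restrict P ρ + h.sigmaIn j P) := by
  rw [h.sigmaIn_eq]
  exact h.isPLDynamicalRMatrix_add P _ (dvd_mul_right _ _) (dvd_mul_left _ _) j hj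
    (mul_ne_zero hP (h.detP_ne_zero hnd)) Z ρ hρ
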